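/- Let $d_u,d_y,J\ge 1$ be integers, let $\Psi:\mathbb R^{d_u}\to\mathbb R^{d_u}$ be (Borel) measurable, let $h:\mathbb R^{d_u}\to\mathbb R^{d_y}$, let $\Sigma\in\mathbb R^{d_u\times d_u}$, $\Gamma\in\mathbb R^{d_y\times d_y}$ be symmetric matrices, and let $y_1^\dagger,\dots,y_J^\dagger\in\mathbb R^{d_y}$ be data. Write $|\cdot|$ for the Euclidean norm and $\mathcal N(m,A)(\cdot)$ for the Lebesgue density of the Gaussian with mean $m$ and covariance $A$. *Operators.* For a probability measure $\mu$ on $\mathbb R^{d_u}$, let $\mathsf P\mu$ have density $\mathsf P\mu(u)=\int \mathcal N(\Psi(v),\Sigma)(u)\,\mu(dv)$, and let $\mathsf Q\mathsf P\mu$ be the probability measure on $\mathbb R^{d_u}\times\mathbb R^{d_y}$ with density $\mathsf Q\mathsf P\mu(u,y)=\mathcal N(h(u),\Gamma)(y)\,\mathsf P\mu(u)$. For $0\le j\le J-1$, $\mathsf B_j$ is conditioning on the datum $y_{j+1}^\dagger$: it sends a joint density $p(u,y)$ to the measure with density $$\mathsf B_j p(u)=\frac{p(u,y_{j+1}^\dagger)}{\int_{\mathbb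 R^{d_u}}p(U,y_{j+1}^\dagger)\,dU}.$$ For a probability measure $\pi$ on $\mathbb R^{d_u}\times\mathbb R^{d_y}$ with finite second moment and covariance blocks $\mathcal C^{uu}(\pi),\mathcal C^{uy}(\pi),\mathcal C^{yy}(\pi)$, with $\mathcal C^{yy}(\pi)$ invertible, $\mathsf T_j\pi$ is the pushforward of $\pi$ under $(u,y)\mapsto u+\mathcal C^{uy}(\pi)\,\mathcal C^{yy}(\pi)^{-1}(y_{j+1}^\dagger-y)$. The Gaussian projection $\mathsf G\pi$ is the Gaussian measure with the same mean and covariance as $\pi$. The weighted total variation distance is $$d_g(\nu_1,\nu_2)=\sup_{|f|\le g}\Bigl|\int f\,d\nu_1-\int f\,d\nu_2\Bigr|,\qquad g(x)=1+|x|^2,$$ the supremum being over measurable $f$. *Assumption H.* There are positive constants $\kappa_y,\kappa_\Psi,\kappa_h,\ell_h$ such that $|y_j^\dagger|\le\kappa_y$ for $1\le j\le J$; $\Sigma$ and $\Gamma$ are positive definite; $|\Psi(u)|\le\kappa_\Psi(1+|u|)$ and $|h(u)|\le\kappa_h(1+|u|)$ for all $u$; and $|h(u)-h(v)|\le\ell_h|u-v|$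 for all $u,v$. **Theorem.** Suppose that Assumption H holds, that $\mu_0=\mu_0^{\rm EK}$ is a Gaussian measure on $\mathbb R^{d_u}$, and that $$\mu_{j+1}=\mathsf B_j\mathsf Q\mathsf P\mu_j,\qquad \mu^{\rm EK}_{j+1}=\mathsf T_j\mathsf Q\mathsf P\mu^{\rm EK}_j,\qquad 0\le j\le J-1 .$$ Then the distances below are finite and $$d_g(\mu_J^{\rm EK},\mu_J)\le C\max_{0\le j\le J-1}d_g\bigl(\mathsf Q\mathsf P\mu_j,\ \mathsf G\mathsf Q\mathsf P\mu_j\bigr),$$ where $C<\infty$ depends only on $d_u$, $d_y$, $J$, $\kappa_y$, $\kappa_\Psi$, $\kappa_h$, $\ell_h$, $\Sigma$, $\Gamma$ and an upper bound for the moment $\int|x|^{q}\,\mu_0(dx)$ of order $q=\max\{3+d_u,4+d_y\}$. -/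

import Mathlib

open MeasureTheory ProbabilityTheory
open scoped ENNReal NNReal Matrix

noncomputable section

namespace EnKF

/-- The Euclidean space `ℝⁿ`. -/
abbrev Vec (n : ℕ) := EuclideanSpace ℝ (Fin n)

/-- The joint state and data space `ℝ^dᵤ × ℝ^d_y`, with its Euclidean norm
`‖(u, y)‖² = ‖u‖² + ‖y‖²`; the coordinates of `u` are indexed by `Sum.inl`, those of `y` by
`Sum.inr`. -/
abbrev Joint (du dy : ℕ) := EuclideanSpace ℝ (Fin du ⊕ Fin dy)

/-- The state component `u` of a point `(u, y)` of the joint space. -/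
def Joint.u {du dy : ℕ} (z : Joint du dy) : Vec du := WithLp.toLp 2 fun i => z (Sum.inl i)

/-- The data component `y` of a point `(u, y)` of the joint space. -/
def Joint.y {du dy : ℕ} (z : Joint du dy) : Vec dy := WithLp.toLp 2 fun i => z (Sum.inr i)

/-- The polynomial moment `∫ |x|^q μ(dx)`. -/
def moment {n : ℕ} (q : ℕ) (μ : Measure (Vec n)) : ℝ := ∫ x, ‖x‖ ^ q ∂μ

/-- The mean `∫ x μ(dx)`. -/
def mean {ι : Type*} [Fintype ι] (μ : Measure (EuclideanSpace ℝ ι)) : EuclideanSpace ℝ ι :=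
  ∫ x, x ∂μ

/-- The covariance matrix of `μ`. -/
def cov {ι : Type*} [Fintype ι] (μ : Measure (EuclideanSpace ℝ ι)) : Matrix ι ι ℝ :=
  Matrix.of fun i j => ProbabilityTheory.covariance (fun x => x i) (fun x => x j) μ

/-- The Gaussian projection: the Gaussian measure with the mean and the covariance of `μ`. -/
def gaussProj {ι : Type*} [Fintype ι] [DecidableEq ι] (μ : Measure (EuclideanSpace ℝ ι)) :
    Measure (EuclideanSpace ℝ ι) :=
  multivariateGaussian (mean μ) (cov μ)

/-- The weighted total variation distance `sup_{|f| ≤ g} |μ[f] - ν[f]|`, `g(x) = 1 + |x|²`, over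
measurable `f`, as an extended nonnegative number. (All such `f` are integrable for the measures
with finite second moment, on which this is used.) -/
def dg {ι : Type*} [Fintype ι] (μ ν : Measure (EuclideanSpace ℝ ι)) : ℝ≥0∞ :=
  ⨆ (f : EuclideanSpace ℝ ι → ℝ) (_ : Measurable f) (_ : ∀ x, |f x| ≤ 1 + ‖x‖ ^ 2),
    ENNReal.ofReal |(∫ x, f x ∂μ) - ∫ x, f x ∂ν|

/-- The Lebesgue density at `x` of the centred Gaussian `N(0, S)`, for positive definite `S`:
`((2π)^n det S)^{-1/2} exp(-½ xᵀ S⁻¹ x)`. -/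
def gaussDensity {n : ℕ} (S : Matrix (Fin n) (Fin n) ℝ) (x : Vec n) : ℝ :=
  (Real.sqrt ((2 * Real.pi) ^ n * S.det))⁻¹ *
    Real.exp (-(1 / 2) * (WithLp.ofLp x ⬝ᵥ (S⁻¹ *ᵥ WithLp.ofLp x)))

/-- The Lebesgue density of the prediction `P μ`, the law of `Ψ(v) + ξ` with `v ∼ μ` and
`ξ ∼ N(0, S)` independent: `(P μ)(u) = ∫ N(Ψ(v), S)(u) μ(dv)`. -/
def predDensity {du : ℕ} (Ψ : Vec du → Vec du) (S : Matrix (Fin du) (Fin du) ℝ)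
    (μ : Measure (Vec du)) (u : Vec du) : ℝ≥0∞ :=
  ∫⁻ v, ENNReal.ofReal (gaussDensity S (u - Ψ v)) ∂μ

/-- The operator `Q` on densities: `(Q ρ)(u, y) = N(h(u), Γ)(y) ρ(u)`. -/
def liftDensity {du dy : ℕ} (h : Vec du → Vec dy) (Γ : Matrix (Fin dy) (Fin dy) ℝ)
    (ρ : Vec du → ℝ≥0∞) (u : Vec du) (y : Vec dy) : ℝ≥0∞ :=
  ENNReal.ofReal (gaussDensity Γ (y - h u)) * ρ u

/-- The joint density of `Q P μ`. -/
def jointDensity {du dy : ℕ} (Ψ : Vec du → Vec du) (h : Vec du → Vec dy)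
    (S : Matrix (Fin du) (Fin du) ℝ) (Γ : Matrix (Fin dy) (Fin dy) ℝ)
    (μ : Measure (Vec du)) : Vec du → Vec dy → ℝ≥0∞ :=
  liftDensity h Γ (predDensity Ψ S μ)

/-- The probability measure on the joint space with Lebesgue density `p`. -/
def ofJointDensity {du dy : ℕ} (p : Vec du → Vec dy → ℝ≥0∞) : Measure (Joint du dy) :=
  (volume : Measure (Joint du dy)).withDensity fun z => p z.u z.y

/-- The measure `Q P μ` on the joint space. -/
def QP {du dy : ℕ} (Ψ : Vec du → Vec du) (h : Vec du → Vec dy)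
    (S : Matrix (Fin du) (Fin du) ℝ) (Γ : Matrix (Fin dy) (Fin dy) ℝ)
    (μ : Measure (Vec du)) : Measure (Joint du dy) :=
  ofJointDensity (jointDensity Ψ h S Γ μ)

/-- Conditioning on the datum `y†`: the measure with Lebesgue density
`u ↦ p(u, y†) / ∫ p(U, y†) dU`. As it evaluates the joint density on the slice `y = y†`, which is
Lebesgue null, this operator acts on the density function `p` itself. -/
def condition {du dy : ℕ} (ydag : Vec dy) (p : Vec du → Vec dy → ℝ≥0∞) : Measure (Vec du) :=
  (volume : Measure (Vec du)).withDensity fun u => p u ydag / ∫⁻ U, p U ydag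

/-- The Kalman transport map `(u, y) ↦ u + C^{uy}(π) C^{yy}(π)⁻¹ (y† - y)`. -/
def kalmanMap {du dy : ℕ} (π : Measure (Joint du dy)) (ydag : Vec dy) (z : Joint du dy) : Vec du :=
  z.u + Matrix.toEuclideanLin ((cov π).toBlocks₁₂ * ((cov π).toBlocks₂₂)⁻¹) (ydag - z.y)

/-- The mean field ensemble Kalman analysis map: the pushforward of `π` by its Kalman transport
map. -/
def kalmanTransport {du dy : ℕ} (ydag : Vec dy) (π : Measure (Joint du dy)) : Measure (Vec du) :=
  π.map (kalmanMap π ydag)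

/-- `μ₀, …, μ_J` is the true filter: `μ_{j+1} = B_j Q P μ_j`, where `B_j` conditions on the
datum `y_{j+1}`. -/
def IsTrueFilter {du dy : ℕ} (J : ℕ) (Ψ : Vec du → Vec du) (h : Vec du → Vec dy)
    (S : Matrix (Fin du) (Fin du) ℝ) (Γ : Matrix (Fin dy) (Fin dy) ℝ) (y : ℕ → Vec dy)
    (μ : ℕ → Measure (Vec du)) : Prop :=
  ∀ j < J, μ (j + 1) = condition (y (j + 1)) (jointDensity Ψ h S Γ (μ j))

/-- `μ₀, …, μ_J` is the mean field ensemble Kalman filter: `μ_{j+1} = T_j Q P μ_j`, where `T_j`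
uses the datum `y_{j+1}`. -/
def IsMeanFieldEnKF {du dy : ℕ} (J : ℕ) (Ψ : Vec du → Vec du) (h : Vec du → Vec dy)
    (S : Matrix (Fin du) (Fin du) ℝ) (Γ : Matrix (Fin dy) (Fin dy) ℝ) (y : ℕ → Vec dy)
    (μ : ℕ → Measure (Vec du)) : Prop :=
  ∀ j < J, μ (j + 1) = kalmanTransport (y (j + 1)) (QP Ψ h S Γ (μ j))

/-- The standing assumption on the data, the vector fields and the noise covariances, with the
constants `κy, κΨ, κh, ℓh`. -/
structure AssumptionH {du dy : ℕ} (J : ℕ) (κy κΨ κh ℓh : ℝ) (Ψ : Vec du → Vec du)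
    (h : Vec du → Vec dy) (S : Matrix (Fin du) (Fin du) ℝ) (Γ : Matrix (Fin dy) (Fin dy) ℝ)
    (y : ℕ → Vec dy) : Prop where
  data_bound : ∀ j, 1 ≤ j → j ≤ J → ‖y j‖ ≤ κy
  posDef_S : S.PosDef
  posDef_Γ : Γ.PosDef
  growth_Ψ : ∀ u, ‖Ψ u‖ ≤ κΨ * (1 + ‖u‖)
  growth_h : ∀ u, ‖h u‖ ≤ κh * (1 + ‖u‖)
  lipschitz_h : ∀ u v, ‖h u - h v‖ ≤ ℓh * ‖u - v‖

/-- `max_{0 ≤ j ≤ J-1} d_g(Q P μ_j, G Q P μ_j)`. -/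
def maxGap {du dy : ℕ} (J : ℕ) (Ψ : Vec du → Vec du) (h : Vec du → Vec dy)
    (S : Matrix (Fin du) (Fin du) ℝ) (Γ : Matrix (Fin dy) (Fin dy) ℝ)
    (μ : ℕ → Measure (Vec du)) : ℝ≥0∞ :=
  (Finset.range J).sup fun j => dg (QP Ψ h S Γ (μ j)) (gaussProj (QP Ψ h S Γ (μ j)))

end EnKF

end

/-! Write `ν` for a law of the ensemble filter and `μ` for the true one at the same time. One step
is split by the triangle inequality into three distances: `T QPν` to `T QPμ`, `T QPμ` to `T G QPμ`,
and `T G QPμ` to `B QPμ`. The second is easy: `QPμ` and `G QPμ` have the same covariance, so one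
affine map of quadratic weight growth transports both. With the other two bounds a step gives
`e_{j+1} ≤ C (e_j + gap_j)`, and induction on the time closes the argument.

For the first distance, `QP` is Lipschitz in `dg` because a Markov kernel with linearly growing
samples preserves the weight. The map `T` is nonlinear through its gain. The covariance of `QPμ` is
bounded above by moments and below by the noise, so the gain is Lipschitz in the covariance, hence
in `dg` (`exists_covBounds_QP`, `CovBounds.norm_gain_sub_le`). Test functions are only measurable,
so the effect of a change of gain is moved to the density by a volume preserving shear. The Gaussian
noise makes the density of `QPμ` differentiable enough in `u` to pay for it
(`exists_dg_map_aff_le`).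

For the third distance, the analysis variable and the datum are independent under a Gaussian law, so
its density factors (`exists_gaussian_density`). On the slice `y = y†` the first factor is the
density of `T G QPμ`, which is thus the normalized slice. It remains to compare the slices of two
joint densities, although the slice is Lebesgue null. Along a fibre of constant `u` both densities
are exponentials of quadratic polynomials in `y`. The third difference of a quadratic vanishes, so a
pointwise difference at `y†` is controlled by differences at shifted points, and averaging over the
shifts gives the `L¹` norm along the fibre (`QuadraticAt.ofReal_abs_exp_sub_exp_le`). Integration
over `u` yields `dg`, and normalization is stable since the mass of the slice is bounded below
(`dg_withDensity_div_le`, `exists_le_lintegral_jointDensity`).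

Fourth moments are enough throughout and propagate along both filters. Every estimate chooses its
constant before the vector fields and the measures, so that the final constant depends only on the
admissible quantities. -/

noncomputable section

set_option linter.unusedSectionVars false

namespace EnKF

open scoped RealInnerProductSpace

open scoped RealInnerProductSpace MatrixOrder

/-! ### Quadratic forms and inverses of positive definite matrices -/

section Quad

variable {ι : Type*} [Fintype ι] [DecidableEq ι]

/-- The quadratic form `xᵀ A x` of a matrix. -/
def quad (A : Matrix ι ι ℝ) (x : EuclideanSpace ℝ ι) : ℝ :=
  WithLp.ofLp x ⬝ᵥ (A *ᵥ WithLp.ofLp x)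

lemma quad_eq_inner (A : Matrix ι ι ℝ) (x : EuclideanSpace ℝ ι) :
    quad A x = ⟪x, Matrix.toEuclideanCLM (𝕜 := ℝ) A x⟫ := by
  rw [Matrix.inner_toEuclideanCLM]; simp [quad]

@[fun_prop]
lemma continuous_quad (A : Matrix ι ι ℝ) : Continuous (quad A) := by
  simp_rw [funext (quad_eq_inner A)]
  fun_prop

lemma quad_add_smul (A : Matrix ι ι ℝ) (x v : EuclideanSpace ℝ ι) (t : ℝ) :
    quad A (x + t • v) = quad A x + t * (⟪x, Matrix.toEuclideanCLM (𝕜 := ℝ) A v⟫ +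
      ⟪v, Matrix.toEuclideanCLM (𝕜 := ℝ) A x⟫) + t ^ 2 * quad A v := by
  simp only [quad_eq_inner, map_add, map_smul, inner_add_left, inner_add_right,
    inner_smul_left, inner_smul_right, RCLike.conj_to_real]
  ring

lemma quad_smul (A : Matrix ι ι ℝ) (v : EuclideanSpace ℝ ι) (t : ℝ) :
    quad A (t • v) = t ^ 2 * quad A v := by
  simpa [quad] using quad_add_smul A 0 v t

lemma abs_quad_sub_quad_le (A : Matrix ι ι ℝ) (x y : EuclideanSpace ℝ ι) :
    |quad A x - quad A y| ≤ ‖Matrix.toEuclideanCLM (𝕜 := ℝ) A‖ * (‖x - y‖ * (‖x‖ + ‖y‖)) := by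
  set L := Matrix.toEuclideanCLM (𝕜 := ℝ) A
  have h : quad A x - quad A y = ⟪x - y, L x⟫ + ⟪y, L (x - y)⟫ := by
    simp only [quad_eq_inner, map_sub, inner_sub_left, inner_sub_right, L]; ring
  rw [h]
  refine (abs_add_le _ _).trans ?_
  have h1 := abs_real_inner_le_norm (x - y) (L x)
  have h2 := abs_real_inner_le_norm y (L (x - y))
  have h3 := mul_le_mul_of_nonneg_left (L.le_opNorm x) (norm_nonneg (x - y))
  have h4 := mul_le_mul_of_nonneg_left (L.le_opNorm (x - y)) (norm_nonneg y)
  linarith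

omit [DecidableEq ι] in
lemma quad_pos {A : Matrix ι ι ℝ} (hA : A.PosDef) {x : EuclideanSpace ℝ ι} (hx : x ≠ 0) :
    0 < quad A x := by
  have := hA.dotProduct_mulVec_pos (x := WithLp.ofLp x) (by simpa using hx)
  simpa [quad] using this

omit [DecidableEq ι] in
lemma quad_nonneg {A : Matrix ι ι ℝ} (hA : A.PosSemidef) (x : EuclideanSpace ℝ ι) :
    0 ≤ quad A x := by
  have := hA.dotProduct_mulVec_nonneg (WithLp.ofLp x)
  simpa [quad] using this

/-- A continuous positive function has a positive minimum on the compact unit sphere; homogeneity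
extends the bound to all vectors. -/
lemma exists_mul_norm_sq_le_quad {A : Matrix ι ι ℝ} (hA : A.PosDef) :
    ∃ c : ℝ, 0 < c ∧ ∀ x, c * ‖x‖ ^ 2 ≤ quad A x := by
  rcases isEmpty_or_nonempty ι with h | h
  · exact ⟨1, one_pos, fun x => by simp [Subsingleton.elim x 0, quad]⟩
  obtain ⟨x₀, hx₀, hmin⟩ := (isCompact_sphere (0 : EuclideanSpace ℝ ι) 1).exists_isMinOn
    (NormedSpace.sphere_nonempty.2 zero_le_one) (continuous_quad A).continuousOn
  have hx₀' : x₀ ≠ 0 := by rintro rfl; simp at hx₀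
  refine ⟨quad A x₀, quad_pos hA hx₀', fun x => ?_⟩
  rcases eq_or_ne x 0 with rfl | hx
  · simp [quad]
  have hx' : ‖x‖ ≠ 0 := norm_ne_zero_iff.2 hx
  have h1 : quad A x₀ ≤ quad A (‖x‖⁻¹ • x) := hmin (by simp [norm_smul, hx'])
  rw [quad_smul] at h1
  calc quad A x₀ * ‖x‖ ^ 2 ≤ (‖x‖⁻¹ ^ 2 * quad A x) * ‖x‖ ^ 2 := by gcongr
    _ = quad A x := by field_simp

omit [DecidableEq ι] in
lemma posDef_of_mul_norm_sq_le_quad {A : Matrix ι ι ℝ} (hA : A.IsHermitian) {c : ℝ} (hc : 0 < c)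
    (h : ∀ x, c * ‖x‖ ^ 2 ≤ quad A x) : A.PosDef := by
  refine Matrix.PosDef.of_dotProduct_mulVec_pos hA fun x hx => ?_
  have h1 := h (WithLp.toLp 2 x)
  have : 0 < c * ‖WithLp.toLp 2 x‖ ^ 2 := by
    have : 0 < ‖WithLp.toLp 2 x‖ := by simpa using hx
    positivity
  simpa [quad] using this.trans_le h1

lemma toEuclideanCLM_apply_inv {A : Matrix ι ι ℝ} (hA : A.PosDef) (x : EuclideanSpace ℝ ι) :
    Matrix.toEuclideanCLM (𝕜 := ℝ) A (Matrix.toEuclideanCLM (𝕜 := ℝ) A⁻¹ x) = x := by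
  rw [← mul_apply_eq_comp, ← map_mul, Matrix.mul_nonsing_inv _
    ((Matrix.isUnit_iff_isUnit_det A).1 hA.isUnit)]
  simp

/-- With `w = A⁻¹ x` one has `c ‖w‖² ≤ ⟪w, x⟫ ≤ ‖w‖ ‖x‖`. The bound sees `A` only through `c`, which
makes later constants uniform over covariance matrices. -/
lemma norm_inv_apply_le {A : Matrix ι ι ℝ} (hA : A.PosDef) {c : ℝ} (hc : 0 < c)
    (h : ∀ x, c * ‖x‖ ^ 2 ≤ quad A x) (x : EuclideanSpace ℝ ι) :
    ‖Matrix.toEuclideanCLM (𝕜 := ℝ) A⁻¹ x‖ ≤ c⁻¹ * ‖x‖ := by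
  set w := Matrix.toEuclideanCLM (𝕜 := ℝ) A⁻¹ x with hw
  have h1 := h w
  rw [quad_eq_inner, toEuclideanCLM_apply_inv hA] at h1
  have h2 := real_inner_le_norm w x
  rcases (norm_nonneg w).eq_or_lt with h0 | h0
  · rw [← h0]; positivity
  have : c * ‖w‖ ≤ ‖x‖ := by nlinarith
  rw [inv_mul_eq_div, le_div_iff₀ hc]; linarith

lemma norm_toEuclideanCLM_inv_le {A : Matrix ι ι ℝ} (hA : A.PosDef) {c : ℝ} (hc : 0 < c)
    (h : ∀ x, c * ‖x‖ ^ 2 ≤ quad A x) :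
    ‖Matrix.toEuclideanCLM (𝕜 := ℝ) A⁻¹‖ ≤ c⁻¹ :=
  ContinuousLinearMap.opNorm_le_bound _ (by positivity) (norm_inv_apply_le hA hc h)

lemma quad_inv_le {A : Matrix ι ι ℝ} (hA : A.PosDef) {c : ℝ} (hc : 0 < c)
    (h : ∀ x, c * ‖x‖ ^ 2 ≤ quad A x) (x : EuclideanSpace ℝ ι) :
    quad A⁻¹ x ≤ c⁻¹ * ‖x‖ ^ 2 := by
  rw [quad_eq_inner]
  have h1 := norm_inv_apply_le hA hc h x
  have h2 := real_inner_le_norm x (Matrix.toEuclideanCLM (𝕜 := ℝ) A⁻¹ x)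
  nlinarith [norm_nonneg x]

end Quad

/-! ### The explicit Gaussian density and the Gaussian measure -/

section Density

variable {n : ℕ}

/-- The normalising constant of the Gaussian density. -/
def gaussConst (S : Matrix (Fin n) (Fin n) ℝ) : ℝ := (Real.sqrt ((2 * Real.pi) ^ n * S.det))⁻¹

lemma gaussDensity_eq (S : Matrix (Fin n) (Fin n) ℝ) (x : Vec n) :
    gaussDensity S x = gaussConst S * Real.exp (-(1 / 2) * quad S⁻¹ x) := rfl

lemma gaussConst_pos {S : Matrix (Fin n) (Fin n) ℝ} (hS : S.PosDef) : 0 < gaussConst S := by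
  have := hS.det_pos
  unfold gaussConst; positivity

lemma gaussDensity_pos {S : Matrix (Fin n) (Fin n) ℝ} (hS : S.PosDef) (x : Vec n) :
    0 < gaussDensity S x := by
  rw [gaussDensity_eq]; exact mul_pos (gaussConst_pos hS) (Real.exp_pos _)

lemma gaussDensity_le {S : Matrix (Fin n) (Fin n) ℝ} (hS : S.PosDef) (x : Vec n) :
    gaussDensity S x ≤ gaussConst S := by
  rw [gaussDensity_eq]
  have h1 := gaussConst_pos hS
  have h2 := quad_nonneg hS.inv.posSemidef x
  have : Real.exp (-(1 / 2) * quad S⁻¹ x) ≤ 1 := Real.exp_le_one_iff.2 (by linarith)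
  nlinarith

@[fun_prop]
lemma continuous_gaussDensity (S : Matrix (Fin n) (Fin n) ℝ) : Continuous (gaussDensity S) := by
  simp_rw [funext (gaussDensity_eq S)]
  fun_prop

@[fun_prop]
lemma measurable_gaussDensity (S : Matrix (Fin n) (Fin n) ℝ) : Measurable (gaussDensity S) :=
  (continuous_gaussDensity S).measurable

lemma integrable_gaussDensity_one : Integrable (gaussDensity (1 : Matrix (Fin n) (Fin n) ℝ)) := by
  have h := GaussianFourier.integrable_cexp_neg_mul_sq_norm_add (V := Vec n) (b := 1 / 2)
    (by norm_num) 0 0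
  have h2 := (h.re.const_mul (gaussConst (1 : Matrix (Fin n) (Fin n) ℝ)))
  refine h2.congr (ae_of_all _ fun x => ?_)
  have e1 : quad (1 : Matrix (Fin n) (Fin n) ℝ) x = ‖x‖ ^ 2 := by
    rw [quad_eq_inner]; simp
  have e2 : Complex.exp (-(1 / 2) * (‖x‖ : ℂ) ^ 2 + 0 * ((⟪(0 : Vec n), x⟫ : ℝ) : ℂ))
      = ((Real.exp (-(1 / 2) * ‖x‖ ^ 2) : ℝ) : ℂ) := by
    push_cast; simp
  simp only [gaussDensity_eq, inv_one, e1]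
  rw [e2]; rfl

/-- Both finite measures have the same characteristic function, by the Fourier transform of `exp
(-‖x‖² / 2)`; the constant `gaussConst 1` cancels the factor `(2π)^(n/2)`. -/
lemma withDensity_gaussDensity_one :
    (volume : Measure (Vec n)).withDensity
      (fun x => ENNReal.ofReal (gaussDensity (1 : Matrix (Fin n) (Fin n) ℝ) x)) =
    stdGaussian (Vec n) := by
  have hI := integrable_gaussDensity_one (n := n)
  have : IsFiniteMeasure ((volume : Measure (Vec n)).withDensity
      (fun x => ENNReal.ofReal (gaussDensity (1 : Matrix (Fin n) (Fin n) ℝ) x))) :=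
    isFiniteMeasure_withDensity_ofReal hI.2
  refine Measure.ext_of_charFun ?_
  ext t
  rw [charFun_stdGaussian, charFun_apply, integral_withDensity_eq_integral_toReal_smul
    (by fun_prop) (ae_of_all _ fun _ => ENNReal.ofReal_lt_top)]
  have e1 : ∀ x : Vec n, quad (1 : Matrix (Fin n) (Fin n) ℝ) x = ‖x‖ ^ 2 := fun x => by
    rw [quad_eq_inner]; simp
  have e2 : ∀ x : Vec n, (ENNReal.ofReal (gaussDensity (1 : Matrix (Fin n) (Fin n) ℝ) x)).toReal •
      Complex.exp (⟪x, t⟫ * Complex.I) = (gaussConst (1 : Matrix (Fin n) (Fin n) ℝ) : ℂ) *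
      Complex.exp (-(1 / 2) * (‖x‖ : ℂ) ^ 2 + Complex.I * ((⟪t, x⟫ : ℝ) : ℂ)) := fun x => by
    rw [ENNReal.toReal_ofReal (gaussDensity_pos Matrix.PosDef.one x).le, gaussDensity_eq, inv_one,
      e1, Complex.exp_add, real_inner_comm, Complex.real_smul]
    push_cast
    rw [mul_comm Complex.I, mul_assoc]
  simp_rw [e2]
  rw [integral_const_mul, GaussianFourier.integral_cexp_neg_mul_sq_norm_add (by norm_num)]
  rw [← mul_assoc]
  have e3 : (gaussConst (1 : Matrix (Fin n) (Fin n) ℝ) : ℂ) *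
      ((Real.pi / (1 / 2 : ℂ)) ^ ((Module.finrank ℝ (Vec n) : ℂ) / 2)) = 1 := by
    have : (Real.pi / (1 / 2 : ℂ)) ^ ((Module.finrank ℝ (Vec n) : ℂ) / 2) =
        (((2 * Real.pi) ^ ((n : ℝ) / 2) : ℝ) : ℂ) := by
      rw [Complex.ofReal_cpow (by positivity)]
      simp; congr 1; ring
    rw [this, ← Complex.ofReal_mul, gaussConst, Real.sqrt_eq_rpow, ← Real.rpow_natCast]
    simp only [Matrix.det_one, mul_one]
    rw [← Real.rpow_mul (by positivity), mul_one_div, inv_mul_cancel₀ (by positivity)]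
    simp
  rw [e3, one_mul, Complex.I_sq]
  congr 1; ring

/-- The measure on the right is the image of the standard Gaussian under `x ↦ m + √S x`. The linear
change of variables contributes the Jacobian `|det √S|`, whose square is `det S`. -/
lemma withDensity_gaussDensity {S : Matrix (Fin n) (Fin n) ℝ} (hS : S.PosDef) (m : Vec n) :
    (volume : Measure (Vec n)).withDensity (fun x => ENNReal.ofReal (gaussDensity S (x - m))) =
      multivariateGaussian m S := by
  set A := Matrix.toEuclideanCLM (𝕜 := ℝ) (CFC.sqrt S) with hA
  have hsq : CFC.sqrt S * CFC.sqrt S = S := CFC.sqrt_mul_sqrt_self _ hS.posSemidef.nonneg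
  have hdet2 : (CFC.sqrt S).det * (CFC.sqrt S).det = S.det := by rw [← Matrix.det_mul, hsq]
  have hdetS := hS.det_pos
  have hd : (CFC.sqrt S).det ≠ 0 := fun h => by simp [h] at hdet2; linarith
  have hdet : LinearMap.det (A : Vec n →ₗ[ℝ] Vec n) = (CFC.sqrt S).det := by
    rw [← LinearMap.det_toMatrix (EuclideanSpace.basisFun (Fin n) ℝ).toBasis]
    congr 1
    have := Matrix.coe_toEuclideanCLM_eq_toEuclideanLin (𝕜 := ℝ) (CFC.sqrt S)
    rw [hA, this, Matrix.toEuclideanLin_eq_toLin_orthonormal, LinearMap.toMatrix_toLin]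
  have hdens : ∀ x, gaussDensity (1 : Matrix (Fin n) (Fin n) ℝ) x =
      |(CFC.sqrt S).det| * gaussDensity S (A x) := fun x => by
    rw [gaussDensity_eq, gaussDensity_eq, ← mul_assoc]
    congr 1
    · unfold gaussConst
      rw [← hdet2, Real.sqrt_mul (by positivity) ((CFC.sqrt S).det * _), Real.sqrt_mul_self_eq_abs]
      have : |(CFC.sqrt S).det| ≠ 0 := by simpa using hd
      simp only [Matrix.det_one, mul_one]
      field_simp
    · congr 2
      have hsa : IsSelfAdjoint A := (CFC.sqrt_nonneg S).isSelfAdjoint.map _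
      rw [quad_eq_inner, quad_eq_inner]
      have h1 : A (Matrix.toEuclideanCLM (𝕜 := ℝ) S⁻¹ (A x)) = x := by
        have h2 : CFC.sqrt S * S⁻¹ * CFC.sqrt S = 1 := by
          have hu : IsUnit (CFC.sqrt S).det := isUnit_iff_ne_zero.2 hd
          have hS' : S⁻¹ = (CFC.sqrt S)⁻¹ * (CFC.sqrt S)⁻¹ := by
            rw [← Matrix.mul_inv_rev, hsq]
          rw [hS', ← mul_assoc, Matrix.mul_nonsing_inv _ hu, one_mul, Matrix.nonsing_inv_mul _ hu]
        rw [← mul_apply_eq_comp, ← mul_apply_eq_comp, hA, ← map_mul,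
          ← map_mul, h2]
        simp
      have h3 : ⟪A x, Matrix.toEuclideanCLM (𝕜 := ℝ) S⁻¹ (A x)⟫ =
          ⟪x, A (Matrix.toEuclideanCLM (𝕜 := ℝ) S⁻¹ (A x))⟫ := by
        rw [← ContinuousLinearMap.adjoint_inner_right, hsa.adjoint_eq]
      rw [h3, h1]; simp
  refine Measure.ext_of_lintegral _ fun f hf => ?_
  rw [multivariateGaussian, lintegral_map hf (by fun_prop), ← withDensity_gaussDensity_one,
    lintegral_withDensity_eq_lintegral_mul _ (by fun_prop) hf,
    lintegral_withDensity_eq_lintegral_mul _ (by fun_prop) (by fun_prop)]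
  simp only [Pi.mul_apply]
  set G : Vec n → ℝ≥0∞ := fun x => ENNReal.ofReal (gaussDensity S x) * f (m + x) with hG
  have hGm : Measurable G := by fun_prop
  have hm := Measure.map_linearMap_addHaar_eq_smul_addHaar (volume : Measure (Vec n))
    (f := (A : Vec n →ₗ[ℝ] Vec n)) (by rw [hdet]; exact hd)
  have h4 : ∫⁻ x, G (A x) = ENNReal.ofReal |(CFC.sqrt S).det⁻¹| * ∫⁻ x, G x := by
    rw [← lintegral_map (μ := volume) hGm (g := A) (by fun_prop)]
    have : Measure.map A volume = Measure.map (A : Vec n →ₗ[ℝ] Vec n) volume := rfl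
    rw [this, hm, lintegral_smul_measure, hdet, smul_eq_mul]
  have h5 : ∀ x, ENNReal.ofReal (gaussDensity 1 x) * f (m + A x) =
      ENNReal.ofReal |(CFC.sqrt S).det| * G (A x) := fun x => by
    rw [hdens, ENNReal.ofReal_mul (abs_nonneg _), hG, mul_assoc]
  simp only [← hA, h5]
  rw [lintegral_const_mul _ (by fun_prop), h4, ← mul_assoc, ← ENNReal.ofReal_mul (abs_nonneg _),
    ← abs_mul, mul_inv_cancel₀ hd]
  simp only [abs_one, ENNReal.ofReal_one, one_mul, hG]
  have h6 := lintegral_add_left_eq_self (μ := (volume : Measure (Vec n)))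
    (fun x => ENNReal.ofReal (gaussDensity S (x - m)) * f x) m
  rw [← h6]
  simp only [add_sub_cancel_left]

end Density

/-! ### Pointwise control of differences of exponentials of quadratics -/

section NegExpQuadratic

/-- With `x = exp (-|a|)` and `y = exp (-|b|)` this follows from `x y ≤ exp (-|a + b|)` and `(1 - x)
(1 - y) ≥ 0`. Subadditivity lets a linear relation between exponents pass to the exponentials. -/
lemma one_sub_exp_neg_abs_add_le (a b : ℝ) :
    1 - Real.exp (-|a + b|) ≤ (1 - Real.exp (-|a|)) + (1 - Real.exp (-|b|)) := by
  have h1 : Real.exp (-|a|) * Real.exp (-|b|) ≤ Real.exp (-|a + b|) := by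
    rw [← Real.exp_add]
    exact Real.exp_le_exp.2 (by linarith [abs_add_le a b])
  have h2 : Real.exp (-|a|) ≤ 1 := Real.exp_le_one_iff.2 (by simp)
  have h3 : Real.exp (-|b|) ≤ 1 := Real.exp_le_one_iff.2 (by simp)
  nlinarith

lemma one_sub_exp_neg_abs_le (r : ℝ) : 1 - Real.exp (-|r|) ≤ |1 - Real.exp r| := by
  rcases le_total r 0 with h | h
  · rw [abs_of_nonpos h, neg_neg]; exact le_abs_self _
  · rw [abs_of_nonneg h, abs_sub_comm]
    refine le_trans ?_ (le_abs_self _)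
    have := Real.add_one_le_exp r
    have := Real.add_one_le_exp (-r)
    have h4 : Real.exp r * Real.exp (-r) = 1 := by rw [← Real.exp_add]; simp
    nlinarith [sq_nonneg (Real.exp r - 1), Real.exp_pos r, Real.exp_pos (-r)]

lemma abs_exp_neg_sub_exp_neg (s t : ℝ) :
    |Real.exp (-s) - Real.exp (-t)| = Real.exp (-s) * |1 - Real.exp (s - t)| := by
  rw [← abs_of_pos (Real.exp_pos (-s)), ← abs_mul, abs_of_pos (Real.exp_pos (-s)), mul_sub, mul_one,
    ← Real.exp_add]
  congr 3; ring_nf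

/-- The left side is `exp (-p₀) (1 - exp (-|p₀ - r₀|))`. Subadditivity spreads the second factor
over the exponent differences at the three other points. There `exp (-p₀) ≤ exp (B - pᵢ)`, which
turns each term into a difference of exponentials at that point. -/
lemma exp_neg_sub_exp_neg_le_of_third_difference {p₀ p₁ p₂ p₃ r₀ r₁ r₂ r₃ B : ℝ}
    (h₀ : p₀ ≤ r₀) (h₁ : p₁ ≤ p₀ + B) (h₂ : p₂ ≤ p₀ + B) (h₃ : p₃ ≤ p₀ + B)
    (hp : p₀ - r₀ = 3 * (p₁ - r₁) - 3 * (p₂ - r₂) + (p₃ - r₃)) :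
    Real.exp (-p₀) - Real.exp (-r₀) ≤ 3 * Real.exp B * (|Real.exp (-p₁) - Real.exp (-r₁)| +
      |Real.exp (-p₂) - Real.exp (-r₂)| + |Real.exp (-p₃) - Real.exp (-r₃)|) := by
  have key : ∀ p r : ℝ, p ≤ p₀ + B → Real.exp (-p₀) * (1 - Real.exp (-|p - r|)) ≤
      Real.exp B * |Real.exp (-p) - Real.exp (-r)| := fun p r hpr => by
    rw [abs_exp_neg_sub_exp_neg, ← mul_assoc, ← Real.exp_add]
    have h2 : Real.exp (-|p - r|) ≤ 1 := Real.exp_le_one_iff.2 (by simp)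
    have := one_sub_exp_neg_abs_le (p - r)
    have h3 : Real.exp (-p₀) ≤ Real.exp (B + -p) := Real.exp_le_exp.2 (by linarith)
    exact mul_le_mul h3 this (by linarith) (Real.exp_pos _).le
  have e0 : Real.exp (-p₀) - Real.exp (-r₀) = Real.exp (-p₀) * (1 - Real.exp (-|p₀ - r₀|)) := by
    rw [abs_of_nonpos (by linarith), mul_sub, ← Real.exp_add]; ring_nf
  have k1 := key p₁ r₁ h₁
  have k2 := key p₂ r₂ h₂
  have k3 := key p₃ r₃ h₃
  set a := p₁ - r₁ with ha
  set b := p₂ - r₂ with hb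
  set c := p₃ - r₃ with hc
  -- The differences `a`, `b`, `c` occur with multiplicities 3, 3 and 1, so subadditivity is applied
  -- six times.
  have s : 1 - Real.exp (-|p₀ - r₀|) ≤ 3 * (1 - Real.exp (-|a|)) + 3 * (1 - Real.exp (-|b|)) +
      (1 - Real.exp (-|c|)) := by
    have e : p₀ - r₀ = a + (a + (a + (-b + (-b + (-b + c))))) := by rw [hp]; ring
    rw [e]
    have := one_sub_exp_neg_abs_add_le a (a + (a + (-b + (-b + (-b + c)))))
    have := one_sub_exp_neg_abs_add_le a (a + (-b + (-b + (-b + c))))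
    have := one_sub_exp_neg_abs_add_le a (-b + (-b + (-b + c)))
    have := one_sub_exp_neg_abs_add_le (-b) (-b + (-b + c))
    have := one_sub_exp_neg_abs_add_le (-b) (-b + c)
    have := one_sub_exp_neg_abs_add_le (-b) c
    rw [abs_neg] at *
    linarith
  rw [e0]
  have h5 := mul_le_mul_of_nonneg_left s (Real.exp_pos (-p₀)).le
  have : 0 ≤ Real.exp B * |Real.exp (-p₃) - Real.exp (-r₃)| := by positivity
  linarith

/-- `q` is along every unit direction from `y` a quadratic polynomial with leading coefficient
at most `B`. -/
def QuadraticAt {n : ℕ} (B : ℝ) (q : Vec n → ℝ) (y : Vec n) : Prop :=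
  ∀ v : Vec n, ‖v‖ ≤ 1 → ∃ b c : ℝ, c ≤ B ∧ ∀ t : ℝ, q (y + t • v) = q y + b * t + c * t ^ 2

variable {n : ℕ} {B : ℝ} {q₁ q₂ : Vec n → ℝ} {y : Vec n}

/-- On a line through `y` the difference `q₁ - q₂` is a quadratic, so its value at `0` is determined
by its values at `1, 2, 3`. Only the leading coefficient enters the constant: the line is followed
in the sense in which `q₁` has nonpositive slope. Both senses are kept in the sum because this
choice depends on `v`. -/
lemma QuadraticAt.exp_sub_exp_le (hB : 0 ≤ B) (h₁ : QuadraticAt B q₁ y) (h₂ : QuadraticAt B q₂ y)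
    (h : q₁ y ≤ q₂ y) {v : Vec n} (hv : ‖v‖ ≤ 1) :
    Real.exp (-q₁ y) - Real.exp (-q₂ y) ≤ 3 * Real.exp (9 * B) *
      ∑ k ∈ ({1, 2, 3, -1, -2, -3} : Finset ℝ),
        |Real.exp (-q₁ (y + k • v)) - Real.exp (-q₂ (y + k • v))| := by
  obtain ⟨b₁, c₁, hc₁, e₁⟩ := h₁ v hv
  obtain ⟨b₂, c₂, hc₂, e₂⟩ := h₂ v hv
  -- Since `b₁ s ≤ 0`, the values of `q₁` at steps `1, 2, 3` exceed `q₁ y` by at most `c₁ k² ≤ 9 B`.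
  have main : ∀ s : ℝ, (s = 1 ∨ s = -1) → b₁ * s ≤ 0 →
      Real.exp (-q₁ y) - Real.exp (-q₂ y) ≤ 3 * Real.exp (9 * B) *
        (|Real.exp (-q₁ (y + s • v)) - Real.exp (-q₂ (y + s • v))| +
        |Real.exp (-q₁ (y + (2 * s) • v)) - Real.exp (-q₂ (y + (2 * s) • v))| +
        |Real.exp (-q₁ (y + (3 * s) • v)) - Real.exp (-q₂ (y + (3 * s) • v))|) := by
    intro s hs hb
    have hs2 : s ^ 2 = 1 := by rcases hs with rfl | rfl <;> norm_num
    refine exp_neg_sub_exp_neg_le_of_third_difference h ?_ ?_ ?_ ?_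
    · rw [e₁, hs2]; linarith
    · rw [e₁, mul_pow, hs2]; linarith
    · rw [e₁, mul_pow, hs2]; linarith
    · simp only [e₁, e₂]; ring
  set F : ℝ → ℝ := fun k => |Real.exp (-q₁ (y + k • v)) - Real.exp (-q₂ (y + k • v))| with hF
  have hF0 : ∀ k, 0 ≤ F k := fun k => abs_nonneg _
  have hsum : ∑ k ∈ ({1, 2, 3, -1, -2, -3} : Finset ℝ), F k =
      F 1 + F 2 + F 3 + F (-1) + F (-2) + F (-3) := by
    rw [Finset.sum_insert (by norm_num), Finset.sum_insert (by norm_num),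
      Finset.sum_insert (by norm_num), Finset.sum_insert (by norm_num),
      Finset.sum_insert (by norm_num), Finset.sum_singleton]
    ring
  rw [hsum]
  have hE := Real.exp_pos (9 * B)
  rcases le_total b₁ 0 with hb | hb
  · refine (main 1 (Or.inl rfl) (by linarith)).trans ?_
    norm_num only [mul_one]
    have := hF0 (-1); have := hF0 (-2); have := hF0 (-3)
    refine mul_le_mul_of_nonneg_left ?_ (by positivity)
    change F 1 + F 2 + F 3 ≤ _
    linarith
  · refine (main (-1) (Or.inr rfl) (by linarith)).trans ?_
    norm_num only [mul_neg, mul_one]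
    have := hF0 1; have := hF0 2; have := hF0 3
    refine mul_le_mul_of_nonneg_left ?_ (by positivity)
    change F (-1) + F (-2) + F (-3) ≤ _
    linarith

lemma QuadraticAt.abs_exp_sub_exp_le (hB : 0 ≤ B) (h₁ : QuadraticAt B q₁ y)
    (h₂ : QuadraticAt B q₂ y) {v : Vec n} (hv : ‖v‖ ≤ 1) :
    |Real.exp (-q₁ y) - Real.exp (-q₂ y)| ≤ 3 * Real.exp (9 * B) *
      ∑ k ∈ ({1, 2, 3, -1, -2, -3} : Finset ℝ),
        |Real.exp (-q₁ (y + k • v)) - Real.exp (-q₂ (y + k • v))| := by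
  rcases le_total (q₁ y) (q₂ y) with h | h
  · rw [abs_of_nonneg (sub_nonneg.2 (Real.exp_le_exp.2 (by linarith)))]
    exact h₁.exp_sub_exp_le hB h₂ h hv
  · rw [abs_sub_comm, abs_of_nonneg (sub_nonneg.2 (Real.exp_le_exp.2 (by linarith)))]
    simp_rw [abs_sub_comm (Real.exp (-q₁ (y + _ • v)))]
    exact h₂.exp_sub_exp_le hB h₁ h hv

/-- The dilation contributes the Jacobian `|k|^(-n)`, which is at most one. -/
lemma lintegral_comp_add_smul_le {F : Vec n → ℝ≥0∞} (hF : Measurable F) (y : Vec n) {k : ℝ}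
    (hk : 1 ≤ |k|) : ∫⁻ v, F (y + k • v) ≤ ∫⁻ v, F v := by
  have hk0 : k ≠ 0 := by rintro rfl; norm_num at hk
  have h1 : ∫⁻ v, F (y + k • v) = ∫⁻ w, F (y + w) ∂(Measure.map (fun v : Vec n => k • v) volume) := by
    rw [lintegral_map (by fun_prop) (by fun_prop)]
  rw [h1, Measure.map_addHaar_smul _ hk0, lintegral_smul_measure,
    lintegral_add_left_eq_self (fun x => F x) y, smul_eq_mul]
  refine mul_le_of_le_one_left zero_le ?_
  rw [ENNReal.ofReal_le_one, abs_inv, abs_pow]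
  exact inv_le_one_of_one_le₀ (one_le_pow₀ hk)

/-- A value of the difference of two Gaussian functions is controlled by its `L¹` norm. -/
lemma QuadraticAt.ofReal_abs_exp_sub_exp_le (hB : 0 ≤ B) (h₁ : QuadraticAt B q₁ y)
    (h₂ : QuadraticAt B q₂ y) (hm₁ : Measurable q₁) (hm₂ : Measurable q₂) :
    volume (Metric.closedBall (0 : Vec n) 1) *
      ENNReal.ofReal |Real.exp (-q₁ y) - Real.exp (-q₂ y)| ≤
      ENNReal.ofReal (18 * Real.exp (9 * B)) *
        ∫⁻ v, ENNReal.ofReal |Real.exp (-q₁ v) - Real.exp (-q₂ v)| := by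
  set F : Vec n → ℝ≥0∞ := fun v => ENNReal.ofReal |Real.exp (-q₁ v) - Real.exp (-q₂ v)| with hF
  have hFm : Measurable F := by fun_prop
  -- The pointwise bound is averaged over all shifts `v` in the unit ball; each of the six shifted
  -- terms then integrates to at most the full `L¹` norm.
  calc volume (Metric.closedBall (0 : Vec n) 1) * F y
      = ∫⁻ _ in Metric.closedBall (0 : Vec n) 1, F y := by
        rw [setLIntegral_const, mul_comm]
    _ ≤ ∫⁻ v in Metric.closedBall (0 : Vec n) 1, ENNReal.ofReal (3 * Real.exp (9 * B)) *
        ∑ k ∈ ({1, 2, 3, -1, -2, -3} : Finset ℝ), F (y + k • v) := by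
        refine setLIntegral_mono (by fun_prop) fun v hv => ?_
        rw [← ENNReal.ofReal_sum_of_nonneg (fun _ _ => abs_nonneg _), ← ENNReal.ofReal_mul
          (by positivity)]
        exact ENNReal.ofReal_le_ofReal (h₁.abs_exp_sub_exp_le hB h₂ (by simpa using hv))
    _ ≤ ∫⁻ v, ENNReal.ofReal (3 * Real.exp (9 * B)) *
        ∑ k ∈ ({1, 2, 3, -1, -2, -3} : Finset ℝ), F (y + k • v) := setLIntegral_le_lintegral _ _
    _ = ENNReal.ofReal (3 * Real.exp (9 * B)) *
        ∑ k ∈ ({1, 2, 3, -1, -2, -3} : Finset ℝ), ∫⁻ v, F (y + k • v) := by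
        rw [lintegral_const_mul _ (by fun_prop), lintegral_finsetSum _ (by fun_prop)]
    _ ≤ ENNReal.ofReal (3 * Real.exp (9 * B)) *
        ∑ _k ∈ ({1, 2, 3, -1, -2, -3} : Finset ℝ), ∫⁻ v, F v := by
        refine mul_le_mul_right (Finset.sum_le_sum fun k hk => ?_) _
        refine lintegral_comp_add_smul_le hFm y ?_
        simp only [Finset.mem_insert, Finset.mem_singleton] at hk
        rcases hk with rfl | rfl | rfl | rfl | rfl | rfl <;> norm_num
    _ ≤ ENNReal.ofReal (3 * Real.exp (9 * B)) * (6 * ∫⁻ v, F v) := by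
        gcongr
        rw [Finset.sum_const, nsmul_eq_mul]
        gcongr
        exact_mod_cast Finset.card_le_six
    _ = _ := by
        rw [← mul_assoc]
        congr 1
        rw [← ENNReal.ofReal_ofNat 6, ← ENNReal.ofReal_mul (by positivity)]
        congr 1; ring

end NegExpQuadratic

/-! ### Coordinates and Lebesgue measure on the joint space -/

section JointSpace

variable {du dy : ℕ}

/-- The point `(u, y)` of the joint space. -/
def joint (u : Vec du) (y : Vec dy) : Joint du dy :=
  WithLp.toLp 2 (Sum.elim (WithLp.ofLp u) (WithLp.ofLp y))

@[simp] lemma joint_u (u : Vec du) (y : Vec dy) : (joint u y).u = u := rfl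
@[simp] lemma joint_y (u : Vec du) (y : Vec dy) : (joint u y).y = y := rfl
@[simp] lemma joint_inl (u : Vec du) (y : Vec dy) (i : Fin du) : joint u y (Sum.inl i) = u i := rfl
@[simp] lemma joint_inr (u : Vec du) (y : Vec dy) (i : Fin dy) : joint u y (Sum.inr i) = y i := rfl
@[simp] lemma Joint.u_apply (z : Joint du dy) (i : Fin du) : z.u i = z (Sum.inl i) := rfl
@[simp] lemma Joint.y_apply (z : Joint du dy) (i : Fin dy) : z.y i = z (Sum.inr i) := rfl

lemma joint_u_y (z : Joint du dy) : joint z.u z.y = z := by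
  ext i; cases i <;> rfl

lemma norm_joint_sq (u : Vec du) (y : Vec dy) : ‖joint u y‖ ^ 2 = ‖u‖ ^ 2 + ‖y‖ ^ 2 := by
  simp [EuclideanSpace.norm_sq_eq]

lemma Joint.norm_sq (z : Joint du dy) : ‖z‖ ^ 2 = ‖z.u‖ ^ 2 + ‖z.y‖ ^ 2 := by
  rw [← norm_joint_sq, joint_u_y]

lemma Joint.norm_u_le (z : Joint du dy) : ‖z.u‖ ≤ ‖z‖ :=
  le_of_sq_le_sq (by rw [z.norm_sq]; nlinarith [sq_nonneg ‖z.y‖]) (norm_nonneg _)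

lemma Joint.norm_y_le (z : Joint du dy) : ‖z.y‖ ≤ ‖z‖ :=
  le_of_sq_le_sq (by rw [z.norm_sq]; nlinarith [sq_nonneg ‖z.u‖]) (norm_nonneg _)

lemma norm_joint_le (u : Vec du) (y : Vec dy) : ‖joint u y‖ ≤ ‖u‖ + ‖y‖ :=
  le_of_sq_le_sq (by rw [norm_joint_sq]; nlinarith [norm_nonneg u, norm_nonneg y]) (by positivity)

/-- The projection to the state component, as a continuous linear map. -/
def uL : Joint du dy →L[ℝ] Vec du :=
  LinearMap.toContinuousLinearMap
    { toFun := Joint.u, map_add' := fun _ _ => rfl, map_smul' := fun _ _ => rfl }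

/-- The projection to the data component, as a continuous linear map. -/
def yL : Joint du dy →L[ℝ] Vec dy :=
  LinearMap.toContinuousLinearMap
    { toFun := Joint.y, map_add' := fun _ _ => rfl, map_smul' := fun _ _ => rfl }

@[simp] lemma uL_apply (z : Joint du dy) : uL z = z.u := rfl
@[simp] lemma yL_apply (z : Joint du dy) : yL z = z.y := rfl

@[fun_prop] lemma continuous_u : Continuous (Joint.u : Joint du dy → Vec du) := uL.continuous
@[fun_prop] lemma continuous_y : Continuous (Joint.y : Joint du dy → Vec dy) := yL.continuous
@[fun_prop] lemma measurable_u : Measurable (Joint.u : Joint du dy → Vec du) :=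
  continuous_u.measurable
@[fun_prop] lemma measurable_y : Measurable (Joint.y : Joint du dy → Vec dy) :=
  continuous_y.measurable

lemma measurePreserving_joint :
    MeasurePreserving (fun p : Vec du × Vec dy => joint p.1 p.2)
      ((volume : Measure (Vec du)).prod volume) volume := by
  have h1 := (PiLp.volume_preserving_ofLp (Fin du)).prod (PiLp.volume_preserving_ofLp (Fin dy))
  have h2 := volume_measurePreserving_sumPiEquivProdPi_symm (fun _ : Fin du ⊕ Fin dy => ℝ)
  have h3 := PiLp.volume_preserving_toLp (Fin du ⊕ Fin dy)
  have h4 : (fun p : Vec du × Vec dy => joint p.1 p.2) = WithLp.toLp 2 ∘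
      (MeasurableEquiv.sumPiEquivProdPi fun _ : Fin du ⊕ Fin dy => ℝ).symm ∘
        Prod.map WithLp.ofLp WithLp.ofLp := by
    funext p
    ext i
    cases i <;> rfl
  rw [h4]
  exact h3.comp (h2.comp h1)

@[fun_prop]
lemma measurable_joint : Measurable (fun p : Vec du × Vec dy => joint p.1 p.2) :=
  measurePreserving_joint.measurable

lemma measurable_joint_comp {α : Type*} [MeasurableSpace α] {f : α → Vec du} {g : α → Vec dy}
    (hf : Measurable f) (hg : Measurable g) : Measurable fun a => joint (f a) (g a) :=
  measurable_joint.comp (hf.prodMk hg)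

lemma lintegral_joint {f : Joint du dy → ℝ≥0∞} (hf : Measurable f) :
    ∫⁻ z, f z = ∫⁻ u, ∫⁻ y, f (joint u y) := by
  rw [← measurePreserving_joint.lintegral_comp hf,
    lintegral_prod (fun p : Vec du × Vec dy => f (joint p.1 p.2))
      (hf.comp measurable_joint).aemeasurable]

end JointSpace

/-! ### The weighted total variation distance -/

section WeightedTV

variable {ι : Type*} [Fintype ι] {μ ν ρ : Measure (EuclideanSpace ℝ ι)}

lemma ofReal_abs_integral_sub_le_dg {f : EuclideanSpace ℝ ι → ℝ} (hf : Measurable f)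
    (h : ∀ x, |f x| ≤ 1 + ‖x‖ ^ 2) :
    ENNReal.ofReal |(∫ x, f x ∂μ) - ∫ x, f x ∂ν| ≤ dg μ ν :=
  le_iSup₂_of_le f hf (le_iSup_of_le h le_rfl)

lemma ofReal_abs_integral_sub_le_mul_dg {f : EuclideanSpace ℝ ι → ℝ} (hf : Measurable f) {c : ℝ}
    (hc : 0 < c) (h : ∀ x, |f x| ≤ c * (1 + ‖x‖ ^ 2)) :
    ENNReal.ofReal |(∫ x, f x ∂μ) - ∫ x, f x ∂ν| ≤ ENNReal.ofReal c * dg μ ν := by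
  have h1 := ofReal_abs_integral_sub_le_dg (μ := μ) (ν := ν) (f := fun x => c⁻¹ * f x)
    (by fun_prop) fun x => by
      rw [abs_mul, abs_of_pos (inv_pos.2 hc), inv_mul_eq_div, div_le_iff₀ hc]; linarith [h x]
  rw [integral_const_mul, integral_const_mul, ← mul_sub, abs_mul, abs_of_pos (inv_pos.2 hc)] at h1
  calc ENNReal.ofReal |(∫ x, f x ∂μ) - ∫ x, f x ∂ν|
      = ENNReal.ofReal c * ENNReal.ofReal (c⁻¹ * |(∫ x, f x ∂μ) - ∫ x, f x ∂ν|) := by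
        rw [← ENNReal.ofReal_mul hc.le, ← mul_assoc, mul_inv_cancel₀ hc.ne', one_mul]
    _ ≤ _ := by gcongr

lemma abs_integral_sub_le_mul_dg (hd : dg μ ν ≠ ⊤) {f : EuclideanSpace ℝ ι → ℝ}
    (hf : Measurable f) {c : ℝ} (hc : 0 < c) (h : ∀ x, |f x| ≤ c * (1 + ‖x‖ ^ 2)) :
    |(∫ x, f x ∂μ) - ∫ x, f x ∂ν| ≤ c * (dg μ ν).toReal := by
  have := ofReal_abs_integral_sub_le_mul_dg (μ := μ) (ν := ν) hf hc h
  rw [← ENNReal.ofReal_toReal hd, ← ENNReal.ofReal_mul hc.le] at this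
  exact (ENNReal.ofReal_le_ofReal_iff (by positivity)).1 this

lemma dg_le {C : ℝ≥0∞} (h : ∀ f : EuclideanSpace ℝ ι → ℝ, Measurable f →
    (∀ x, |f x| ≤ 1 + ‖x‖ ^ 2) → ENNReal.ofReal |(∫ x, f x ∂μ) - ∫ x, f x ∂ν| ≤ C) :
    dg μ ν ≤ C :=
  iSup_le fun f => iSup_le fun hf => iSup_le fun hg => h f hf hg

lemma dg_self : dg μ μ = 0 := by
  refine le_antisymm (dg_le fun f _ _ => ?_) zero_le
  simp

lemma dg_triangle : dg μ ρ ≤ dg μ ν + dg ν ρ := by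
  refine dg_le fun f hf hg => ?_
  calc ENNReal.ofReal |(∫ x, f x ∂μ) - ∫ x, f x ∂ρ|
      ≤ ENNReal.ofReal (|(∫ x, f x ∂μ) - ∫ x, f x ∂ν| + |(∫ x, f x ∂ν) - ∫ x, f x ∂ρ|) :=
        ENNReal.ofReal_le_ofReal (abs_sub_le _ _ _)
    _ ≤ _ := ENNReal.ofReal_add_le
    _ ≤ _ := add_le_add (ofReal_abs_integral_sub_le_dg hf hg) (ofReal_abs_integral_sub_le_dg hf hg)

lemma abs_integral_le_of_weight {f : EuclideanSpace ℝ ι → ℝ} (h : ∀ x, |f x| ≤ 1 + ‖x‖ ^ 2)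
    (hμ : Integrable (fun x => 1 + ‖x‖ ^ 2) μ) : |∫ x, f x ∂μ| ≤ ∫ x, (1 + ‖x‖ ^ 2) ∂μ :=
  (abs_integral_le_integral_abs).trans
    (integral_mono_of_nonneg (ae_of_all _ fun _ => abs_nonneg _) hμ (ae_of_all _ h))

lemma dg_lt_top (hμ : Integrable (fun x => 1 + ‖x‖ ^ 2) μ)
    (hν : Integrable (fun x => 1 + ‖x‖ ^ 2) ν) : dg μ ν < ⊤ := by
  refine (dg_le fun f hf hg => ENNReal.ofReal_le_ofReal (?_ :
    _ ≤ (∫ x, (1 + ‖x‖ ^ 2) ∂μ) + ∫ x, (1 + ‖x‖ ^ 2) ∂ν)).trans_lt ENNReal.ofReal_lt_top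
  exact (abs_sub _ _).trans
    (add_le_add (abs_integral_le_of_weight hg hμ) (abs_integral_le_of_weight hg hν))

lemma integrable_of_weight {f : EuclideanSpace ℝ ι → ℝ} (hf : Measurable f)
    (h : ∀ x, |f x| ≤ 1 + ‖x‖ ^ 2) (hμ : Integrable (fun x => 1 + ‖x‖ ^ 2) μ) : Integrable f μ :=
  hμ.mono' hf.aestronglyMeasurable (ae_of_all _ h)

/-- If `f` is admissible for the images, then `f ∘ F` is dominated by `c` times the weight. -/
lemma dg_map_le {κ : Type*} [Fintype κ] {F : EuclideanSpace ℝ ι → EuclideanSpace ℝ κ}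
    (hF : Measurable F) {c : ℝ} (hc : 0 < c) (h : ∀ x, 1 + ‖F x‖ ^ 2 ≤ c * (1 + ‖x‖ ^ 2)) :
    dg (μ.map F) (ν.map F) ≤ ENNReal.ofReal c * dg μ ν := by
  refine dg_le fun f hf hg => ?_
  rw [integral_map hF.aemeasurable hf.aestronglyMeasurable,
    integral_map hF.aemeasurable hf.aestronglyMeasurable]
  exact ofReal_abs_integral_sub_le_mul_dg (hf.comp hF) hc fun x => (hg _).trans (h x)

/-- The extremal test function, the weight times the sign of `a - b`, is admissible. This is how
`dg` becomes a weighted `L¹` norm of densities. -/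
lemma lintegral_weight_mul_abs_sub_le_dg {a b : EuclideanSpace ℝ ι → ℝ≥0∞} (ha : Measurable a)
    (hb : Measurable b) (ha' : ∀ x, a x ≠ ⊤) (hb' : ∀ x, b x ≠ ⊤)
    (hia : Integrable (fun x => 1 + ‖x‖ ^ 2) (volume.withDensity a))
    (hib : Integrable (fun x => 1 + ‖x‖ ^ 2) (volume.withDensity b)) :
    ∫⁻ x, ENNReal.ofReal ((1 + ‖x‖ ^ 2) * |(a x).toReal - (b x).toReal|) ≤
      dg (volume.withDensity a) (volume.withDensity b) := by
  classical
  set f : EuclideanSpace ℝ ι → ℝ := fun x =>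
    if (b x).toReal ≤ (a x).toReal then 1 + ‖x‖ ^ 2 else -(1 + ‖x‖ ^ 2) with hf
  have hfm : Measurable f :=
    Measurable.ite (measurableSet_le (by fun_prop) (by fun_prop)) (by fun_prop) (by fun_prop)
  have hfg : ∀ x, |f x| ≤ 1 + ‖x‖ ^ 2 := fun x => by
    have : (0 : ℝ) ≤ 1 + ‖x‖ ^ 2 := by positivity
    simp only [hf]; split_ifs
    · rw [abs_of_nonneg this]
    · rw [abs_neg, abs_of_nonneg this]
  have h1 := ofReal_abs_integral_sub_le_dg (μ := volume.withDensity a)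
    (ν := volume.withDensity b) hfm hfg
  have ia := (integrable_withDensity_iff_integrable_smul₀' ha.aemeasurable
    (ae_of_all _ fun x => (ha' x).lt_top)).1 (integrable_of_weight hfm hfg hia)
  have ib := (integrable_withDensity_iff_integrable_smul₀' hb.aemeasurable
    (ae_of_all _ fun x => (hb' x).lt_top)).1 (integrable_of_weight hfm hfg hib)
  rw [integral_withDensity_eq_integral_toReal_smul ha (ae_of_all _ fun x => (ha' x).lt_top),
    integral_withDensity_eq_integral_toReal_smul hb (ae_of_all _ fun x => (hb' x).lt_top),
    ← integral_sub ia ib] at h1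
  have e : ∀ x, (a x).toReal • f x - (b x).toReal • f x =
      (1 + ‖x‖ ^ 2) * |(a x).toReal - (b x).toReal| := fun x => by
    simp only [hf, smul_eq_mul]; split_ifs with h
    · rw [abs_of_nonneg (by linarith)]; ring
    · rw [abs_of_neg (by linarith)]; ring
  have iab := ia.sub ib
  have e' : (fun x => (a x).toReal • f x - (b x).toReal • f x) = fun x =>
      (1 + ‖x‖ ^ 2) * |(a x).toReal - (b x).toReal| := funext e
  change Integrable (fun x => (a x).toReal • f x - (b x).toReal • f x) _ at iab
  rw [e'] at iab h1
  rw [← ofReal_integral_eq_lintegral_ofReal iab (ae_of_all _ fun x => by positivity)]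
  rwa [abs_of_nonneg (integral_nonneg fun x => by positivity)] at h1

end WeightedTV

/-! ### Bounded fourth moments -/

section Moments

variable {ι : Type*} [Fintype ι]

/-- Probability measures whose fourth moment is at most `R`. -/
structure FourthMomentLE (R : ℝ) (μ : Measure (EuclideanSpace ℝ ι)) : Prop where
  prob : IsProbabilityMeasure μ
  integrable : Integrable (fun x => ‖x‖ ^ 4) μ
  integral_le : ∫ x, ‖x‖ ^ 4 ∂μ ≤ R

variable {R : ℝ} {μ : Measure (EuclideanSpace ℝ ι)}

lemma FourthMomentLE.integrable_of_le (h : FourthMomentLE R μ) {f : EuclideanSpace ℝ ι → ℝ}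
    (hf : AEStronglyMeasurable f μ) {c : ℝ} (hfc : ∀ x, |f x| ≤ c * (1 + ‖x‖ ^ 4)) :
    Integrable f μ := by
  have := h.prob
  exact (((integrable_const 1).add h.integrable).const_mul c).mono' hf (ae_of_all _ hfc)

lemma FourthMomentLE.integral_le_of_le (h : FourthMomentLE R μ) {f : EuclideanSpace ℝ ι → ℝ}
    (hf : AEStronglyMeasurable f μ) {c : ℝ} (hc : 0 ≤ c) (hfc : ∀ x, |f x| ≤ c * (1 + ‖x‖ ^ 4)) :
    |∫ x, f x ∂μ| ≤ c * (1 + R) := by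
  have := h.prob
  refine (abs_integral_le_integral_abs).trans ?_
  refine (integral_mono (h.integrable_of_le hf hfc).abs
    (((integrable_const 1).add h.integrable).const_mul c) hfc).trans ?_
  rw [integral_const_mul, integral_add' (integrable_const 1) h.integrable]
  have := h.integral_le
  simp only [integral_const, probReal_univ, smul_eq_mul, mul_one]
  gcongr

lemma one_add_sq_le (a : ℝ) : 1 + a ^ 2 ≤ 2 * (1 + a ^ 4) := by
  nlinarith [sq_nonneg (a ^ 2 - 1)]

lemma FourthMomentLE.integrable_weight (h : FourthMomentLE R μ) :
    Integrable (fun x => 1 + ‖x‖ ^ 2) μ :=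
  h.integrable_of_le (by fun_prop) (c := 2) fun x => by
    rw [abs_of_nonneg (by positivity)]; exact one_add_sq_le _

lemma FourthMomentLE.integral_weight_le (h : FourthMomentLE R μ) :
    ∫ x, (1 + ‖x‖ ^ 2) ∂μ ≤ 2 * (1 + R) :=
  (le_abs_self _).trans <| h.integral_le_of_le (by fun_prop) zero_le_two fun x => by
    rw [abs_of_nonneg (by positivity)]; exact one_add_sq_le _

lemma FourthMomentLE.nonneg (h : FourthMomentLE R μ) : 0 ≤ R :=
  (integral_nonneg fun _ => by positivity).trans h.integral_le

end Moments

/-! ### The prediction as the law of a sampled state and datum -/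

section Sampling

variable {du dy : ℕ}

lemma map_add_multivariateGaussian {n : ℕ} (m : Vec n) (S : Matrix (Fin n) (Fin n) ℝ) :
    (multivariateGaussian 0 S).map (fun x => m + x) = multivariateGaussian m S := by
  rw [multivariateGaussian, multivariateGaussian, Measure.map_map (by fun_prop) (by fun_prop)]
  congr 1
  funext x
  simp

lemma lintegral_gaussDensity_mul {n : ℕ} {S : Matrix (Fin n) (Fin n) ℝ} (hS : S.PosDef)
    (m : Vec n) {F : Vec n → ℝ≥0∞} (hF : Measurable F) :
    ∫⁻ x, ENNReal.ofReal (gaussDensity S (x - m)) * F x =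
      ∫⁻ x, F (m + x) ∂(multivariateGaussian 0 S) := by
  rw [← lintegral_map (μ := multivariateGaussian 0 S) hF (g := fun x => m + x) (by fun_prop),
    map_add_multivariateGaussian, ← withDensity_gaussDensity hS m,
    lintegral_withDensity_eq_lintegral_mul _ (by fun_prop) hF]
  rfl

lemma lintegral_gaussDensity {n : ℕ} {S : Matrix (Fin n) (Fin n) ℝ} (hS : S.PosDef)
    (m : Vec n) : ∫⁻ x, ENNReal.ofReal (gaussDensity S (x - m)) = 1 := by
  have := lintegral_gaussDensity_mul hS m (F := fun _ => 1) measurable_const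
  simpa using this

lemma integrable_norm_pow_gaussian {n : ℕ} {ν : Measure (Vec n)} [IsGaussian ν] (k : ℕ) :
    Integrable (fun x => ‖x‖ ^ k) ν := by
  have h : MemLp id (k : ℝ≥0∞) ν := IsGaussian.hasGaussianLaw_id.memLp (by simp)
  exact h.integrable_norm_pow'

/-- The joint law of the current state and of the two noise variables. -/
def law (S : Matrix (Fin du) (Fin du) ℝ) (Γ : Matrix (Fin dy) (Fin dy) ℝ) (μ : Measure (Vec du)) :
    Measure (Vec du × Vec du × Vec dy) :=
  μ.prod ((multivariateGaussian 0 S).prod (multivariateGaussian 0 Γ))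

/-- The predicted state and datum, as a function of the current state and the noise. -/
def sample (Ψ : Vec du → Vec du) (h : Vec du → Vec dy) (ω : Vec du × Vec du × Vec dy) :
    Joint du dy :=
  joint (Ψ ω.1 + ω.2.1) (h (Ψ ω.1 + ω.2.1) + ω.2.2)

/-- The density of `(u, y)` given the current state `v`. -/
def transDensity (Ψ : Vec du → Vec du) (h : Vec du → Vec dy) (S : Matrix (Fin du) (Fin du) ℝ)
    (Γ : Matrix (Fin dy) (Fin dy) ℝ) (v u : Vec du) (y : Vec dy) : ℝ :=
  gaussDensity S (u - Ψ v) * gaussDensity Γ (y - h u)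

/-- The standing conditions on the vector fields. -/
structure VectorFields (κΨ κh ℓh : ℝ) (Ψ : Vec du → Vec du) (h : Vec du → Vec dy) : Prop where
  measurable_Ψ : Measurable Ψ
  growth_Ψ : ∀ u, ‖Ψ u‖ ≤ κΨ * (1 + ‖u‖)
  growth_h : ∀ u, ‖h u‖ ≤ κh * (1 + ‖u‖)
  lipschitz_h : ∀ u v, ‖h u - h v‖ ≤ ℓh * ‖u - v‖

variable {κΨ κh ℓh : ℝ} {Ψ : Vec du → Vec du} {h : Vec du → Vec dy}
  {S : Matrix (Fin du) (Fin du) ℝ} {Γ : Matrix (Fin dy) (Fin dy) ℝ} {μ : Measure (Vec du)}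

lemma VectorFields.measurable_h (H : VectorFields κΨ κh ℓh Ψ h) : Measurable h := by
  have : LipschitzWith ℓh.toNNReal h := LipschitzWith.of_dist_le_mul fun u v => by
    rw [dist_eq_norm, dist_eq_norm]
    exact (H.lipschitz_h u v).trans (by gcongr; exact Real.le_coe_toNNReal _)
  exact this.continuous.measurable

@[fun_prop]
lemma measurable_sample (hΨ : Measurable Ψ) (hh : Measurable h) : Measurable (sample Ψ h) :=
  measurable_joint_comp (by fun_prop) (by fun_prop)

instance [IsProbabilityMeasure μ] : IsProbabilityMeasure (law S Γ μ) := by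
  unfold law; infer_instance

/-- Integration against the law of the prediction, in terms of the transition density. -/
lemma lintegral_lintegral_transDensity [SFinite μ] (hΨ : Measurable Ψ) (hh : Measurable h)
    (hS : S.PosDef) (hΓ : Γ.PosDef) {G : Vec du × Joint du dy → ℝ≥0∞} (hG : Measurable G) :
    ∫⁻ z : Joint du dy, ∫⁻ v, ENNReal.ofReal (transDensity Ψ h S Γ v z.u z.y) * G (v, z) ∂μ =
      ∫⁻ ω, G (ω.1, sample Ψ h ω) ∂(law S Γ μ) := by
  have hs := measurable_sample hΨ hh
  rw [lintegral_lintegral_swap (by unfold transDensity; fun_prop), law,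
    lintegral_prod _ (by fun_prop)]
  refine lintegral_congr fun v => ?_
  rw [lintegral_joint (by unfold transDensity; fun_prop), lintegral_prod _ (by fun_prop)]
  have hj := measurable_joint (du := du) (dy := dy)
  have hG' : Measurable fun p : Vec du × Vec dy => G (v, joint p.1 p.2) := by fun_prop
  have e : ∀ u : Vec du, ∫⁻ y : Vec dy, ENNReal.ofReal (transDensity Ψ h S Γ v u y) *
      G (v, joint u y) = ENNReal.ofReal (gaussDensity S (u - Ψ v)) *
        ∫⁻ η, G (v, joint u (h u + η)) ∂(multivariateGaussian 0 Γ) := fun u => by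
    have hGu : Measurable fun y => G (v, joint u y) := by
      exact hG'.comp measurable_prodMk_left
    rw [← lintegral_gaussDensity_mul hΓ (h u) hGu, ← lintegral_const_mul _ (by fun_prop)]
    refine lintegral_congr fun y => ?_
    rw [transDensity, ENNReal.ofReal_mul (gaussDensity_pos hS _).le, mul_assoc]
  simp only [joint_u, joint_y, e]
  refine lintegral_gaussDensity_mul hS (Ψ v)
    (F := fun u => ∫⁻ η, G (v, joint u (h u + η)) ∂(multivariateGaussian 0 Γ)) ?_
  refine Measurable.lintegral_prod_right' (f := fun p : Vec du × Vec dy =>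
    G (v, joint p.1 (h p.1 + p.2))) ?_
  exact hG'.comp (f := fun p : Vec du × Vec dy => (p.1, h p.1 + p.2)) (by fun_prop)

lemma measurable_predDensity [SFinite μ] (hΨ : Measurable Ψ) : Measurable (predDensity Ψ S μ) := by
  unfold predDensity
  exact Measurable.lintegral_prod_right' (f := fun p : Vec du × Vec du =>
    ENNReal.ofReal (gaussDensity S (p.1 - Ψ p.2))) (by fun_prop)

lemma jointDensity_eq (hΨ : Measurable Ψ) (hΓ : Γ.PosDef) (u : Vec du) (y : Vec dy) :
    jointDensity Ψ h S Γ μ u y = ∫⁻ v, ENNReal.ofReal (transDensity Ψ h S Γ v u y) ∂μ := by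
  rw [jointDensity, liftDensity, predDensity, ← lintegral_const_mul _ (by fun_prop)]
  refine lintegral_congr fun v => ?_
  rw [transDensity, mul_comm (gaussDensity S _), ENNReal.ofReal_mul (gaussDensity_pos hΓ _).le]

lemma measurable_jointDensity [SFinite μ] (hΨ : Measurable Ψ) (hh : Measurable h) :
    Measurable fun z : Joint du dy => jointDensity Ψ h S Γ μ z.u z.y := by
  have := measurable_predDensity (S := S) (μ := μ) hΨ
  unfold jointDensity liftDensity
  fun_prop

lemma predDensity_le [IsProbabilityMeasure μ] (hS : S.PosDef) (u : Vec du) :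
    predDensity Ψ S μ u ≤ ENNReal.ofReal (gaussConst S) := by
  calc predDensity Ψ S μ u ≤ ∫⁻ _, ENNReal.ofReal (gaussConst S) ∂μ :=
        lintegral_mono fun v => ENNReal.ofReal_le_ofReal (gaussDensity_le hS _)
    _ = _ := by simp

lemma predDensity_ne_top [IsProbabilityMeasure μ] (hS : S.PosDef) (u : Vec du) :
    predDensity Ψ S μ u ≠ ⊤ :=
  ((predDensity_le hS u).trans_lt ENNReal.ofReal_lt_top).ne

lemma predDensity_pos [IsProbabilityMeasure μ] (hΨ : Measurable Ψ) (hS : S.PosDef) (u : Vec du) :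
    0 < predDensity Ψ S μ u := by
  unfold predDensity
  rw [lintegral_pos_iff_support (by fun_prop)]
  have : Function.support (fun v => ENNReal.ofReal (gaussDensity S (u - Ψ v))) = Set.univ := by
    ext v; simpa using gaussDensity_pos hS (u - Ψ v)
  rw [this]; simp

lemma lintegral_QP [SFinite μ] (hΨ : Measurable Ψ) (hh : Measurable h)
    (hS : S.PosDef) (hΓ : Γ.PosDef) {f : Joint du dy → ℝ≥0∞} (hf : Measurable f) :
    ∫⁻ z, f z ∂(QP Ψ h S Γ μ) = ∫⁻ ω, f (sample Ψ h ω) ∂(law S Γ μ) := by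
  rw [QP, ofJointDensity, lintegral_withDensity_eq_lintegral_mul _
    (measurable_jointDensity hΨ hh) hf,
    ← lintegral_lintegral_transDensity hΨ hh hS hΓ (G := fun p => f p.2) (by fun_prop)]
  refine lintegral_congr fun z => ?_
  rw [Pi.mul_apply, jointDensity_eq hΨ hΓ]
  exact (lintegral_mul_const (f z) (f := fun v => ENNReal.ofReal (transDensity Ψ h S Γ v z.u z.y))
    (by unfold transDensity; fun_prop)).symm

/-- `Q P μ` is the law of the predicted state and datum. -/
lemma QP_eq_map [SFinite μ] (hΨ : Measurable Ψ) (hh : Measurable h)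
    (hS : S.PosDef) (hΓ : Γ.PosDef) :
    QP Ψ h S Γ μ = (law S Γ μ).map (sample Ψ h) := by
  refine Measure.ext_of_lintegral _ fun f hf => ?_
  rw [lintegral_QP hΨ hh hS hΓ hf, lintegral_map hf (by fun_prop)]

lemma isProbabilityMeasure_QP [IsProbabilityMeasure μ] (hΨ : Measurable Ψ) (hh : Measurable h)
    (hS : S.PosDef) (hΓ : Γ.PosDef) : IsProbabilityMeasure (QP Ψ h S Γ μ) := by
  rw [QP_eq_map hΨ hh hS hΓ]
  exact Measure.isProbabilityMeasure_map (measurable_sample hΨ hh).aemeasurable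

/-- A weight which dominates the current state, the noise and the prediction. -/
def weight (ω : Vec du × Vec du × Vec dy) : ℝ := 1 + ‖ω.1‖ + ‖ω.2.1‖ + ‖ω.2.2‖

@[fun_prop]
lemma continuous_weight : Continuous (weight : Vec du × Vec du × Vec dy → ℝ) := by
  unfold weight; fun_prop

lemma one_le_weight (ω : Vec du × Vec du × Vec dy) : 1 ≤ weight ω := by
  unfold weight
  linarith [norm_nonneg ω.1, norm_nonneg ω.2.1, norm_nonneg ω.2.2]

lemma add_pow_four_le (a b : ℝ) : (a + b) ^ 4 ≤ 8 * (a ^ 4 + b ^ 4) := by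
  nlinarith [sq_nonneg (a - b), sq_nonneg (a + b), sq_nonneg (a ^ 2 - b ^ 2),
    mul_nonneg (sq_nonneg (a - b)) (sq_nonneg (a + b)), mul_nonneg (sq_nonneg (a - b)) (sq_nonneg (a - b)),
    mul_nonneg (sq_nonneg (a - b)) (add_nonneg (sq_nonneg a) (sq_nonneg b))]

lemma exists_integral_weight_pow_four_le (S : Matrix (Fin du) (Fin du) ℝ)
    (Γ : Matrix (Fin dy) (Fin dy) ℝ) (R : ℝ) :
    ∃ B : ℝ, 0 < B ∧ ∀ μ : Measure (Vec du), FourthMomentLE R μ →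
      Integrable (fun ω => weight ω ^ 4) (law S Γ μ) ∧ ∫ ω, weight ω ^ 4 ∂(law S Γ μ) ≤ B := by
  set a := ∫ x, ‖x‖ ^ 4 ∂(multivariateGaussian 0 S)
  set b := ∫ x, ‖x‖ ^ 4 ∂(multivariateGaussian 0 Γ)
  -- `64 = 8 * 8` comes from applying `add_pow_four_le` at two levels to the four summands of the
  -- weight. The maximum with `1` only secures positivity.
  refine ⟨max 1 (64 * (1 + R + a + b)), by positivity, fun μ hμ => ?_⟩
  have := hμ.prob
  have i1 : Integrable (fun ω : Vec du × Vec du × Vec dy => ‖ω.1‖ ^ 4) (law S Γ μ) :=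
    hμ.integrable.comp_fst _
  have i2 : Integrable (fun ω : Vec du × Vec du × Vec dy => ‖ω.2.1‖ ^ 4) (law S Γ μ) :=
    ((integrable_norm_pow_gaussian (ν := multivariateGaussian 0 S) 4).comp_fst
      (multivariateGaussian 0 Γ)).comp_snd μ
  have i3 : Integrable (fun ω : Vec du × Vec du × Vec dy => ‖ω.2.2‖ ^ 4) (law S Γ μ) :=
    ((integrable_norm_pow_gaussian (ν := multivariateGaussian 0 Γ) 4).comp_snd
      (multivariateGaussian 0 S)).comp_snd μ
  have e1 : ∫ ω, ‖ω.1‖ ^ 4 ∂(law S Γ μ) = ∫ x, ‖x‖ ^ 4 ∂μ := by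
    rw [law, integral_fun_fst (μ := μ) (fun x => ‖x‖ ^ 4)]; simp
  have e2 : ∫ ω, ‖ω.2.1‖ ^ 4 ∂(law S Γ μ) = a := by
    rw [law, integral_fun_snd (μ := μ) (fun x : Vec du × Vec dy => ‖x.1‖ ^ 4),
      integral_fun_fst (fun x => ‖x‖ ^ 4)]; simp [a]
  have e3 : ∫ ω, ‖ω.2.2‖ ^ 4 ∂(law S Γ μ) = b := by
    rw [law, integral_fun_snd (μ := μ) (fun x : Vec du × Vec dy => ‖x.2‖ ^ 4),
      integral_fun_snd (fun x => ‖x‖ ^ 4)]; simp [b]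
  have hle : ∀ ω : Vec du × Vec du × Vec dy,
      weight ω ^ 4 ≤ 64 * (1 + ‖ω.1‖ ^ 4 + ‖ω.2.1‖ ^ 4 + ‖ω.2.2‖ ^ 4) := fun ω => by
    have h1 := add_pow_four_le (1 + ‖ω.1‖) (‖ω.2.1‖ + ‖ω.2.2‖)
    have h2 := add_pow_four_le 1 ‖ω.1‖
    have h3 := add_pow_four_le ‖ω.2.1‖ ‖ω.2.2‖
    have : weight ω = (1 + ‖ω.1‖) + (‖ω.2.1‖ + ‖ω.2.2‖) := by unfold weight; ring
    rw [this]; linarith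
  have i0 := ((((integrable_const (1 : ℝ)).add i1).add i2).add i3).const_mul 64
  refine ⟨i0.mono' (by fun_prop) (ae_of_all _ fun ω => ?_), ?_⟩
  · rw [Real.norm_of_nonneg (by positivity)]; exact hle ω
  · refine le_trans ?_ (le_max_right _ _)
    refine (integral_mono_of_nonneg (ae_of_all _ fun ω => by positivity) i0
      (ae_of_all _ hle)).trans ?_
    rw [integral_const_mul, integral_add' (((integrable_const (1 : ℝ)).add i1).add i2) i3,
      integral_add' ((integrable_const (1 : ℝ)).add i1) i2, integral_add' (integrable_const 1) i1,
      e1, e2, e3]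
    have := hμ.integral_le
    simp only [integral_const, probReal_univ, smul_eq_mul, mul_one]
    gcongr

lemma exists_norm_sample_le (κΨ κh ℓh : ℝ) :
    ∃ c : ℝ, 1 ≤ c ∧ ∀ (Ψ : Vec du → Vec du) (h : Vec du → Vec dy), VectorFields κΨ κh ℓh Ψ h →
      ∀ ω, ‖sample Ψ h ω‖ ≤ c * weight ω := by
  set c₁ := max 0 κΨ + 1
  set c₂ := max 0 κh * (1 + c₁) + 1
  have h0 : 0 ≤ max 0 κΨ := le_max_left _ _
  have h0' : 0 ≤ max 0 κh := le_max_left _ _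
  refine ⟨c₁ + c₂, by have : 0 ≤ max 0 κh * (1 + c₁) := by positivity
                      linarith, fun Ψ h H ω => ?_⟩
  have hW : weight ω = 1 + ‖ω.1‖ + ‖ω.2.1‖ + ‖ω.2.2‖ := rfl
  have hW1 := one_le_weight ω
  have n1 := norm_nonneg ω.1
  have n2 := norm_nonneg ω.2.1
  have n3 := norm_nonneg ω.2.2
  have hu : ‖Ψ ω.1 + ω.2.1‖ ≤ c₁ * weight ω := by
    calc ‖Ψ ω.1 + ω.2.1‖ ≤ κΨ * (1 + ‖ω.1‖) + ‖ω.2.1‖ :=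
          (norm_add_le _ _).trans (by gcongr; exact H.growth_Ψ _)
      _ ≤ max 0 κΨ * (1 + ‖ω.1‖) + ‖ω.2.1‖ := by gcongr; exact le_max_right _ _
      _ ≤ max 0 κΨ * weight ω + weight ω := by gcongr <;> linarith
      _ = _ := by ring
  have hy : ‖h (Ψ ω.1 + ω.2.1) + ω.2.2‖ ≤ c₂ * weight ω := by
    calc ‖h (Ψ ω.1 + ω.2.1) + ω.2.2‖ ≤ κh * (1 + ‖Ψ ω.1 + ω.2.1‖) + ‖ω.2.2‖ :=
          (norm_add_le _ _).trans (by gcongr; exact H.growth_h _)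
      _ ≤ max 0 κh * (1 + ‖Ψ ω.1 + ω.2.1‖) + ‖ω.2.2‖ := by gcongr; exact le_max_right _ _
      _ ≤ max 0 κh * (weight ω + c₁ * weight ω) + weight ω := by gcongr <;> linarith
      _ = _ := by ring
  calc ‖sample Ψ h ω‖ ≤ _ := norm_joint_le _ _
    _ ≤ _ := by rw [add_mul]; exact add_le_add hu hy

lemma exists_fourthMomentLE_QP (κΨ κh ℓh : ℝ) (hS : S.PosDef) (hΓ : Γ.PosDef) (R : ℝ) :
    ∃ R' : ℝ, ∀ (Ψ : Vec du → Vec du) (h : Vec du → Vec dy), VectorFields κΨ κh ℓh Ψ h →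
      ∀ μ, FourthMomentLE R μ → FourthMomentLE R' (QP Ψ h S Γ μ) := by
  obtain ⟨B, hB, hB'⟩ := exists_integral_weight_pow_four_le S Γ R
  obtain ⟨c, hc, hc'⟩ := exists_norm_sample_le (du := du) (dy := dy) κΨ κh ℓh
  refine ⟨c ^ 4 * B, fun Ψ h H μ hμ => ?_⟩
  have := hμ.prob
  have hs := measurable_sample H.measurable_Ψ H.measurable_h
  obtain ⟨i, le⟩ := hB' μ hμ
  have hle : ∀ ω, ‖sample Ψ h ω‖ ^ 4 ≤ c ^ 4 * weight ω ^ 4 := fun ω => by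
    rw [← mul_pow]; gcongr; exact hc' Ψ h H ω
  have i' : Integrable (fun ω => ‖sample Ψ h ω‖ ^ 4) (law S Γ μ) :=
    (i.const_mul (c ^ 4)).mono' (by fun_prop) (ae_of_all _ fun ω => by
      rw [Real.norm_of_nonneg (by positivity)]; exact hle ω)
  have hQ := QP_eq_map (μ := μ) H.measurable_Ψ H.measurable_h hS hΓ
  refine ⟨isProbabilityMeasure_QP H.measurable_Ψ H.measurable_h hS hΓ, ?_, ?_⟩
  · rw [hQ, integrable_map_measure (by fun_prop) hs.aemeasurable]
    exact i'
  · rw [hQ, integral_map hs.aemeasurable (by fun_prop)]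
    calc _ ≤ ∫ ω, c ^ 4 * weight ω ^ 4 ∂(law S Γ μ) :=
          integral_mono i' (i.const_mul _) hle
      _ ≤ _ := by rw [integral_const_mul]; gcongr

end Sampling

/-! ### Covariance matrices and their continuity in `dg` -/

section Covariance

variable {ι : Type*} [Fintype ι] {π π' : Measure (EuclideanSpace ℝ ι)}

lemma FourthMomentLE.memLp_two {R : ℝ} (hπ : FourthMomentLE R π) : MemLp id 2 π := by
  refine (memLp_two_iff_integrable_sq_norm (by fun_prop)).2 ?_
  have := hπ.prob
  have h := hπ.integrable_weight.sub (integrable_const 1)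
  refine h.congr (ae_of_all _ fun x => ?_)
  simp

lemma cov_isHermitian (π : Measure (EuclideanSpace ℝ ι)) : (cov π).IsHermitian := by
  ext i j
  simp [cov, covariance_comm]

variable [DecidableEq ι]

lemma dotProduct_cov_mulVec [IsFiniteMeasure π] (hπ : MemLp id 2 π) (x y : EuclideanSpace ℝ ι) :
    WithLp.ofLp x ⬝ᵥ (cov π *ᵥ WithLp.ofLp y) = cov[fun z => ⟪x, z⟫, fun z => ⟪y, z⟫; π] := by
  have hm : ∀ i, MemLp (fun z : EuclideanSpace ℝ ι => z i) 2 π := fun i => by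
    have := (EuclideanSpace.proj (𝕜 := ℝ) i : EuclideanSpace ℝ ι →L[ℝ] ℝ).comp_memLp' hπ
    exact this
  have e : ∀ w : EuclideanSpace ℝ ι, (fun z : EuclideanSpace ℝ ι => ⟪w, z⟫) =
      fun z => ∑ i, w i * z i := fun w => by
    funext z; simp [PiLp.inner_apply, mul_comm]
  rw [e, e, covariance_fun_sum_fun_sum (fun i => (hm i).const_mul _) (fun i => (hm i).const_mul _)]
  simp only [dotProduct, Matrix.mulVec, Finset.mul_sum, covariance_const_mul_left,
    covariance_const_mul_right, cov, Matrix.of_apply]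
  refine Finset.sum_congr rfl fun i _ => Finset.sum_congr rfl fun j _ => by ring

lemma quad_cov [IsFiniteMeasure π] (hπ : MemLp id 2 π) (x : EuclideanSpace ℝ ι) :
    quad (cov π) x = Var[fun z => ⟪x, z⟫; π] := by
  rw [quad, dotProduct_cov_mulVec hπ, covariance_self (by fun_prop)]

lemma posSemidef_cov [IsFiniteMeasure π] (hπ : MemLp id 2 π) : (cov π).PosSemidef := by
  refine Matrix.PosSemidef.of_dotProduct_mulVec_nonneg (cov_isHermitian π) fun x => ?_
  have := quad_cov hπ (WithLp.toLp 2 x)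
  simp only [quad] at this
  simp [this, variance_nonneg]

lemma abs_apply_le_norm (x : EuclideanSpace ℝ ι) (i : ι) : |x i| ≤ ‖x‖ := by
  simpa using PiLp.norm_apply_le x i

lemma FourthMomentLE.abs_integral_apply_le {R : ℝ} (hπ : FourthMomentLE R π) (i : ι) :
    |∫ x, x i ∂π| ≤ 2 * (1 + R) := by
  refine hπ.integral_le_of_le (by fun_prop) zero_le_two fun x => ?_
  have := one_add_sq_le ‖x‖
  nlinarith [abs_apply_le_norm x i, sq_nonneg (‖x‖ - 1), norm_nonneg x]

lemma abs_apply_mul_apply_le (x : EuclideanSpace ℝ ι) (i j : ι) : |x i * x j| ≤ ‖x‖ ^ 2 := by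
  rw [abs_mul, sq]
  exact mul_le_mul (abs_apply_le_norm x i) (abs_apply_le_norm x j) (abs_nonneg _) (norm_nonneg _)

lemma FourthMomentLE.cov_eq_sub {R : ℝ} (hπ : FourthMomentLE R π) (i j : ι) :
    cov π i j = (∫ x, x i * x j ∂π) - (∫ x, x i ∂π) * ∫ x, x j ∂π := by
  have := hπ.prob
  have hm : ∀ i, MemLp (fun z : EuclideanSpace ℝ ι => z i) 2 π := fun i =>
    (EuclideanSpace.proj (𝕜 := ℝ) i : EuclideanSpace ℝ ι →L[ℝ] ℝ).comp_memLp' hπ.memLp_two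
  rw [cov, Matrix.of_apply, covariance_eq_sub (hm i) (hm j)]
  rfl

lemma FourthMomentLE.abs_cov_le {R : ℝ} (hπ : FourthMomentLE R π) (i j : ι) :
    |cov π i j| ≤ 2 * (1 + R) + (2 * (1 + R)) ^ 2 := by
  rw [hπ.cov_eq_sub]
  refine (abs_sub _ _).trans (add_le_add ?_ ?_)
  · refine hπ.integral_le_of_le (by fun_prop) zero_le_two fun x => ?_
    linarith [abs_apply_mul_apply_le x i j, one_add_sq_le ‖x‖]
  · rw [abs_mul, sq]
    have := hπ.nonneg
    exact mul_le_mul (hπ.abs_integral_apply_le i) (hπ.abs_integral_apply_le j) (abs_nonneg _)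
      (by positivity)

/-- Coordinates and products of two coordinates are dominated by `1 + ‖x‖²`, so `dg` controls first
and second moments. The product of means is only locally Lipschitz; the moment bound `R` enters
there. -/
lemma FourthMomentLE.abs_cov_sub_cov_le {R : ℝ} (hπ : FourthMomentLE R π)
    (hπ' : FourthMomentLE R π') (i j : ι) :
    |cov π i j - cov π' i j| ≤ (1 + 4 * (1 + R)) * (dg π π').toReal := by
  have hd : dg π π' ≠ ⊤ := (dg_lt_top hπ.integrable_weight hπ'.integrable_weight).ne
  have h1 : ∀ i, |(∫ x, x i ∂π) - ∫ x, x i ∂π'| ≤ (dg π π').toReal := fun i => by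
    have := abs_integral_sub_le_mul_dg hd (f := fun x => x i) (by fun_prop) one_pos fun x => by
      nlinarith [abs_apply_le_norm x i, sq_nonneg (‖x‖ - 1), norm_nonneg x]
    simpa using this
  have h2 : |(∫ x, x i * x j ∂π) - ∫ x, x i * x j ∂π'| ≤ (dg π π').toReal := by
    have := abs_integral_sub_le_mul_dg hd (f := fun x => x i * x j) (by fun_prop) one_pos fun x => by
      nlinarith [abs_apply_mul_apply_le x i j]
    simpa using this
  rw [hπ.cov_eq_sub, hπ'.cov_eq_sub]
  have a1 := hπ.abs_integral_apply_le j
  have a2 := hπ'.abs_integral_apply_le i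
  set D := (dg π π').toReal
  have e : (∫ x, x i * x j ∂π) - (∫ x, x i ∂π) * (∫ x, x j ∂π) -
      ((∫ x, x i * x j ∂π') - (∫ x, x i ∂π') * ∫ x, x j ∂π') =
      ((∫ x, x i * x j ∂π) - ∫ x, x i * x j ∂π') -
      (((∫ x, x i ∂π) - ∫ x, x i ∂π') * (∫ x, x j ∂π) +
        (∫ x, x i ∂π') * ((∫ x, x j ∂π) - ∫ x, x j ∂π')) := by ring
  rw [e]
  have hD : 0 ≤ D := ENNReal.toReal_nonneg
  have hR := hπ.nonneg
  calc _ ≤ D + (|((∫ x, x i ∂π) - ∫ x, x i ∂π') * (∫ x, x j ∂π)| +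
        |(∫ x, x i ∂π') * ((∫ x, x j ∂π) - ∫ x, x j ∂π')|) :=
        (abs_sub _ _).trans (add_le_add h2 (abs_add_le _ _))
    _ ≤ D + (D * (2 * (1 + R)) + (2 * (1 + R)) * D) := by
        rw [abs_mul, abs_mul]; gcongr <;> exact h1 _
    _ = _ := by ring

end Covariance

/-! ### Operator norms of rectangular matrices -/

section MatrixMaps

variable {l m n : Type*} [Fintype l] [Fintype m] [Fintype n] [DecidableEq l] [DecidableEq m]
  [DecidableEq n]

/-- The continuous linear map between Euclidean spaces of a rectangular matrix. -/
def matL (A : Matrix m n ℝ) : EuclideanSpace ℝ n →L[ℝ] EuclideanSpace ℝ m :=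
  LinearMap.toContinuousLinearMap (Matrix.toEuclideanLin A)

lemma ofLp_matL (A : Matrix m n ℝ) (x : EuclideanSpace ℝ n) :
    WithLp.ofLp (matL A x) = A *ᵥ WithLp.ofLp x := rfl

lemma matL_sub (A B : Matrix m n ℝ) : matL (A - B) = matL A - matL B := by
  ext x i; simp [ofLp_matL, Matrix.sub_mulVec]

lemma matL_add (A B : Matrix m n ℝ) : matL (A + B) = matL A + matL B := by
  ext x i; simp [ofLp_matL, Matrix.add_mulVec]

lemma matL_mul (A : Matrix l m ℝ) (B : Matrix m n ℝ) : matL (A * B) = (matL A).comp (matL B) := by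
  ext x i; simp [ofLp_matL, Matrix.mulVec_mulVec]

lemma norm_le_sum_abs (x : EuclideanSpace ℝ n) : ‖x‖ ≤ ∑ i, |x i| := by
  classical
  conv_lhs => rw [← (EuclideanSpace.basisFun n ℝ).sum_repr x]
  refine (norm_sum_le _ _).trans (Finset.sum_le_sum fun i _ => ?_)
  simp [norm_smul]

lemma norm_matL_le {A : Matrix m n ℝ} {a : ℝ} (h : ∀ i j, |A i j| ≤ a) (ha : 0 ≤ a) :
    ‖matL A‖ ≤ Fintype.card m * (Fintype.card n * a) := by
  refine ContinuousLinearMap.opNorm_le_bound _ (by positivity) fun x => ?_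
  refine (norm_le_sum_abs _).trans ?_
  have : ∀ i, |matL A x i| ≤ Fintype.card n * a * ‖x‖ := fun i => by
    rw [ofLp_matL, Matrix.mulVec, dotProduct]
    refine (Finset.abs_sum_le_sum_abs _ _).trans ?_
    calc ∑ j, |A i j * x j| ≤ ∑ _j : n, a * ‖x‖ := by
          refine Finset.sum_le_sum fun j _ => ?_
          rw [abs_mul]
          exact mul_le_mul (h i j) (abs_apply_le_norm x j) (abs_nonneg _) ha
      _ = _ := by simp [mul_assoc]
  calc ∑ i, |matL A x i| ≤ ∑ _i : m, Fintype.card n * a * ‖x‖ := Finset.sum_le_sum fun i _ => this i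
    _ = _ := by simp [mul_assoc]

lemma inner_matL_transpose (A : Matrix m n ℝ) (x : EuclideanSpace ℝ m) (y : EuclideanSpace ℝ n) :
    ⟪x, matL A y⟫ = ⟪matL Aᵀ x, y⟫ := by
  simp only [EuclideanSpace.inner_eq_star_dotProduct, ofLp_matL, star_trivial]
  rw [dotProduct_comm, Matrix.dotProduct_mulVec, Matrix.mulVec_transpose, dotProduct_comm]

end MatrixMaps

/-! ### Bounds and Lipschitz continuity of the Kalman gain -/

section Gain

variable {du dy : ℕ}

/-- The Kalman gain of a covariance matrix. -/
def gain (C : Matrix (Fin du ⊕ Fin dy) (Fin du ⊕ Fin dy) ℝ) : Vec dy →L[ℝ] Vec du :=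
  matL (C.toBlocks₁₂ * C.toBlocks₂₂⁻¹)

/-- Covariance matrices which are at least `lam` and whose entries are at most `a`. -/
structure CovBounds {ι : Type*} [Fintype ι] (lam a : ℝ) (C : Matrix ι ι ℝ) : Prop where
  herm : C.IsHermitian
  lower : ∀ x, lam * ‖x‖ ^ 2 ≤ quad C x
  entries : ∀ i j, |C i j| ≤ a

variable {C C' : Matrix (Fin du ⊕ Fin dy) (Fin du ⊕ Fin dy) ℝ} {lam a : ℝ}

lemma quad_toBlocks₂₂ (C : Matrix (Fin du ⊕ Fin dy) (Fin du ⊕ Fin dy) ℝ) (b : Vec dy) :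
    quad C.toBlocks₂₂ b = quad C (joint 0 b) := by
  simp [quad, dotProduct, Matrix.mulVec, Matrix.toBlocks₂₂]

lemma CovBounds.lower₂₂ (hC : CovBounds lam a C) (b : Vec dy) :
    lam * ‖b‖ ^ 2 ≤ quad C.toBlocks₂₂ b := by
  have := hC.lower (joint 0 b)
  rwa [norm_joint_sq, norm_zero, zero_pow two_ne_zero, zero_add, ← quad_toBlocks₂₂] at this

lemma CovBounds.posDef₂₂ (hC : CovBounds lam a C) (hlam : 0 < lam) : C.toBlocks₂₂.PosDef := by
  refine posDef_of_mul_norm_sq_le_quad ?_ hlam hC.lower₂₂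
  ext i j
  exact congrFun (congrFun hC.herm (Sum.inr i)) (Sum.inr j)

lemma CovBounds.norm_inv₂₂_le (hC : CovBounds lam a C) (hlam : 0 < lam) :
    ‖matL C.toBlocks₂₂⁻¹‖ ≤ lam⁻¹ :=
  norm_toEuclideanCLM_inv_le (hC.posDef₂₂ hlam) hlam hC.lower₂₂

lemma CovBounds.norm_gain_le (hC : CovBounds lam a C) (hlam : 0 < lam) (ha : 0 ≤ a) :
    ‖gain C‖ ≤ du * (dy * a) * lam⁻¹ := by
  rw [gain, matL_mul]
  refine (ContinuousLinearMap.opNorm_comp_le _ _).trans ?_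
  refine mul_le_mul ?_ (hC.norm_inv₂₂_le hlam) (norm_nonneg _) (by positivity)
  simpa using norm_matL_le (A := C.toBlocks₁₂) (fun i j => hC.entries _ _) ha

lemma CovBounds.norm_gain_sub_le (hC : CovBounds lam a C) (hC' : CovBounds lam a C')
    (hlam : 0 < lam) (ha : 0 ≤ a) {d : ℝ} (hd : 0 ≤ d) (h : ∀ i j, |C i j - C' i j| ≤ d) :
    ‖gain C - gain C'‖ ≤
      (du * dy * lam⁻¹ + du * dy * a * lam⁻¹ * (dy * dy) * lam⁻¹) * d := by
  have hu : IsUnit C.toBlocks₂₂.det :=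
    (Matrix.isUnit_iff_isUnit_det _).1 (hC.posDef₂₂ hlam).isUnit
  have hu' : IsUnit C'.toBlocks₂₂.det :=
    (Matrix.isUnit_iff_isUnit_det _).1 (hC'.posDef₂₂ hlam).isUnit
  -- A resolvent identity: every term carries one factor that is a difference of blocks, and the
  -- other factors are uniformly bounded.
  have e : C.toBlocks₁₂ * C.toBlocks₂₂⁻¹ - C'.toBlocks₁₂ * C'.toBlocks₂₂⁻¹ =
      (C.toBlocks₁₂ - C'.toBlocks₁₂) * C.toBlocks₂₂⁻¹ +
      (C'.toBlocks₁₂ * C'.toBlocks₂₂⁻¹) * ((C'.toBlocks₂₂ - C.toBlocks₂₂) * C.toBlocks₂₂⁻¹) := by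
    rw [Matrix.sub_mul, Matrix.sub_mul, Matrix.mul_nonsing_inv _ hu, Matrix.mul_sub, Matrix.mul_one,
      Matrix.mul_assoc C'.toBlocks₁₂, ← Matrix.mul_assoc C'.toBlocks₂₂⁻¹, Matrix.nonsing_inv_mul _ hu',
      Matrix.one_mul]
    abel
  have h1 := norm_matL_le (A := C.toBlocks₁₂ - C'.toBlocks₁₂) (a := d)
    (fun i j => by simpa using! h (Sum.inl i) (Sum.inr j)) hd
  have h2 := norm_matL_le (A := C'.toBlocks₂₂ - C.toBlocks₂₂) (a := d)
    (fun i j => by simpa [abs_sub_comm] using! h (Sum.inr i) (Sum.inr j)) hd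
  have h3 := hC'.norm_gain_le hlam ha
  have h4 := hC.norm_inv₂₂_le hlam
  simp only [Fintype.card_fin] at h1 h2
  rw [gain, gain, ← matL_sub, e, matL_add, matL_mul, matL_mul (C'.toBlocks₁₂ * _), matL_mul
    (C'.toBlocks₂₂ - C.toBlocks₂₂)]
  calc _ ≤ (du * (dy * d)) * lam⁻¹ + (du * (dy * a) * lam⁻¹) * ((dy * (dy * d)) * lam⁻¹) := by
        refine (norm_add_le _ _).trans (add_le_add ?_ ?_)
        · exact (ContinuousLinearMap.opNorm_comp_le _ _).trans
            (mul_le_mul h1 h4 (norm_nonneg _) (by positivity))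
        · refine (ContinuousLinearMap.opNorm_comp_le _ _).trans
            (mul_le_mul h3 ?_ (norm_nonneg _) (by positivity))
          exact (ContinuousLinearMap.opNorm_comp_le _ _).trans
            (mul_le_mul h2 h4 (norm_nonneg _) (by positivity))
    _ = _ := by ring

end Gain

/-! ### Nondegeneracy of the predicted covariance -/

section LowerBound

variable {du dy : ℕ} {κΨ κh ℓh : ℝ} {Ψ : Vec du → Vec du} {h : Vec du → Vec dy}
  {S : Matrix (Fin du) (Fin du) ℝ} {Γ : Matrix (Fin dy) (Fin dy) ℝ} {μ : Measure (Vec du)} {R : ℝ}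

lemma variance_inner_multivariateGaussian {n : ℕ} {S : Matrix (Fin n) (Fin n) ℝ} (hS : S.PosDef)
    (m a : Vec n) : Var[fun z => ⟪a, z⟫; multivariateGaussian m S] = quad S a := by
  rw [← covarianceBilin_self IsGaussian.memLp_two_id, covarianceBilin_multivariateGaussian
    hS.posSemidef]
  rfl

lemma memLp_two_of_le_weight (hμ : FourthMomentLE R μ) {f : Vec du × Vec du × Vec dy → ℝ}
    (hf : Measurable f) {c : ℝ} (hfc : ∀ ω, |f ω| ≤ c * weight ω) :
    MemLp f 2 (law S Γ μ) := by
  obtain ⟨B, -, hB⟩ := exists_integral_weight_pow_four_le S Γ R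
  refine (memLp_two_iff_integrable_sq hf.aestronglyMeasurable).2 ?_
  refine ((hB μ hμ).1.const_mul (c ^ 2)).mono' (by fun_prop) (ae_of_all _ fun ω => ?_)
  rw [Real.norm_of_nonneg (by positivity), ← sq_abs]
  have h1 := one_le_weight ω
  calc |f ω| ^ 2 ≤ (c * weight ω) ^ 2 := by gcongr; exact hfc ω
    _ = c ^ 2 * weight ω ^ 2 := by ring
    _ ≤ c ^ 2 * weight ω ^ 4 := by gcongr; norm_num

/-- Nonnegativity of the variance of `X + 2 Z` bounds the covariance of `X` and `Z` from below. -/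
lemma half_variance_sub_le {Ω : Type*} [MeasurableSpace Ω] {P : Measure Ω} [IsProbabilityMeasure P]
    {X Z : Ω → ℝ} (hX : MemLp X 2 P) (hZ : MemLp Z 2 P) :
    Var[X; P] / 2 - Var[Z; P] ≤ Var[fun ω => X ω + Z ω; P] := by
  have h1 := variance_fun_add hX hZ
  have h2 := variance_fun_add hX (hZ.const_mul 2)
  rw [covariance_const_mul_right, variance_const_mul] at h2
  have := variance_nonneg (fun ω => X ω + 2 * Z ω) P
  linarith

/-- The state noise is independent of `Ψ v`, so the variances add and that of `Ψ v` can be dropped.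
-/
lemma quad_le_variance_inner_state [IsProbabilityMeasure μ] (hμ : FourthMomentLE R μ)
    (H : VectorFields κΨ κh ℓh Ψ h) (hS : S.PosDef) (a : Vec du) :
    quad S a ≤ Var[fun ω => ⟪a, Ψ ω.1 + ω.2.1⟫; law S Γ μ] := by
  have hΨ := H.measurable_Ψ
  have e : (fun ω : Vec du × Vec du × Vec dy => ⟪a, Ψ ω.1 + ω.2.1⟫) =
      fun ω => (fun v => ⟪a, Ψ v⟫) ω.1 + (fun p : Vec du × Vec dy => ⟪a, p.1⟫) ω.2 := by
    funext ω; simp [inner_add_right]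
  have m2 : MemLp (fun p : Vec du × Vec dy => ⟪a, p.1⟫) 2
      ((multivariateGaussian 0 S).prod (multivariateGaussian 0 Γ)) := by
    have : MemLp (fun z : Vec du => ⟪a, z⟫) 2 (multivariateGaussian 0 S) :=
      IsGaussian.memLp_two_id.const_inner a
    exact this.comp_fst _
  have m1 : MemLp (fun v => ⟪a, Ψ v⟫) 2 μ := by
    refine (memLp_two_iff_integrable_sq (by fun_prop)).2 ?_
    refine hμ.integrable_of_le (by fun_prop) (c := ‖a‖ ^ 2 * (4 * κΨ ^ 2)) fun v => ?_
    rw [abs_of_nonneg (by positivity), ← sq_abs]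
    calc |⟪a, Ψ v⟫| ^ 2 ≤ (‖a‖ * (κΨ * (1 + ‖v‖))) ^ 2 := by
          gcongr
          exact (abs_real_inner_le_norm _ _).trans (by gcongr; exact H.growth_Ψ v)
      _ = ‖a‖ ^ 2 * (κΨ ^ 2 * (1 + ‖v‖) ^ 2) := by ring
      _ ≤ ‖a‖ ^ 2 * (κΨ ^ 2 * (4 * (1 + ‖v‖ ^ 4))) := by
          gcongr
          nlinarith [sq_nonneg (‖v‖ - 1), one_add_sq_le ‖v‖]
      _ = _ := by ring
  rw [e, law, variance_add_prod m1 m2]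
  have e2 : Var[fun p : Vec du × Vec dy => ⟪a, p.1⟫;
      (multivariateGaussian 0 S).prod (multivariateGaussian 0 Γ)] = quad S a := by
    rw [← variance_inner_multivariateGaussian hS 0 a]
    exact (measurePreserving_fst (μ := multivariateGaussian 0 S)
      (ν := multivariateGaussian 0 Γ)).variance_fun_comp (f := fun z => ⟪a, z⟫) (by fun_prop)
  rw [e2]
  linarith [variance_nonneg (fun v => ⟪a, Ψ v⟫) μ]

lemma quad_le_variance_add_inner_noise [IsProbabilityMeasure μ] {X : Vec du × Vec du → ℝ}
    (hX : Measurable X) (b : Vec dy) (hΓ : Γ.PosDef)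
    (hm : MemLp (fun ω : Vec du × Vec du × Vec dy => X (ω.1, ω.2.1)) 2 (law S Γ μ)) :
    quad Γ b ≤ Var[fun ω => X (ω.1, ω.2.1) + ⟪b, ω.2.2⟫; law S Γ μ] := by
  have hassoc := (measurePreserving_prodAssoc μ (multivariateGaussian 0 S)
    (multivariateGaussian 0 Γ))
  have m2 : MemLp (fun z : Vec dy => ⟪b, z⟫) 2 (multivariateGaussian 0 Γ) :=
    IsGaussian.memLp_two_id.const_inner b
  have m1 : MemLp X 2 (μ.prod (multivariateGaussian 0 S)) := by
    have hp : MeasurePreserving (fun ω : Vec du × Vec du × Vec dy => (ω.1, ω.2.1)) (law S Γ μ)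
        (μ.prod (multivariateGaussian 0 S)) :=
      (MeasurePreserving.id μ).prod (measurePreserving_fst (μ := multivariateGaussian 0 S)
        (ν := multivariateGaussian 0 Γ))
    rw [← hp.map_eq, memLp_map_measure_iff (by fun_prop) hp.measurable.aemeasurable]
    exact hm
  have e := hassoc.variance_fun_comp (f := fun ω : Vec du × Vec du × Vec dy =>
    X (ω.1, ω.2.1) + ⟪b, ω.2.2⟫) (by fun_prop)
  have e2 := variance_add_prod m1 m2
  rw [law, ← e]
  change _ ≤ Var[fun p : (Vec du × Vec du) × Vec dy => X p.1 + ⟪b, p.2⟫; _]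
  rw [e2, variance_inner_multivariateGaussian hΓ]
  linarith [variance_nonneg X (μ.prod (multivariateGaussian 0 S))]

lemma variance_inner_le {Ω : Type*} [MeasurableSpace Ω] {P : Measure Ω} [IsProbabilityMeasure P]
    {n : ℕ} (b : Vec n) {Y : Ω → Vec n} (hY : Measurable Y) {M : ℝ}
    (hi : Integrable (fun ω => ‖Y ω‖ ^ 2) P) (hM : ∫ ω, ‖Y ω‖ ^ 2 ∂P ≤ M) :
    Var[fun ω => ⟪b, Y ω⟫; P] ≤ M * ‖b‖ ^ 2 := by
  refine (variance_le_expectation_sq (by fun_prop)).trans ?_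
  calc ∫ ω, ((fun ω => ⟪b, Y ω⟫) ^ 2) ω ∂P ≤ ∫ ω, ‖b‖ ^ 2 * ‖Y ω‖ ^ 2 ∂P := by
        refine integral_mono_of_nonneg (ae_of_all _ fun ω => sq_nonneg _) (hi.const_mul _)
          (ae_of_all _ fun ω => ?_)
        simp only [Pi.pow_apply]
        rw [← mul_pow, ← sq_abs]
        gcongr
        exact abs_real_inner_le_norm _ _
    _ ≤ _ := by rw [integral_const_mul, mul_comm]; gcongr

lemma inner_joint (z : Joint du dy) (u : Vec du) (y : Vec dy) :
    ⟪z, joint u y⟫ = ⟪z.u, u⟫ + ⟪z.y, y⟫ := by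
  simp [PiLp.inner_apply, Fintype.sum_sum_type]

/-- The variance `V` of a linear form in direction `(a, b)` is bounded below twice. The observation
noise alone gives `γ ‖b‖² ≤ V`. The state noise gives `σ ‖a‖² / 2 - M ‖b‖² ≤ V`, where the
contribution of the datum is treated as a perturbation of variance at most `M ‖b‖²`. The first bound
absorbs the loss in the second. -/
lemma exists_covBounds_QP (κΨ κh ℓh : ℝ) (hS : S.PosDef) (hΓ : Γ.PosDef) (R : ℝ) :
    ∃ lam a : ℝ, 0 < lam ∧ 0 < a ∧ ∀ (Ψ : Vec du → Vec du) (h : Vec du → Vec dy),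
      VectorFields κΨ κh ℓh Ψ h → ∀ μ, FourthMomentLE R μ →
        CovBounds lam a (cov (QP Ψ h S Γ μ)) := by
  obtain ⟨R', hR'⟩ := exists_fourthMomentLE_QP (du := du) (dy := dy) κΨ κh ℓh hS hΓ R
  obtain ⟨cw, hcw, hsamp⟩ := exists_norm_sample_le (du := du) (dy := dy) κΨ κh ℓh
  obtain ⟨B, hB, hW⟩ := exists_integral_weight_pow_four_le S Γ R
  obtain ⟨σ, hσ, hσ'⟩ := exists_mul_norm_sq_le_quad hS
  obtain ⟨γ, hγ, hγ'⟩ := exists_mul_norm_sq_le_quad hΓ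
  set M := cw ^ 2 * B with hM
  have hM0 : 0 ≤ M := by positivity
  -- Solving the two lower bounds for the components of `x` gives `‖x‖² ≤ k V`, so `k⁻¹` is the
  -- lower bound of the covariance.
  set k := (1 + M / γ) * (2 / σ) + 1 / γ with hk
  have hk0 : 0 < k := by positivity
  refine ⟨k⁻¹, max 1 (2 * (1 + R') + (2 * (1 + R')) ^ 2), by positivity, by positivity,
    fun Ψ h H μ hμ => ?_⟩
  have := hμ.prob
  have hQ := hR' Ψ h H μ hμ
  have := hQ.prob
  refine ⟨cov_isHermitian _, fun (x : Joint du dy) => ?_, fun i j => (hQ.abs_cov_le i j).trans (le_max_right _ _)⟩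
  have hΨ := H.measurable_Ψ
  have hh := H.measurable_h
  have hs := measurable_sample hΨ hh
  have hy : ∀ ω, ‖h (Ψ ω.1 + ω.2.1) + ω.2.2‖ ≤ cw * weight ω := fun ω =>
    (Joint.norm_y_le (sample Ψ h ω)).trans (hsamp Ψ h H ω)
  have hu : ∀ ω : Vec du × Vec du × Vec dy, ‖Ψ ω.1 + ω.2.1‖ ≤ cw * weight ω := fun ω =>
    (Joint.norm_u_le (sample Ψ h ω)).trans (hsamp Ψ h H ω)
  set V := quad (cov (QP Ψ h S Γ μ)) x with hV
  have eV : V = Var[fun ω => ⟪x.u, Ψ ω.1 + ω.2.1⟫ + ⟪x.y, h (Ψ ω.1 + ω.2.1) + ω.2.2⟫;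
      law S Γ μ] := by
    rw [hV, quad_cov hQ.memLp_two, QP_eq_map hΨ hh hS hΓ,
      variance_map (by fun_prop) hs.aemeasurable]
    congr 1
    funext ω
    exact inner_joint x _ _
  have mU : MemLp (fun ω => ⟪x.u, Ψ ω.1 + ω.2.1⟫) 2 (law S Γ μ) :=
    memLp_two_of_le_weight hμ (by fun_prop) (c := ‖x.u‖ * cw) fun ω =>
      (abs_real_inner_le_norm _ _).trans (by rw [mul_assoc]; gcongr; exact hu ω)
  have mY : MemLp (fun ω => ⟪x.y, h (Ψ ω.1 + ω.2.1) + ω.2.2⟫) 2 (law S Γ μ) :=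
    memLp_two_of_le_weight hμ (by fun_prop) (c := ‖x.y‖ * cw) fun ω =>
      (abs_real_inner_le_norm _ _).trans (by rw [mul_assoc]; gcongr; exact hy ω)
  have mη : MemLp (fun ω : Vec du × Vec du × Vec dy => ⟪x.y, ω.2.2⟫) 2 (law S Γ μ) :=
    memLp_two_of_le_weight hμ (by fun_prop) (c := ‖x.y‖) fun ω =>
      (abs_real_inner_le_norm _ _).trans (by
        gcongr; unfold weight; linarith [norm_nonneg ω.1, norm_nonneg ω.2.1])
  have l1 : γ * ‖x.y‖ ^ 2 ≤ V := by
    refine (hγ' x.y).trans ?_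
    have := quad_le_variance_add_inner_noise (S := S) (Γ := Γ) (μ := μ)
      (X := fun p => ⟪x.u, Ψ p.1 + p.2⟫ + ⟪x.y, h (Ψ p.1 + p.2)⟫) (by fun_prop) x.y hΓ (by
        refine (mU.add (mY.sub mη)).ae_eq (ae_of_all _ fun ω => ?_)
        simp [inner_add_right])
    rw [eV]
    convert! this using 3 with ω
    rw [inner_add_right x.y]; ring
  have l2 : σ * ‖x.u‖ ^ 2 / 2 - M * ‖x.y‖ ^ 2 ≤ V := by
    rw [eV]
    refine le_trans ?_ (half_variance_sub_le mU mY)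
    have h1 := quad_le_variance_inner_state (Γ := Γ) hμ H hS x.u
    have h2 := hσ' x.u
    have h3 : Var[fun ω => ⟪x.y, h (Ψ ω.1 + ω.2.1) + ω.2.2⟫; law S Γ μ] ≤ M * ‖x.y‖ ^ 2 := by
      have hle : ∀ ω : Vec du × Vec du × Vec dy,
          ‖h (Ψ ω.1 + ω.2.1) + ω.2.2‖ ^ 2 ≤ cw ^ 2 * weight ω ^ 4 := fun ω => by
        have h1 := one_le_weight ω
        calc _ ≤ (cw * weight ω) ^ 2 := by gcongr; exact hy ω
          _ = cw ^ 2 * weight ω ^ 2 := by ring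
          _ ≤ _ := by gcongr; norm_num
      have hi := (hW μ hμ).1.const_mul (cw ^ 2)
      have hi' : Integrable (fun ω => ‖h (Ψ ω.1 + ω.2.1) + ω.2.2‖ ^ 2) (law S Γ μ) :=
        hi.mono' (by fun_prop) (ae_of_all _ fun ω => by
          rw [Real.norm_of_nonneg (by positivity)]; exact hle ω)
      refine variance_inner_le x.y (by fun_prop) hi' ?_
      calc _ ≤ ∫ ω, cw ^ 2 * weight ω ^ 4 ∂(law S Γ μ) := integral_mono hi' hi hle
        _ ≤ M := by rw [integral_const_mul, hM]; gcongr; exact (hW μ hμ).2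
    linarith
  have l3 : ‖x.y‖ ^ 2 ≤ V / γ := by rw [le_div_iff₀ hγ]; linarith
  have l4 : ‖x.u‖ ^ 2 ≤ (1 + M / γ) * V * (2 / σ) := by
    have : M * ‖x.y‖ ^ 2 ≤ M / γ * V := by
      calc M * ‖x.y‖ ^ 2 ≤ M * (V / γ) := by gcongr
        _ = _ := by ring
    rw [mul_div_assoc', le_div_iff₀ hσ]
    linarith
  rw [inv_mul_eq_div, div_le_iff₀ hk0, x.norm_sq]
  calc _ ≤ (1 + M / γ) * V * (2 / σ) + V / γ := add_le_add l4 l3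
    _ = V * k := by rw [hk]; ring

end LowerBound

/-! ### Lipschitz continuity of the prediction -/

section PredictionLipschitz

variable {du dy : ℕ} {κΨ κh ℓh : ℝ} {Ψ : Vec du → Vec du} {h : Vec du → Vec dy}
  {S : Matrix (Fin du) (Fin du) ℝ} {Γ : Matrix (Fin dy) (Fin dy) ℝ} {μ ν : Measure (Vec du)} {R : ℝ}

lemma FourthMomentLE.integrable_of_le_weight (hμ : FourthMomentLE R μ)
    {f : Vec du × Vec du × Vec dy → ℝ} (hf : Measurable f) {c : ℝ}
    (hfc : ∀ ω, |f ω| ≤ c * weight ω ^ 4) : Integrable f (law S Γ μ) := by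
  obtain ⟨B, -, hB⟩ := exists_integral_weight_pow_four_le S Γ R
  exact ((hB μ hμ).1.const_mul c).mono' hf.aestronglyMeasurable (ae_of_all _ hfc)

lemma integrable_noise_sq (S : Matrix (Fin du) (Fin du) ℝ) (Γ : Matrix (Fin dy) (Fin dy) ℝ) :
    Integrable (fun p : Vec du × Vec dy => (1 + ‖p.1‖ + ‖p.2‖) ^ 2)
      ((multivariateGaussian 0 S).prod (multivariateGaussian 0 Γ)) := by
  have i1 := (integrable_norm_pow_gaussian (ν := multivariateGaussian 0 S) 2).comp_fst
    (multivariateGaussian 0 Γ)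
  have i2 := (integrable_norm_pow_gaussian (ν := multivariateGaussian 0 Γ) 2).comp_snd
    (multivariateGaussian 0 S)
  refine ((((integrable_const (1 : ℝ)).add i1).add i2).const_mul 3).mono' (by fun_prop)
    (ae_of_all _ fun p => ?_)
  rw [Real.norm_of_nonneg (by positivity)]
  simp only [Pi.add_apply]
  nlinarith [sq_nonneg (‖p.1‖ - 1), sq_nonneg (‖p.2‖ - 1), sq_nonneg (‖p.1‖ - ‖p.2‖)]

/-- Averaging a test function over the noise gives a function of the current state alone, the same
for both measures. Linear growth of the samples bounds it by a multiple of `1 + ‖v‖²`, so it is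
again a test function up to a constant. -/
lemma exists_dg_QP_le (κΨ κh ℓh : ℝ) (hS : S.PosDef) (hΓ : Γ.PosDef) (R : ℝ) :
    ∃ C : ℝ, 0 < C ∧ ∀ (Ψ : Vec du → Vec du) (h : Vec du → Vec dy), VectorFields κΨ κh ℓh Ψ h →
      ∀ μ ν, FourthMomentLE R μ → FourthMomentLE R ν →
        dg (QP Ψ h S Γ μ) (QP Ψ h S Γ ν) ≤ ENNReal.ofReal C * dg μ ν := by
  obtain ⟨c, hc, hsamp⟩ := exists_norm_sample_le (du := du) (dy := dy) κΨ κh ℓh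
  set N := (multivariateGaussian 0 S).prod (multivariateGaussian 0 Γ) with hN
  set m := ∫ p : Vec du × Vec dy, (1 + ‖p.1‖ + ‖p.2‖) ^ 2 ∂N with hm
  have hm0 : 0 ≤ m := integral_nonneg fun _ => by positivity
  refine ⟨1 + 2 * c ^ 2 * m, by positivity, fun Ψ h H μ ν hμ hν => dg_le fun f hf hfg => ?_⟩
  have hs := measurable_sample H.measurable_Ψ H.measurable_h
  have := hμ.prob
  have := hν.prob
  have hbound : ∀ ω : Vec du × Vec du × Vec dy, |f (sample Ψ h ω)| ≤ 1 + c ^ 2 * weight ω ^ 2 :=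
    fun ω => (hfg _).trans (by rw [← mul_pow]; gcongr; exact hsamp Ψ h H ω)
  have hi : ∀ ρ : Measure (Vec du), FourthMomentLE R ρ →
      Integrable (fun ω => f (sample Ψ h ω)) (law S Γ ρ) := fun ρ hρ =>
    hρ.integrable_of_le_weight (by fun_prop) (c := 1 + c ^ 2) fun ω => by
      refine (hbound ω).trans ?_
      have h1 := one_le_weight ω
      have h2 : 1 ≤ weight ω ^ 4 := one_le_pow₀ h1
      have h3 : weight ω ^ 2 ≤ weight ω ^ 4 := pow_le_pow_right₀ h1 (by norm_num)
      rw [add_mul]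
      gcongr
      linarith
  set F : Vec du → ℝ := fun v => ∫ p, f (sample Ψ h (v, p)) ∂N with hF
  have hFm : Measurable F := by
    have : StronglyMeasurable fun ω : Vec du × Vec du × Vec dy => f (sample Ψ h ω) :=
      (hf.comp hs).stronglyMeasurable
    exact this.integral_prod_right.measurable
  have e : ∀ ρ : Measure (Vec du), FourthMomentLE R ρ →
      ∫ z, f z ∂(QP Ψ h S Γ ρ) = ∫ v, F v ∂ρ := fun ρ hρ => by
    have := hρ.prob
    rw [QP_eq_map H.measurable_Ψ H.measurable_h hS hΓ, integral_map hs.aemeasurable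
      hf.aestronglyMeasurable]
    exact integral_prod _ (hi ρ hρ)
  rw [e μ hμ, e ν hν]
  refine ofReal_abs_integral_sub_le_mul_dg hFm (by positivity) fun v => ?_
  have hin := integrable_noise_sq S Γ
  have hpt : ∀ p : Vec du × Vec dy, |f (sample Ψ h (v, p))| ≤
      1 * (1 + ‖v‖ ^ 2) + (2 * c ^ 2 * (1 + ‖v‖ ^ 2)) * (1 + ‖p.1‖ + ‖p.2‖) ^ 2 := fun p => by
    refine (hbound _).trans ?_
    have h1 : weight (v, p) ≤ (1 + ‖v‖) * (1 + ‖p.1‖ + ‖p.2‖) := by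
      simp only [weight]
      nlinarith [mul_nonneg (norm_nonneg v) (norm_nonneg p.1),
        mul_nonneg (norm_nonneg v) (norm_nonneg p.2)]
    have h0 := one_le_weight (v, p)
    have h2 : weight (v, p) ^ 2 ≤ (2 * (1 + ‖v‖ ^ 2)) * (1 + ‖p.1‖ + ‖p.2‖) ^ 2 := by
      calc weight (v, p) ^ 2 ≤ ((1 + ‖v‖) * (1 + ‖p.1‖ + ‖p.2‖)) ^ 2 := by gcongr
        _ = (1 + ‖v‖) ^ 2 * (1 + ‖p.1‖ + ‖p.2‖) ^ 2 := by ring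
        _ ≤ _ := by gcongr; nlinarith [sq_nonneg (‖v‖ - 1)]
    have h3 : c ^ 2 * weight (v, p) ^ 2 ≤
        c ^ 2 * ((2 * (1 + ‖v‖ ^ 2)) * (1 + ‖p.1‖ + ‖p.2‖) ^ 2) := by gcongr
    nlinarith [sq_nonneg ‖v‖]
  calc |F v| ≤ ∫ p, |f (sample Ψ h (v, p))| ∂N := abs_integral_le_integral_abs
    _ ≤ ∫ p : Vec du × Vec dy, (1 * (1 + ‖v‖ ^ 2) + (2 * c ^ 2 * (1 + ‖v‖ ^ 2)) *
        (1 + ‖p.1‖ + ‖p.2‖) ^ 2) ∂N :=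
        integral_mono_of_nonneg (ae_of_all _ fun _ => abs_nonneg _)
          ((integrable_const _).add (hin.const_mul _)) (ae_of_all _ hpt)
    _ = (1 + 2 * c ^ 2 * m) * (1 + ‖v‖ ^ 2) := by
        rw [integral_add (integrable_const _) (hin.const_mul _), integral_const,
          integral_const_mul, ← hm, probReal_univ, smul_eq_mul]
        ring

end PredictionLipschitz

/-! ### The affine analysis map and shears -/

section Shear

variable {du dy : ℕ}

/-- The affine analysis map with gain `A`. -/
def aff (A : Vec dy →L[ℝ] Vec du) (ydag : Vec dy) (z : Joint du dy) : Vec du :=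
  z.u + A (ydag - z.y)

@[fun_prop]
lemma continuous_aff (A : Vec dy →L[ℝ] Vec du) (ydag : Vec dy) :
    Continuous (aff A ydag : Joint du dy → Vec du) := by
  unfold aff; fun_prop

@[fun_prop]
lemma measurable_aff (A : Vec dy →L[ℝ] Vec du) (ydag : Vec dy) :
    Measurable (aff A ydag : Joint du dy → Vec du) :=
  (continuous_aff A ydag).measurable

lemma norm_aff_le {A : Vec dy →L[ℝ] Vec du} {ydag : Vec dy} {κ κy : ℝ} (hA : ‖A‖ ≤ κ)
    (hy : ‖ydag‖ ≤ κy) (z : Joint du dy) : ‖aff A ydag z‖ ≤ (1 + κ) * ‖z‖ + κ * κy := by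
  have hκ : 0 ≤ κ := (norm_nonneg _).trans hA
  calc ‖aff A ydag z‖ ≤ ‖z.u‖ + ‖A‖ * ‖ydag - z.y‖ :=
        (norm_add_le _ _).trans (by gcongr; exact A.le_opNorm _)
    _ ≤ ‖z‖ + κ * (κy + ‖z‖) := by
        gcongr
        · exact z.norm_u_le
        · exact (norm_sub_le _ _).trans (add_le_add hy z.norm_y_le)
    _ = _ := by ring

lemma exists_weight_aff_le (κ κy : ℝ) (hκ : 0 ≤ κ) :
    ∃ c : ℝ, 0 < c ∧ ∀ (A : Vec dy →L[ℝ] Vec du) (ydag : Vec dy), ‖A‖ ≤ κ → ‖ydag‖ ≤ κy →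
      ∀ z : Joint du dy, 1 + ‖aff A ydag z‖ ^ 2 ≤ c * (1 + ‖z‖ ^ 2) := by
  refine ⟨1 + 2 * (1 + κ) ^ 2 + 2 * (κ * κy) ^ 2, by positivity, fun A ydag hA hy z => ?_⟩
  have h1 := norm_aff_le hA hy z
  have h2 : ‖aff A ydag z‖ ^ 2 ≤ ((1 + κ) * ‖z‖ + κ * κy) ^ 2 := by gcongr
  have h3 := add_sq_le (a := (1 + κ) * ‖z‖) (b := κ * κy)
  have : 0 ≤ (1 + κ) ^ 2 := by positivity
  have : 0 ≤ (κ * κy) ^ 2 * ‖z‖ ^ 2 := by positivity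
  nlinarith [sq_nonneg ‖z‖]

/-- A shear of the joint space along the state component. -/
def shear (D : Vec dy →L[ℝ] Vec du) (ydag : Vec dy) (z : Joint du dy) : Joint du dy :=
  joint (z.u + D (ydag - z.y)) z.y

lemma measurable_shear (D : Vec dy →L[ℝ] Vec du) (ydag : Vec dy) :
    Measurable (shear D ydag : Joint du dy → Joint du dy) :=
  measurable_joint_comp (by fun_prop) (by fun_prop)

/-- For fixed `y` the shear is a translation in `u`. -/
lemma measurePreserving_shear (D : Vec dy →L[ℝ] Vec du) (ydag : Vec dy) :
    MeasurePreserving (shear D ydag : Joint du dy → Joint du dy) := by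
  have hm := measurable_shear (du := du) D ydag
  refine ⟨hm, Measure.ext_of_lintegral _ fun f hf => ?_⟩
  have hj := measurable_joint (du := du) (dy := dy)
  have sw : ∀ g : Joint du dy → ℝ≥0∞, Measurable g →
      ∫⁻ z, g z = ∫⁻ y, ∫⁻ u, g (joint u y) := fun g hg => by
    rw [lintegral_joint hg]
    exact lintegral_lintegral_swap (f := fun u y => g (joint u y)) (hg.comp hj).aemeasurable
  rw [lintegral_map hf hm, sw (fun z => f (shear D ydag z)) (hf.comp hm), sw f hf]
  refine lintegral_congr fun y => ?_
  simp only [shear, joint_u, joint_y]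
  exact lintegral_add_right_eq_self (fun u => f (joint u y)) _

end Shear

/-! ### Regularity of the transition density in the state -/

section TransitionDensity

lemma abs_exp_neg_sub_exp_neg_le (s t : ℝ) :
    |Real.exp (-s) - Real.exp (-t)| ≤ |s - t| * Real.exp (-s) + |s - t| * Real.exp (-t) := by
  have key : ∀ s t : ℝ, s ≤ t → |Real.exp (-s) - Real.exp (-t)| ≤ |s - t| * Real.exp (-s) := by
    intro s t hst
    rw [abs_exp_neg_sub_exp_neg, mul_comm |s - t|]
    refine mul_le_mul_of_nonneg_left ?_ (Real.exp_pos _).le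
    have h1 : Real.exp (s - t) ≤ 1 := Real.exp_le_one_iff.2 (by linarith)
    rw [abs_of_nonneg (sub_nonneg.2 h1), abs_of_nonpos (by linarith)]
    linarith [Real.add_one_le_exp (s - t)]
  rcases le_total s t with h | h
  · have := key s t h
    have : 0 ≤ |s - t| * Real.exp (-t) := by positivity
    linarith
  · have h1 := key t s h
    rw [abs_sub_comm, abs_sub_comm t s] at h1
    have : 0 ≤ |s - t| * Real.exp (-s) := by positivity
    linarith

variable {du dy : ℕ} {κΨ κh ℓh : ℝ} {Ψ : Vec du → Vec du} {h : Vec du → Vec dy}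
  {S : Matrix (Fin du) (Fin du) ℝ} {Γ : Matrix (Fin dy) (Fin dy) ℝ} {μ ν : Measure (Vec du)} {R : ℝ}

lemma transDensity_pos (hS : S.PosDef) (hΓ : Γ.PosDef) (v u : Vec du) (y : Vec dy) :
    0 < transDensity Ψ h S Γ v u y :=
  mul_pos (gaussDensity_pos hS _) (gaussDensity_pos hΓ _)

lemma transDensity_eq (v u : Vec du) (y : Vec dy) :
    transDensity Ψ h S Γ v u y = gaussConst S * gaussConst Γ *
      Real.exp (-(1 / 2 * quad S⁻¹ (u - Ψ v) + 1 / 2 * quad Γ⁻¹ (y - h u))) := by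
  rw [transDensity, gaussDensity_eq, gaussDensity_eq, neg_add, Real.exp_add]
  ring_nf

/-- The size of the noise which leads from the state `v` to `(u, y)`. -/
def noiseSize (Ψ : Vec du → Vec du) (h : Vec du → Vec dy) (v u : Vec du) (y : Vec dy) : ℝ :=
  1 + ‖u - Ψ v‖ + ‖y - h u‖

/-- The exponent is quadratic in the noise and `h` is Lipschitz, so its increment is at most the
displacement times the noise size. The right side is symmetric in `u` and `u'`: each density is
paired with its own noise size, which remains integrable after a change of variables. -/
lemma exists_abs_transDensity_sub_le (hℓ : 0 ≤ ℓh) (hS : S.PosDef) (hΓ : Γ.PosDef) :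
    ∃ C : ℝ, 0 < C ∧ ∀ (Ψ : Vec du → Vec du) (h : Vec du → Vec dy), VectorFields κΨ κh ℓh Ψ h →
      ∀ v u u' y, |transDensity Ψ h S Γ v u y - transDensity Ψ h S Γ v u' y| ≤
        C * ‖u' - u‖ * (noiseSize Ψ h v u y * transDensity Ψ h S Γ v u y +
          noiseSize Ψ h v u' y * transDensity Ψ h S Γ v u' y) := by
  set LS := ‖Matrix.toEuclideanCLM (𝕜 := ℝ) S⁻¹‖ with hLS
  set LΓ := ‖Matrix.toEuclideanCLM (𝕜 := ℝ) Γ⁻¹‖ with hLΓ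
  have hLS0 : 0 ≤ LS := norm_nonneg _
  have hLΓ0 : 0 ≤ LΓ := norm_nonneg _
  refine ⟨1 + LS + LΓ * ℓh + LΓ * ℓh ^ 2, by positivity, fun Ψ h H v u u' y => ?_⟩
  set C := 1 + LS + LΓ * ℓh + LΓ * ℓh ^ 2 with hC
  have hC1 : 1 ≤ C := by
    have : 0 ≤ LΓ * ℓh := by positivity
    have : 0 ≤ LΓ * ℓh ^ 2 := by positivity
    linarith
  have a0 := transDensity_pos (Ψ := Ψ) (h := h) hS hΓ v u y
  have a0' := transDensity_pos (Ψ := Ψ) (h := h) hS hΓ v u' y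
  have r1 : 1 ≤ noiseSize Ψ h v u y := by
    unfold noiseSize; linarith [norm_nonneg (u - Ψ v), norm_nonneg (y - h u)]
  have r1' : 1 ≤ noiseSize Ψ h v u' y := by
    unfold noiseSize; linarith [norm_nonneg (u' - Ψ v), norm_nonneg (y - h u')]
  set a := transDensity Ψ h S Γ v u y
  set a' := transDensity Ψ h S Γ v u' y
  set r := noiseSize Ψ h v u y with hr
  set r' := noiseSize Ψ h v u' y with hr'
  -- For displacements of at least one the sum of the densities already suffices, since the constant
  -- and the noise sizes are at least one. For smaller ones the noise sizes at `u` and `u'` are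
  -- comparable.
  rcases le_total 1 ‖u' - u‖ with hδ | hδ
  · calc |a - a'| ≤ a + a' := (abs_sub _ _).trans (by rw [abs_of_pos a0, abs_of_pos a0'])
      _ ≤ 1 * 1 * (r * a + r' * a') := by nlinarith
      _ ≤ C * ‖u' - u‖ * (r * a + r' * a') := by gcongr
  · set s := 1 / 2 * quad S⁻¹ (u - Ψ v) + 1 / 2 * quad Γ⁻¹ (y - h u) with hs
    set t := 1 / 2 * quad S⁻¹ (u' - Ψ v) + 1 / 2 * quad Γ⁻¹ (y - h u') with ht
    set δ := ‖u' - u‖ with hδ'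
    have hδ0 : 0 ≤ δ := norm_nonneg _
    have q1 := abs_quad_sub_quad_le S⁻¹ (u - Ψ v) (u' - Ψ v)
    have q2 := abs_quad_sub_quad_le Γ⁻¹ (y - h u) (y - h u')
    rw [sub_sub_sub_cancel_right, ← hLS, norm_sub_rev, ← hδ'] at q1
    rw [sub_sub_sub_cancel_left, ← hLΓ] at q2
    have l2 : ‖h u' - h u‖ ≤ ℓh * δ := H.lipschitz_h _ _
    have n1 : ‖u' - Ψ v‖ ≤ ‖u - Ψ v‖ + δ := by
      calc ‖u' - Ψ v‖ = ‖(u - Ψ v) + (u' - u)‖ := by congr 1; abel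
        _ ≤ _ := norm_add_le _ _
    have n1' : ‖u - Ψ v‖ ≤ ‖u' - Ψ v‖ + δ := by
      calc ‖u - Ψ v‖ = ‖(u' - Ψ v) - (u' - u)‖ := by congr 1; abel
        _ ≤ _ := norm_sub_le _ _
    have n2 : ‖y - h u'‖ ≤ ‖y - h u‖ + ℓh := by
      calc ‖y - h u'‖ = ‖(y - h u) - (h u' - h u)‖ := by congr 1; abel
        _ ≤ ‖y - h u‖ + ℓh * δ := (norm_sub_le _ _).trans (by gcongr)
        _ ≤ _ := by nlinarith
    have n2' : ‖y - h u‖ ≤ ‖y - h u'‖ + ℓh := by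
      calc ‖y - h u‖ = ‖(y - h u') + (h u' - h u)‖ := by congr 1; abel
        _ ≤ ‖y - h u'‖ + ℓh * δ := (norm_add_le _ _).trans (by gcongr)
        _ ≤ _ := by nlinarith
    have st : |s - t| ≤ 1 / 2 * (LS * (δ * (‖u - Ψ v‖ + ‖u' - Ψ v‖))) +
        1 / 2 * (LΓ * ((ℓh * δ) * (‖y - h u‖ + ‖y - h u'‖))) := by
      have e : s - t = 1 / 2 * (quad S⁻¹ (u - Ψ v) - quad S⁻¹ (u' - Ψ v)) +
        1 / 2 * (quad Γ⁻¹ (y - h u) - quad Γ⁻¹ (y - h u')) := by rw [hs, ht]; ring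
      rw [e]
      refine (abs_add_le _ _).trans ?_
      rw [abs_mul, abs_mul, abs_of_pos (by norm_num : (0 : ℝ) < 1 / 2)]
      gcongr
      refine q2.trans ?_
      gcongr
    have key : ∀ x z : ℝ, 0 ≤ x → 0 ≤ z → ‖u - Ψ v‖ + ‖u' - Ψ v‖ ≤ 2 * x + 1 →
        ‖y - h u‖ + ‖y - h u'‖ ≤ 2 * z + ℓh → |s - t| ≤ C * δ * (1 + x + z) := by
      intro x z hx hz h1 h2
      refine st.trans ?_
      calc _ ≤ 1 / 2 * (LS * (δ * (2 * x + 1))) + 1 / 2 * (LΓ * ((ℓh * δ) * (2 * z + ℓh))) := by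
            gcongr
        _ = δ * (LS * (x + 1 / 2) + LΓ * ℓh * z + LΓ * ℓh ^ 2 * (1 / 2)) := by ring
        _ ≤ δ * (LS * (1 + x + z) + LΓ * ℓh * (1 + x + z) + LΓ * ℓh ^ 2 * (1 + x + z)) := by
            have h3 : x + 1 / 2 ≤ 1 + x + z := by linarith
            have h4 : z ≤ 1 + x + z := by linarith
            have h5 : 1 / 2 ≤ 1 + x + z := by linarith
            have := mul_le_mul_of_nonneg_left h3 hLS0
            have := mul_le_mul_of_nonneg_left h4 (mul_nonneg hLΓ0 hℓ)
            have := mul_le_mul_of_nonneg_left h5 (mul_nonneg hLΓ0 (sq_nonneg ℓh))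
            exact mul_le_mul_of_nonneg_left (by linarith) hδ0
        _ ≤ δ * (C * (1 + x + z)) := by
            refine mul_le_mul_of_nonneg_left ?_ hδ0
            rw [hC]; nlinarith
        _ = _ := by ring
    have k1 : |s - t| ≤ C * δ * r := key _ _ (norm_nonneg _) (norm_nonneg _)
      (by linarith) (by linarith)
    have k2 : |s - t| ≤ C * δ * r' := key _ _ (norm_nonneg _) (norm_nonneg _)
      (by linarith) (by linarith)
    have hk : 0 < gaussConst S * gaussConst Γ := mul_pos (gaussConst_pos hS) (gaussConst_pos hΓ)
    have ea : a = gaussConst S * gaussConst Γ * Real.exp (-s) := transDensity_eq v u y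
    have ea' : a' = gaussConst S * gaussConst Γ * Real.exp (-t) := transDensity_eq v u' y
    calc |a - a'| = gaussConst S * gaussConst Γ * |Real.exp (-s) - Real.exp (-t)| := by
          rw [ea, ea', ← mul_sub, abs_mul, abs_of_pos hk]
      _ ≤ gaussConst S * gaussConst Γ *
          (|s - t| * Real.exp (-s) + |s - t| * Real.exp (-t)) := by
          gcongr; exact abs_exp_neg_sub_exp_neg_le s t
      _ = |s - t| * a + |s - t| * a' := by rw [ea, ea']; ring
      _ ≤ (C * δ * r) * a + (C * δ * r') * a' := by gcongr
      _ = _ := by ring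

end TransitionDensity

/-! ### Lipschitz continuity of the Kalman analysis -/

section AnalysisLipschitz

variable {du dy : ℕ} {κΨ κh ℓh : ℝ} {Ψ : Vec du → Vec du} {h : Vec du → Vec dy}
  {S : Matrix (Fin du) (Fin du) ℝ} {Γ : Matrix (Fin dy) (Fin dy) ℝ} {μ ν : Measure (Vec du)} {R : ℝ}

lemma ofReal_abs_integral_le {α : Type*} [MeasurableSpace α] {P : Measure α} (f : α → ℝ) :
    ENNReal.ofReal |∫ x, f x ∂P| ≤ ∫⁻ x, ENNReal.ofReal |f x| ∂P := by
  have := enorm_integral_le_lintegral_enorm (μ := P) f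
  simpa only [Real.enorm_eq_ofReal_abs] using this

lemma ofReal_abs_toReal_lintegral_sub_le {α : Type*} [MeasurableSpace α] {P : Measure α}
    {a b : α → ℝ} (ha : Integrable a P) (hb : Integrable b P) (ha0 : ∀ x, 0 ≤ a x)
    (hb0 : ∀ x, 0 ≤ b x) :
    ENNReal.ofReal |(∫⁻ x, ENNReal.ofReal (a x) ∂P).toReal -
      (∫⁻ x, ENNReal.ofReal (b x) ∂P).toReal| ≤ ∫⁻ x, ENNReal.ofReal |a x - b x| ∂P := by
  rw [← integral_eq_lintegral_of_nonneg_ae (ae_of_all _ ha0) ha.aestronglyMeasurable,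
    ← integral_eq_lintegral_of_nonneg_ae (ae_of_all _ hb0) hb.aestronglyMeasurable,
    ← integral_sub ha hb]
  exact ofReal_abs_integral_le _

@[fun_prop]
lemma measurable_transDensity (hΨ : Measurable Ψ) (hh : Measurable h) :
    Measurable fun p : Vec du × Joint du dy => transDensity Ψ h S Γ p.1 p.2.u p.2.y := by
  unfold transDensity; fun_prop

lemma integrable_transDensity [IsProbabilityMeasure μ] (hΨ : Measurable Ψ) (hS : S.PosDef)
    (hΓ : Γ.PosDef) (u : Vec du) (y : Vec dy) :
    Integrable (fun v => transDensity Ψ h S Γ v u y) μ := by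
  refine (integrable_const (gaussConst S * gaussConst Γ)).mono'
    (by unfold transDensity; fun_prop) (ae_of_all _ fun v => ?_)
  rw [Real.norm_of_nonneg (transDensity_pos hS hΓ _ _ _).le]
  exact mul_le_mul (gaussDensity_le hS _) (gaussDensity_le hΓ _) (gaussDensity_pos hΓ _).le
    (gaussConst_pos hS).le

lemma jointDensity_ne_top [IsProbabilityMeasure μ] (hS : S.PosDef) (u : Vec du) (y : Vec dy) :
    jointDensity Ψ h S Γ μ u y ≠ ⊤ :=
  ENNReal.mul_ne_top ENNReal.ofReal_ne_top (predDensity_ne_top hS u)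

lemma integral_QP [IsProbabilityMeasure μ] (hΨ : Measurable Ψ) (hh : Measurable h)
    (hS : S.PosDef) (f : Joint du dy → ℝ) :
    ∫ z, f z ∂(QP Ψ h S Γ μ) = ∫ z, (jointDensity Ψ h S Γ μ z.u z.y).toReal * f z :=
  integral_withDensity_eq_integral_toReal_smul (measurable_jointDensity hΨ hh)
    (ae_of_all _ fun _ => (jointDensity_ne_top hS _ _).lt_top) _

lemma integrable_QP_iff [IsProbabilityMeasure μ] (hΨ : Measurable Ψ) (hh : Measurable h)
    (hS : S.PosDef) {f : Joint du dy → ℝ} :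
    Integrable f (QP Ψ h S Γ μ) ↔
      Integrable fun z : Joint du dy => (jointDensity Ψ h S Γ μ z.u z.y).toReal * f z :=
  integrable_withDensity_iff_integrable_smul₀' (measurable_jointDensity hΨ hh).aemeasurable
    (ae_of_all _ fun _ => (jointDensity_ne_top hS _ _).lt_top)

/-- The weight of the transition density in the estimate of a shear. -/
def shearWeight (Ψ : Vec du → Vec du) (h : Vec du → Vec dy) (A : Vec dy →L[ℝ] Vec du)
    (ydag : Vec dy) (p : Vec du × Joint du dy) : ℝ :=
  (1 + ‖aff A ydag p.2‖ ^ 2) * ‖ydag - p.2.y‖ * noiseSize Ψ h p.1 p.2.u p.2.y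

lemma shearWeight_nonneg (A : Vec dy →L[ℝ] Vec du) (ydag : Vec dy) (p : Vec du × Joint du dy) :
    0 ≤ shearWeight Ψ h A ydag p := by
  unfold shearWeight noiseSize; positivity

@[fun_prop]
lemma measurable_shearWeight (hΨ : Measurable Ψ) (hh : Measurable h) (A : Vec dy →L[ℝ] Vec du)
    (ydag : Vec dy) : Measurable (shearWeight Ψ h A ydag) := by
  unfold shearWeight noiseSize; fun_prop

/-- The weight has degree four in the sample: two from the test function, one from the innovation
`y† - y` that multiplies the change of gain, one from the noise size. Hence the use of fourth
moments. -/
lemma exists_lintegral_shearWeight_le (κΨ κh ℓh : ℝ) (S : Matrix (Fin du) (Fin du) ℝ)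
    (Γ : Matrix (Fin dy) (Fin dy) ℝ) (R : ℝ) {κ κy : ℝ} (hκ : 0 ≤ κ) (hκy : 0 ≤ κy) :
    ∃ C : ℝ, 0 < C ∧ ∀ (Ψ : Vec du → Vec du) (h : Vec du → Vec dy), VectorFields κΨ κh ℓh Ψ h →
      ∀ μ, FourthMomentLE R μ → ∀ (A : Vec dy →L[ℝ] Vec du) (ydag : Vec dy), ‖A‖ ≤ κ →
        ‖ydag‖ ≤ κy →
        ∫⁻ ω, ENNReal.ofReal (shearWeight Ψ h A ydag (ω.1, sample Ψ h ω)) ∂(law S Γ μ) ≤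
          ENNReal.ofReal C := by
  obtain ⟨cw, hcw, hsamp⟩ := exists_norm_sample_le (du := du) (dy := dy) κΨ κh ℓh
  obtain ⟨B, hB, hW⟩ := exists_integral_weight_pow_four_le S Γ R
  obtain ⟨ca, hca, haff⟩ := exists_weight_aff_le (du := du) (dy := dy) κ κy hκ
  set k := ca * (1 + cw ^ 2) * (κy + cw) with hk
  have hk0 : 0 < k := by positivity
  refine ⟨k * B, by positivity, fun Ψ h H μ hμ A ydag hA hy => ?_⟩
  have hle : ∀ ω, shearWeight Ψ h A ydag (ω.1, sample Ψ h ω) ≤ k * weight ω ^ 4 := fun ω => by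
    have h1 := one_le_weight ω
    have hz := hsamp Ψ h H ω
    have e1 : 1 + ‖aff A ydag (sample Ψ h ω)‖ ^ 2 ≤ ca * ((1 + cw ^ 2) * weight ω ^ 2) := by
      refine (haff A ydag hA hy _).trans ?_
      gcongr
      calc 1 + ‖sample Ψ h ω‖ ^ 2 ≤ 1 ^ 2 + (cw * weight ω) ^ 2 := by rw [one_pow]; gcongr
        _ ≤ weight ω ^ 2 + (cw * weight ω) ^ 2 := by gcongr
        _ = _ := by ring
    have e2 : ‖ydag - (sample Ψ h ω).y‖ ≤ (κy + cw) * weight ω := by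
      calc _ ≤ κy + cw * weight ω := (norm_sub_le _ _).trans
            (add_le_add hy ((Joint.norm_y_le _).trans hz))
        _ ≤ κy * weight ω + cw * weight ω := by gcongr; exact le_mul_of_one_le_right hκy h1
        _ = _ := by ring
    have e3 : noiseSize Ψ h ω.1 (sample Ψ h ω).u (sample Ψ h ω).y ≤ weight ω := by
      simp only [noiseSize, sample, joint_u, joint_y, weight, add_sub_cancel_left]
      linarith [norm_nonneg ω.1]
    have e4 : 0 ≤ noiseSize Ψ h ω.1 (sample Ψ h ω).u (sample Ψ h ω).y := by
      unfold noiseSize; positivity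
    calc shearWeight Ψ h A ydag (ω.1, sample Ψ h ω)
        ≤ ca * ((1 + cw ^ 2) * weight ω ^ 2) * ((κy + cw) * weight ω) * weight ω := by
          unfold shearWeight; gcongr
      _ = _ := by rw [hk]; ring
  calc _ ≤ ∫⁻ ω, ENNReal.ofReal (k * weight ω ^ 4) ∂(law S Γ μ) :=
        lintegral_mono fun ω => ENNReal.ofReal_le_ofReal (hle ω)
    _ = ENNReal.ofReal (∫ ω, k * weight ω ^ 4 ∂(law S Γ μ)) :=
        (ofReal_integral_eq_lintegral_ofReal ((hW μ hμ).1.const_mul k)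
          (ae_of_all _ fun ω => by positivity)).symm
    _ ≤ _ := by
        refine ENNReal.ofReal_le_ofReal ?_
        rw [integral_const_mul]
        gcongr
        exact (hW μ hμ).2

lemma aff_shear (A A' : Vec dy →L[ℝ] Vec du) (ydag : Vec dy) (z : Joint du dy) :
    aff A' ydag (shear (A - A') ydag z) = aff A ydag z := by
  simp [aff, shear, add_assoc]

/-- A test function has no modulus of continuity, so the two maps cannot be compared inside it. The
shear with `D = A - A'` satisfies `aff A' ∘ shear = aff A` and preserves volume. The difference of
the integrals is therefore one of `f ∘ aff A` against the density and its sheared copy, whose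
displacement is at most `‖A - A'‖ ‖y† - y‖`. -/
lemma exists_dg_map_aff_le (κΨ κh : ℝ) (hℓ : 0 ≤ ℓh) (hS : S.PosDef) (hΓ : Γ.PosDef) (R : ℝ)
    {κ κy : ℝ} (hκ : 0 ≤ κ) (hκy : 0 ≤ κy) :
    ∃ C : ℝ, 0 < C ∧ ∀ (Ψ : Vec du → Vec du) (h : Vec du → Vec dy), VectorFields κΨ κh ℓh Ψ h →
      ∀ μ, FourthMomentLE R μ → ∀ (A A' : Vec dy →L[ℝ] Vec du) (ydag : Vec dy), ‖A‖ ≤ κ →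
        ‖A'‖ ≤ κ → ‖ydag‖ ≤ κy →
        dg ((QP Ψ h S Γ μ).map (aff A ydag)) ((QP Ψ h S Γ μ).map (aff A' ydag)) ≤
          ENNReal.ofReal (C * ‖A - A'‖) := by
  obtain ⟨R', hR'⟩ := exists_fourthMomentLE_QP (du := du) (dy := dy) κΨ κh ℓh hS hΓ R
  obtain ⟨C₀, hC₀, htrans⟩ := exists_abs_transDensity_sub_le (κΨ := κΨ) (κh := κh) hℓ hS hΓ
  obtain ⟨C₁, hC₁, hwt⟩ := exists_lintegral_shearWeight_le κΨ κh ℓh S Γ R hκ hκy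
  obtain ⟨ca, hca, haff⟩ := exists_weight_aff_le (du := du) (dy := dy) κ κy hκ
  refine ⟨2 * C₀ * C₁, by positivity, fun Ψ h H μ hμ A A' ydag hA hA' hy =>
    dg_le fun f hf hfg => ?_⟩
  have := hμ.prob
  have hΨ := H.measurable_Ψ
  have hh := H.measurable_h
  have hQ := hR' Ψ h H μ hμ
  have hs := measurePreserving_shear (du := du) (A - A') ydag
  have hsm := hs.measurable
  set p : Joint du dy → ℝ≥0∞ := fun z => jointDensity Ψ h S Γ μ z.u z.y with hp
  have hpm : Measurable p := measurable_jointDensity hΨ hh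
  have hint : ∀ B : Vec dy →L[ℝ] Vec du, ‖B‖ ≤ κ →
      Integrable (fun z => (p z).toReal * f (aff B ydag z)) := fun B hB => by
    refine (integrable_QP_iff hΨ hh hS).1 ?_
    refine (hQ.integrable_weight.const_mul ca).mono'
      (hf.comp (measurable_aff B ydag)).aestronglyMeasurable (ae_of_all _ fun z => ?_)
    exact (hfg _).trans (haff B ydag hB hy z)
  have e1 : ∀ B : Vec dy →L[ℝ] Vec du, ∫ x, f x ∂((QP Ψ h S Γ μ).map (aff B ydag)) =
      ∫ z, (p z).toReal * f (aff B ydag z) := fun B => by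
    rw [integral_map (by fun_prop) hf.aestronglyMeasurable, integral_QP hΨ hh hS]
  have e2 : ∫ z, (p z).toReal * f (aff A' ydag z) =
      ∫ z, (p (shear (A - A') ydag z)).toReal * f (aff A ydag z) := by
    conv_lhs => rw [← hs.map_eq]
    rw [integral_map hsm.aemeasurable (by fun_prop)]
    simp only [aff_shear]
  have hint' : Integrable (fun z => (p (shear (A - A') ydag z)).toReal * f (aff A ydag z)) := by
    have := hs.integrable_comp_of_integrable (hint A' hA')
    simpa only [Function.comp_def, aff_shear] using this
  rw [e1, e1, e2, ← integral_sub (hint A hA) hint']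
  refine (ofReal_abs_integral_le _).trans ?_
  set k := C₀ * ‖A - A'‖ with hk
  have hk0 : 0 ≤ k := by positivity
  set G : (Vec dy →L[ℝ] Vec du) → Vec du × Joint du dy → ℝ≥0∞ := fun B q =>
    ENNReal.ofReal (k * shearWeight Ψ h B ydag q) with hG
  have hGm : ∀ B, Measurable (G B) := fun B => by
    have := measurable_shearWeight hΨ hh B ydag
    fun_prop
  have htm := measurable_transDensity (S := S) (Γ := Γ) hΨ hh
  set I : (Vec dy →L[ℝ] Vec du) → Joint du dy → ℝ≥0∞ := fun B z =>
    ∫⁻ v, ENNReal.ofReal (transDensity Ψ h S Γ v z.u z.y) * G B (v, z) ∂μ with hI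
  have hIm : ∀ B, Measurable (I B) := fun B => by
    have := hGm B
    exact Measurable.lintegral_prod_left' (f := fun q : Vec du × Joint du dy =>
      ENNReal.ofReal (transDensity Ψ h S Γ q.1 q.2.u q.2.y) * G B q) (by fun_prop)
  have hIint : ∀ B : Vec dy →L[ℝ] Vec du, ‖B‖ ≤ κ → ∫⁻ z, I B z ≤ ENNReal.ofReal (k * C₁) :=
    fun B hB => by
      rw [hI, lintegral_lintegral_transDensity hΨ hh hS hΓ (hGm B)]
      simp only [hG, ENNReal.ofReal_mul hk0]
      have := measurable_shearWeight hΨ hh B ydag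
      have hsam := measurable_sample hΨ hh
      rw [lintegral_const_mul _ (by fun_prop)]
      gcongr
      exact hwt Ψ h H μ hμ B ydag hB hy
  have hpt : ∀ z, ENNReal.ofReal |(p z).toReal * f (aff A ydag z) -
      (p (shear (A - A') ydag z)).toReal * f (aff A ydag z)| ≤
      I A z + I A' (shear (A - A') ydag z) := fun z => by
    set z' := shear (A - A') ydag z with hz'
    have hy' : z'.y = z.y := rfl
    have hu' : z'.u - z.u = (A - A') (ydag - z.y) := by simp [hz', shear]
    have hδ : ‖z'.u - z.u‖ ≤ ‖A - A'‖ * ‖ydag - z.y‖ := by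
      rw [hu']; exact ContinuousLinearMap.le_opNorm _ _
    have hGmv : ∀ B w, Measurable fun v => G B (v, w) := fun B w =>
      (hGm B).comp measurable_prodMk_right
    -- The estimate below is made for each current state `v` separately and then integrated, since
    -- the regularity in `u` belongs to the transition density.
    have htv : ∀ u y, Measurable fun v => transDensity Ψ h S Γ v u y := fun u y => by
      unfold transDensity; fun_prop
    have hg0 : 0 ≤ 1 + ‖aff A ydag z‖ ^ 2 := by positivity
    rw [← sub_mul, abs_mul, ENNReal.ofReal_mul (abs_nonneg _)]
    calc ENNReal.ofReal |(p z).toReal - (p z').toReal| * ENNReal.ofReal |f (aff A ydag z)|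
        ≤ (∫⁻ v, ENNReal.ofReal |transDensity Ψ h S Γ v z.u z.y -
            transDensity Ψ h S Γ v z'.u z.y| ∂μ) * ENNReal.ofReal (1 + ‖aff A ydag z‖ ^ 2) := by
          refine mul_le_mul' ?_ (ENNReal.ofReal_le_ofReal (hfg _))
          simp only [hp, jointDensity_eq hΨ hΓ, hy']
          exact ofReal_abs_toReal_lintegral_sub_le (integrable_transDensity hΨ hS hΓ _ _)
            (integrable_transDensity hΨ hS hΓ _ _) (fun v => (transDensity_pos hS hΓ _ _ _).le)
            (fun v => (transDensity_pos hS hΓ _ _ _).le)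
      _ = ∫⁻ v, ENNReal.ofReal (|transDensity Ψ h S Γ v z.u z.y -
            transDensity Ψ h S Γ v z'.u z.y| * (1 + ‖aff A ydag z‖ ^ 2)) ∂μ := by
          rw [← lintegral_mul_const _ (by fun_prop)]
          simp only [ENNReal.ofReal_mul (abs_nonneg _)]
      _ ≤ ∫⁻ v, (ENNReal.ofReal (transDensity Ψ h S Γ v z.u z.y) * G A (v, z) +
            ENNReal.ofReal (transDensity Ψ h S Γ v z'.u z'.y) * G A' (v, z')) ∂μ := by
          refine lintegral_mono fun v => ?_
          have a0 := (transDensity_pos (Ψ := Ψ) (h := h) hS hΓ v z.u z.y).le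
          have a0' := (transDensity_pos (Ψ := Ψ) (h := h) hS hΓ v z'.u z.y).le
          have n0 : 0 ≤ noiseSize Ψ h v z.u z.y := by unfold noiseSize; positivity
          have n0' : 0 ≤ noiseSize Ψ h v z'.u z.y := by unfold noiseSize; positivity
          simp only [hG]
          rw [hy', ← ENNReal.ofReal_mul a0, ← ENNReal.ofReal_mul a0', ← ENNReal.ofReal_add
            (mul_nonneg a0 (mul_nonneg hk0 (shearWeight_nonneg _ _ _)))
            (mul_nonneg a0' (mul_nonneg hk0 (shearWeight_nonneg _ _ _)))]
          refine ENNReal.ofReal_le_ofReal ?_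
          simp only [shearWeight, hz', aff_shear]
          rw [← hz', hy']
          calc _ ≤ (C₀ * (‖A - A'‖ * ‖ydag - z.y‖) *
                (noiseSize Ψ h v z.u z.y * transDensity Ψ h S Γ v z.u z.y +
                noiseSize Ψ h v z'.u z.y * transDensity Ψ h S Γ v z'.u z.y)) *
                (1 + ‖aff A ydag z‖ ^ 2) := by
                refine mul_le_mul_of_nonneg_right ((htrans Ψ h H v z.u z'.u z.y).trans ?_) hg0
                gcongr
            _ = _ := by rw [hk]; ring
      _ = I A z + I A' z' := by
          have := hGmv A z
          have := hGmv A' z'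
          have := htv z.u z.y
          exact lintegral_add_left (by fun_prop) _
  -- Preservation of volume removes the shear from the second term; this is why it was written with
  -- `A'` and the sheared point.
  calc _ ≤ ∫⁻ z, (I A z + I A' (shear (A - A') ydag z)) := lintegral_mono hpt
    _ = (∫⁻ z, I A z) + ∫⁻ z, I A' z := by
        rw [lintegral_add_left (hIm A), hs.lintegral_comp (hIm A')]
    _ ≤ ENNReal.ofReal (k * C₁) + ENNReal.ofReal (k * C₁) :=
        add_le_add (hIint A hA) (hIint A' hA')
    _ = _ := by
        rw [← ENNReal.ofReal_add (by positivity) (by positivity)]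
        congr 1; rw [hk]; ring

lemma kalmanTransport_eq (ydag : Vec dy) (π : Measure (Joint du dy)) :
    kalmanTransport ydag π = π.map (aff (gain (cov π)) ydag) := rfl

/-- The intermediate measure is `QPμ` transported with the gain of `QPν`. One leg changes the
measure under a fixed affine map; the other changes the gain, which is Lipschitz in the covariance
and hence in `dg`. -/
lemma exists_dg_kalmanTransport_QP_le (κΨ κh : ℝ) (hℓ : 0 ≤ ℓh) (hS : S.PosDef) (hΓ : Γ.PosDef)
    (R : ℝ) {κy : ℝ} (hκy : 0 ≤ κy) :
    ∃ C : ℝ, 0 < C ∧ ∀ (Ψ : Vec du → Vec du) (h : Vec du → Vec dy), VectorFields κΨ κh ℓh Ψ h →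
      ∀ μ ν, FourthMomentLE R μ → FourthMomentLE R ν → ∀ ydag : Vec dy, ‖ydag‖ ≤ κy →
        dg (kalmanTransport ydag (QP Ψ h S Γ ν)) (kalmanTransport ydag (QP Ψ h S Γ μ)) ≤
          ENNReal.ofReal C * dg (QP Ψ h S Γ ν) (QP Ψ h S Γ μ) := by
  obtain ⟨R', hR'⟩ := exists_fourthMomentLE_QP (du := du) (dy := dy) κΨ κh ℓh hS hΓ R
  obtain ⟨lam, a, hlam, ha, hcov⟩ := exists_covBounds_QP (du := du) (dy := dy) κΨ κh ℓh hS hΓ R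
  set κ : ℝ := du * (dy * a) * lam⁻¹
  have hκ : 0 ≤ κ := by positivity
  obtain ⟨C₁, hC₁, h₁⟩ := exists_dg_map_aff_le κΨ κh hℓ hS hΓ R hκ hκy
  obtain ⟨ca, hca, haff⟩ := exists_weight_aff_le (du := du) (dy := dy) κ κy hκ
  set g : ℝ := du * dy * lam⁻¹ + du * dy * a * lam⁻¹ * (dy * dy) * lam⁻¹
  have hg : 0 ≤ g := by positivity
  set d : ℝ := 1 + 4 * (1 + R')
  -- A negative `R'` cannot bound a fourth moment: no measure is then admissible, and any constant
  -- serves.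
  by_cases hR0 : 0 ≤ R'
  swap
  · refine ⟨1, one_pos, fun Ψ h H μ ν hμ hν => absurd (hR' Ψ h H μ hμ).nonneg hR0⟩
  refine ⟨ca + C₁ * (g * d), by positivity, fun Ψ h H μ ν hμ hν ydag hy => ?_⟩
  have hQμ := hR' Ψ h H μ hμ
  have hQν := hR' Ψ h H ν hν
  have cμ := hcov Ψ h H μ hμ
  have cν := hcov Ψ h H ν hν
  have hd : dg (QP Ψ h S Γ ν) (QP Ψ h S Γ μ) ≠ ⊤ :=
    (dg_lt_top hQν.integrable_weight hQμ.integrable_weight).ne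
  have gν := cν.norm_gain_le hlam ha.le
  have gμ := cμ.norm_gain_le hlam ha.le
  have hsub := cν.norm_gain_sub_le cμ hlam ha.le (by positivity)
    (hQν.abs_cov_sub_cov_le hQμ)
  set D := dg (QP Ψ h S Γ ν) (QP Ψ h S Γ μ) with hD
  rw [kalmanTransport_eq, kalmanTransport_eq]
  calc _ ≤ dg ((QP Ψ h S Γ ν).map (aff (gain (cov (QP Ψ h S Γ ν))) ydag))
          ((QP Ψ h S Γ μ).map (aff (gain (cov (QP Ψ h S Γ ν))) ydag)) +
        dg ((QP Ψ h S Γ μ).map (aff (gain (cov (QP Ψ h S Γ ν))) ydag))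
          ((QP Ψ h S Γ μ).map (aff (gain (cov (QP Ψ h S Γ μ))) ydag)) := dg_triangle
    _ ≤ ENNReal.ofReal ca * D + ENNReal.ofReal (C₁ * (g * (d * D.toReal))) := by
        refine add_le_add (dg_map_le (by fun_prop) hca (haff _ ydag gν hy)) ?_
        refine (h₁ Ψ h H μ hμ _ _ ydag gν gμ hy).trans (ENNReal.ofReal_le_ofReal ?_)
        gcongr
    _ = _ := by
        rw [ENNReal.ofReal_add hca.le (by positivity), add_mul (ENNReal.ofReal ca)]
        congr 1
        have e : C₁ * (g * (d * D.toReal)) = C₁ * (g * d) * D.toReal := by ring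
        rw [e, ENNReal.ofReal_mul (by positivity), ENNReal.ofReal_toReal hd]

end AnalysisLipschitz

/-! ### Gaussian measures and the Gaussian projection -/

section GaussianMeasures

variable {ι : Type*} [Fintype ι] [DecidableEq ι]

lemma isGaussian_eq_multivariateGaussian (ν : Measure (EuclideanSpace ℝ ι)) [IsGaussian ν] :
    ν = multivariateGaussian (mean ν) (cov ν) := by
  have hm : MemLp id 2 ν := IsGaussian.memLp_two_id
  refine IsGaussian.ext ?_ ?_
  · simp [mean]
  · ext x y
    rw [covarianceBilin_multivariateGaussian (posSemidef_cov hm), dotProduct_cov_mulVec hm,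
      covarianceBilin_apply_eq_cov hm]

lemma cov_multivariateGaussian {m : EuclideanSpace ℝ ι} {C : Matrix ι ι ℝ} (hC : C.PosSemidef) :
    cov (multivariateGaussian m C) = C := by
  ext i j
  exact covariance_eval_multivariateGaussian hC i j

lemma mean_multivariateGaussian (m : EuclideanSpace ℝ ι) (C : Matrix ι ι ℝ) :
    mean (multivariateGaussian m C) = m := integral_id_multivariateGaussian

lemma integrable_weight_of_memLp {π : Measure (EuclideanSpace ℝ ι)} [IsProbabilityMeasure π]
    (hπ : MemLp id 2 π) : Integrable (fun x => 1 + ‖x‖ ^ 2) π :=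
  (integrable_const 1).add ((memLp_two_iff_integrable_sq_norm (by fun_prop)).1 hπ)

lemma integral_norm_sq_eq {π : Measure (EuclideanSpace ℝ ι)} [IsProbabilityMeasure π]
    (hπ : MemLp id 2 π) : ∫ x, ‖x‖ ^ 2 ∂π = ∑ i, (cov π i i + mean π i ^ 2) := by
  have hm : ∀ i, MemLp (fun z : EuclideanSpace ℝ ι => z i) 2 π := fun i =>
    (EuclideanSpace.proj (𝕜 := ℝ) i : EuclideanSpace ℝ ι →L[ℝ] ℝ).comp_memLp' hπ
  simp only [EuclideanSpace.norm_sq_eq, Real.norm_eq_abs, sq_abs]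
  rw [integral_finsetSum _ fun i _ => (hm i).integrable_sq]
  refine Finset.sum_congr rfl fun i _ => ?_
  have e : mean π i = ∫ x, x i ∂π := by
    have := (EuclideanSpace.proj (𝕜 := ℝ) i : EuclideanSpace ℝ ι →L[ℝ] ℝ).integral_comp_comm
      (hπ.integrable one_le_two)
    simpa [mean] using this.symm
  rw [e, cov, Matrix.of_apply, covariance_self (by fun_prop), variance_eq_sub (hm i)]
  simp

lemma memLp_two_gaussProj (π : Measure (EuclideanSpace ℝ ι)) : MemLp id 2 (gaussProj π) :=
  IsGaussian.memLp_two_id (μ := multivariateGaussian (mean π) (cov π))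

instance (π : Measure (EuclideanSpace ℝ ι)) : IsGaussian (gaussProj π) :=
  isGaussian_multivariateGaussian

lemma cov_gaussProj {π : Measure (EuclideanSpace ℝ ι)} [IsFiniteMeasure π] (hπ : MemLp id 2 π) :
    cov (gaussProj π) = cov π :=
  cov_multivariateGaussian (posSemidef_cov hπ)

/-- The second moment is a function of mean and covariance alone, so moment bounds of `π` transfer
to its Gaussian projection. -/
lemma integral_weight_gaussProj {π : Measure (EuclideanSpace ℝ ι)} [IsProbabilityMeasure π]
    (hπ : MemLp id 2 π) :
    ∫ x, (1 + ‖x‖ ^ 2) ∂(gaussProj π) = ∫ x, (1 + ‖x‖ ^ 2) ∂π := by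
  have h2 := (memLp_two_iff_integrable_sq_norm (by fun_prop)).1 hπ
  have h2' := (memLp_two_iff_integrable_sq_norm (by fun_prop)).1 (memLp_two_gaussProj π)
  simp only [id] at h2 h2'
  rw [integral_add (integrable_const _) h2, integral_add (integrable_const _) h2',
    integral_norm_sq_eq hπ, integral_norm_sq_eq (memLp_two_gaussProj π), cov_gaussProj hπ]
  simp only [gaussProj, mean_multivariateGaussian]
  simp

end GaussianMeasures

/-! ### Factorization of a Gaussian density by its analysis variable -/

section GaussianConditioning

variable {du dy : ℕ} {lam a : ℝ}

lemma norm_le_norm_joint (u : Vec du) (y : Vec dy) : ‖u‖ ≤ ‖joint u y‖ :=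
  (joint u y).norm_u_le

lemma inner_aff (K : Matrix (Fin du) (Fin dy) ℝ) (ydag : Vec dy) (b : Vec du) (z : Joint du dy) :
    ⟪b, aff (matL K) ydag z⟫ = ⟪joint b (-matL Kᵀ b), z⟫ + ⟪b, matL K ydag⟫ := by
  rw [real_inner_comm z, inner_joint, aff, map_sub, inner_add_right, inner_sub_right,
    inner_matL_transpose K b z.y, inner_neg_right, real_inner_comm b z.u,
    real_inner_comm (matL Kᵀ b) z.y]
  ring

lemma variance_inner_aff {p : Measure (Joint du dy)} [IsProbabilityMeasure p]
    (K : Matrix (Fin du) (Fin dy) ℝ) (ydag : Vec dy) (b : Vec du) (hp : MemLp id 2 p) :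
    Var[fun z => ⟪b, aff (matL K) ydag z⟫; p] = quad (cov p) (joint b (-matL Kᵀ b)) := by
  simp only [inner_aff]
  rw [variance_add_const (by fun_prop), quad_cov hp]

/-- These are the normal equations of linear regression: the gain is chosen so that `C₁₂ - C₁₂ C₂₂⁻¹
C₂₂ = 0`, which makes the residual uncorrelated with the datum. -/
lemma dotProduct_gain_eq_zero {C : Matrix (Fin du ⊕ Fin dy) (Fin du ⊕ Fin dy) ℝ}
    (hC : C.toBlocks₂₂.PosDef) (b : Vec du) (c : Vec dy) :
    WithLp.ofLp (joint b (-matL (C.toBlocks₁₂ * C.toBlocks₂₂⁻¹)ᵀ b)) ⬝ᵥ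
      (C *ᵥ WithLp.ofLp (joint (0 : Vec du) c)) = 0 := by
  have hu : IsUnit C.toBlocks₂₂.det := (Matrix.isUnit_iff_isUnit_det _).1 hC.isUnit
  have e : WithLp.ofLp (joint b (-matL (C.toBlocks₁₂ * C.toBlocks₂₂⁻¹)ᵀ b)) ⬝ᵥ
      (C *ᵥ WithLp.ofLp (joint (0 : Vec du) c)) =
      WithLp.ofLp b ⬝ᵥ (C.toBlocks₁₂ *ᵥ WithLp.ofLp c) -
      WithLp.ofLp (matL (C.toBlocks₁₂ * C.toBlocks₂₂⁻¹)ᵀ b) ⬝ᵥ (C.toBlocks₂₂ *ᵥ WithLp.ofLp c) := by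
    simp [dotProduct, Matrix.mulVec, Matrix.toBlocks₁₂, Matrix.toBlocks₂₂, sub_eq_add_neg]
  rw [e, ofLp_matL, Matrix.mulVec_transpose, ← Matrix.dotProduct_mulVec, Matrix.mulVec_mulVec,
    Matrix.mul_assoc, Matrix.nonsing_inv_mul _ hu, Matrix.mul_one, sub_self]

/-- The analysis variable and the datum are independent under a Gaussian measure. -/
lemma indepFun_aff_y {p : Measure (Joint du dy)} [IsGaussian p] (hlam : 0 < lam)
    (hC : CovBounds lam a (cov p)) (ydag : Vec dy) :
    IndepFun (aff (gain (cov p)) ydag) Joint.y p := by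
  have hp : MemLp id 2 p := IsGaussian.memLp_two_id
  have hlaw : HasGaussianLaw (fun z : Joint du dy => (z.u - gain (cov p) z.y, z.y)) p :=
    IsGaussian.hasGaussianLaw_id.map_fun ((uL - (gain (cov p)).comp yL).prod yL)
  have hind : IndepFun (fun z : Joint du dy => z.u - gain (cov p) z.y) Joint.y p := by
    -- For jointly Gaussian variables vanishing covariances imply independence.
    refine hlaw.indepFun_of_covariance_inner fun b c => ?_
    have e1 : (fun z : Joint du dy => ⟪b, z.u - gain (cov p) z.y⟫) =
        fun z => ⟪joint b (-matL ((cov p).toBlocks₁₂ * (cov p).toBlocks₂₂⁻¹)ᵀ b), z⟫ := by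
      funext z
      have := inner_aff ((cov p).toBlocks₁₂ * (cov p).toBlocks₂₂⁻¹) 0 b z
      simpa [aff, gain, sub_eq_add_neg] using this
    have e2 : (fun z : Joint du dy => ⟪c, z.y⟫) = fun z => ⟪joint (0 : Vec du) c, z⟫ := by
      funext z
      rw [real_inner_comm z, inner_joint, inner_zero_right, zero_add, real_inner_comm]
    rw [e1, e2, ← dotProduct_cov_mulVec hp]
    exact dotProduct_gain_eq_zero (hC.posDef₂₂ hlam) b c
  have := hind.comp (φ := fun w => w + gain (cov p) ydag) (ψ := id) (by fun_prop) measurable_id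
  convert! this using 1
  funext z
  simp only [aff, map_sub, Function.comp_apply]
  abel

/-- The density of a nondegenerate Gaussian measure on the joint space factors into the density of
its analysis variable and the density of the datum. -/
lemma exists_gaussian_density {p : Measure (Joint du dy)} [IsGaussian p] (hlam : 0 < lam)
    (hC : CovBounds lam a (cov p)) (ydag : Vec dy) :
    ∃ (mw : Vec du) (my : Vec dy) (Sw : Matrix (Fin du) (Fin du) ℝ)
      (Sy : Matrix (Fin dy) (Fin dy) ℝ), Sw.PosDef ∧ Sy.PosDef ∧
      (∀ x, lam * ‖x‖ ^ 2 ≤ quad Sw x) ∧ (∀ x, lam * ‖x‖ ^ 2 ≤ quad Sy x) ∧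
      p.map (aff (gain (cov p)) ydag) =
        volume.withDensity (fun u => ENNReal.ofReal (gaussDensity Sw (u - mw))) ∧
      p = volume.withDensity fun z => ENNReal.ofReal
        (gaussDensity Sw (aff (gain (cov p)) ydag z - mw) * gaussDensity Sy (z.y - my)) := by
  have hp : MemLp id 2 p := IsGaussian.memLp_two_id
  set K := gain (cov p) with hK
  set W := p.map (aff K ydag) with hW
  set Y := p.map (Joint.y : Joint du dy → Vec dy) with hY
  have : IsGaussian Y := (inferInstance : IsGaussian (p.map yL))
  have : IsGaussian W := by
    set L : Joint du dy →L[ℝ] Vec du := uL - K.comp yL with hL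
    have e : (aff K ydag : Joint du dy → Vec du) = (fun w => w + K ydag) ∘ L := by
      funext z
      simp only [hL, aff, map_sub, Function.comp_apply, sub_apply,
        ContinuousLinearMap.comp_apply, uL_apply, yL_apply]
      abel
    rw [hW, e, ← Measure.map_map (by fun_prop) (by fun_prop)]
    infer_instance
  -- The variance of the analysis variable in direction `b` is the joint covariance form at `(b, -Kᵀ
  -- b)`, a vector at least as long as `b`.
  have lw : ∀ b, lam * ‖b‖ ^ 2 ≤ quad (cov W) b := fun b => by
    rw [quad_cov IsGaussian.memLp_two_id, hW, variance_map (by fun_prop) (by fun_prop)]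
    have := variance_inner_aff ((cov p).toBlocks₁₂ * (cov p).toBlocks₂₂⁻¹) ydag b hp
    change _ ≤ Var[fun z => ⟪b, aff K ydag z⟫; p]
    rw [hK, gain, this]
    refine le_trans ?_ (hC.lower _)
    gcongr
    exact norm_le_norm_joint _ _
  have ly : ∀ b, lam * ‖b‖ ^ 2 ≤ quad (cov Y) b := fun b => by
    rw [quad_cov IsGaussian.memLp_two_id, hY, variance_map (by fun_prop) (by fun_prop)]
    have e2 : (fun w => ⟪b, w⟫) ∘ Joint.y = fun z : Joint du dy => ⟪joint (0 : Vec du) b, z⟫ := by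
      funext z
      rw [real_inner_comm z, inner_joint, inner_zero_right, zero_add, real_inner_comm]
      rfl
    rw [e2, ← quad_cov hp, ← quad_toBlocks₂₂]
    exact hC.lower₂₂ b
  have pw : (cov W).PosDef := posDef_of_mul_norm_sq_le_quad (cov_isHermitian _) hlam lw
  have py : (cov Y).PosDef := posDef_of_mul_norm_sq_le_quad (cov_isHermitian _) hlam ly
  have eW : W = volume.withDensity fun u => ENNReal.ofReal (gaussDensity (cov W) (u - mean W)) := by
    rw [withDensity_gaussDensity pw]; exact isGaussian_eq_multivariateGaussian W
  have eY : Y = volume.withDensity fun u => ENNReal.ofReal (gaussDensity (cov Y) (u - mean Y)) := by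
    rw [withDensity_gaussDensity py]; exact isGaussian_eq_multivariateGaussian Y
  refine ⟨mean W, mean Y, cov W, cov Y, pw, py, lw, ly, eW, ?_⟩
  have hprod : p.map (fun z => (aff K ydag z, z.y)) = W.prod Y :=
    (indepFun_iff_map_prod_eq_prod_map_map (by fun_prop) (by fun_prop)).1
      (indepFun_aff_y hlam hC ydag)
  refine Measure.ext_of_lintegral _ fun f hf => ?_
  have hs := measurePreserving_shear (du := du) K ydag
  have hs' := measurable_shear (du := du) (-K) ydag
  have hj := measurable_joint (du := du) (dy := dy)
  have inv : ∀ z : Joint du dy, shear (-K) ydag (shear K ydag z) = z := fun z => by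
    have e : z.u + K (ydag - z.y) + (-K) (ydag - z.y) = z.u := by
      rw [neg_apply, add_neg_cancel_right]
    simp only [shear, joint_u, joint_y, e, joint_u_y]
  have inv' : ∀ z : Joint du dy, shear (-K) ydag (joint (aff K ydag z) z.y) = z := fun z => by
    have e : z.u + K (ydag - z.y) + (-K) (ydag - z.y) = z.u := by
      rw [neg_apply, add_neg_cancel_right]
    simp only [shear, aff, joint_u, joint_y, e, joint_u_y]
  have hgm : Measurable fun q : Vec du × Vec dy => f (shear (-K) ydag (joint q.1 q.2)) := by fun_prop
  -- The opposite shear recovers `z` from the analysis variable and the datum, whose law is a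
  -- product of densities. Undoing the shear under Lebesgue measure brings this product to the
  -- original coordinates without a Jacobian.
  calc ∫⁻ z, f z ∂p = ∫⁻ z, f (shear (-K) ydag (joint (aff K ydag z) z.y)) ∂p := by
        simp only [inv']
    _ = ∫⁻ q, f (shear (-K) ydag (joint q.1 q.2)) ∂(W.prod Y) := by
        rw [← hprod, lintegral_map hgm (by fun_prop)]
    _ = ∫⁻ u, ∫⁻ y, ENNReal.ofReal (gaussDensity (cov W) (u - mean W) *
          gaussDensity (cov Y) (y - mean Y)) * f (shear (-K) ydag (joint u y)) := by
        rw [lintegral_prod _ hgm.aemeasurable]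
        conv_lhs => rw [eW, eY]
        rw [lintegral_withDensity_eq_lintegral_mul _ (by fun_prop)
          (Measurable.lintegral_prod_right' hgm)]
        refine lintegral_congr fun u => ?_
        have hgu : Measurable fun y => f (shear (-K) ydag (joint u y)) :=
          hgm.comp measurable_prodMk_left
        rw [Pi.mul_apply, lintegral_withDensity_eq_lintegral_mul _ (by fun_prop) hgu,
          ← lintegral_const_mul _ (by fun_prop)]
        refine lintegral_congr fun y => ?_
        rw [Pi.mul_apply, ENNReal.ofReal_mul (gaussDensity_pos pw _).le, mul_assoc]
    _ = ∫⁻ z, ENNReal.ofReal (gaussDensity (cov W) (z.u - mean W) *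
          gaussDensity (cov Y) (z.y - mean Y)) * f (shear (-K) ydag z) := by
        rw [lintegral_joint (by fun_prop)]
        rfl
    _ = ∫⁻ z, ENNReal.ofReal (gaussDensity (cov W) (aff K ydag z - mean W) *
          gaussDensity (cov Y) (z.y - mean Y)) * f z := by
        rw [← hs.lintegral_comp (by fun_prop)]
        simp only [inv]
        rfl
    _ = _ := by
        rw [lintegral_withDensity_eq_lintegral_mul _ (by fun_prop) hf]
        rfl

end GaussianConditioning

/-! ### Quadratic polynomials along lines -/

section Slices

variable {n m : ℕ} {B B' : ℝ} {q q' : Vec n → ℝ} {y : Vec n}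

lemma QuadraticAt.add (h : QuadraticAt B q y) (h' : QuadraticAt B' q' y) :
    QuadraticAt (B + B') (fun x => q x + q' x) y := fun v hv => by
  obtain ⟨b, c, hc, e⟩ := h v hv
  obtain ⟨b', c', hc', e'⟩ := h' v hv
  exact ⟨b + b', c + c', add_le_add hc hc', fun t => by simp only [e, e']; ring⟩

lemma QuadraticAt.add_const (h : QuadraticAt B q y) (k : ℝ) :
    QuadraticAt B (fun x => q x + k) y := fun v hv => by
  obtain ⟨b, c, hc, e⟩ := h v hv
  exact ⟨b, c, hc, fun t => by simp only [e]; ring⟩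

lemma QuadraticAt.mono (h : QuadraticAt B q y) (hB : B ≤ B') : QuadraticAt B' q y := fun v hv => by
  obtain ⟨b, c, hc, e⟩ := h v hv
  exact ⟨b, c, hc.trans hB, e⟩

lemma quadraticAt_quad {A : Matrix (Fin m) (Fin m) ℝ} {b κ : ℝ} (hb : 0 ≤ b)
    (hA : ∀ x, quad A x ≤ b * ‖x‖ ^ 2) {L : Vec n →L[ℝ] Vec m} (hL : ‖L‖ ≤ κ) (c : Vec m) :
    QuadraticAt (1 / 2 * (b * κ ^ 2)) (fun x => 1 / 2 * quad A (c + L x)) y := fun v hv => by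
  refine ⟨1 / 2 * (quad A (c + L y + (1 : ℝ) • L v) - quad A (c + L y) - quad A (L v)),
    1 / 2 * quad A (L v), ?_, fun t => ?_⟩
  · have : ‖L v‖ ≤ κ * 1 := (L.le_opNorm v).trans
      (mul_le_mul hL hv (norm_nonneg _) ((norm_nonneg _).trans hL))
    rw [mul_one] at this
    have h1 := hA (L v)
    have h2 : b * ‖L v‖ ^ 2 ≤ b * κ ^ 2 := by gcongr
    linarith
  · simp only [map_add, map_smul, ← add_assoc, quad_add_smul]
    ring

end Slices

/-! ### Values on the slice against `L¹` norms on the fibre -/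

section SliceEstimate

variable {du dy : ℕ} {κΨ κh ℓh : ℝ} {Ψ : Vec du → Vec du} {h : Vec du → Vec dy}
  {S : Matrix (Fin du) (Fin du) ℝ} {Γ : Matrix (Fin dy) (Fin dy) ℝ} {μ ν : Measure (Vec du)} {R : ℝ}

lemma mul_exp_eq_exp_neg {k : ℝ} (hk : 0 < k) (x : ℝ) :
    k * Real.exp (-x) = Real.exp (-(x + -Real.log k)) := by
  rw [neg_add, neg_neg, Real.exp_add, Real.exp_log hk, mul_comm]

/-- The values on the slice `y = y†` of two densities, one Gaussian in `y` and the other jointly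
Gaussian, are close if the densities are close in `L¹` along the fibre. -/
lemma exists_ofReal_abs_slice_sub_le (hΓ : Γ.PosDef) {lam κ : ℝ} (hlam : 0 < lam) :
    ∃ C : ℝ, 0 < C ∧ ∀ (Sw : Matrix (Fin du) (Fin du) ℝ) (Sy : Matrix (Fin dy) (Fin dy) ℝ),
      Sw.PosDef → Sy.PosDef → (∀ x, lam * ‖x‖ ^ 2 ≤ quad Sw x) →
      (∀ x, lam * ‖x‖ ^ 2 ≤ quad Sy x) → ∀ K : Vec dy →L[ℝ] Vec du, ‖K‖ ≤ κ →
      ∀ (u mw : Vec du) (m my ydag : Vec dy) (r : ℝ), 0 < r →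
        ENNReal.ofReal |gaussDensity Γ (ydag - m) * r -
          gaussDensity Sw (aff K ydag (joint u ydag) - mw) * gaussDensity Sy (ydag - my)| ≤
        ENNReal.ofReal C * ∫⁻ y, ENNReal.ofReal |gaussDensity Γ (y - m) * r -
          gaussDensity Sw (aff K ydag (joint u y) - mw) * gaussDensity Sy (y - my)| := by
  obtain ⟨c, hc, hcΓ⟩ := exists_mul_norm_sq_le_quad hΓ
  -- The sum of the leading coefficient bounds of both exponents, so that it serves for each. The
  -- terms come from `Γ`, from `Sw` composed with the gain, and from `Sy`.
  set B : ℝ := 1 / 2 * (c⁻¹ * 1 ^ 2) + (1 / 2 * (lam⁻¹ * κ ^ 2) + 1 / 2 * (lam⁻¹ * 1 ^ 2)) with hB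
  have hB0 : 0 ≤ B := by positivity
  set V := volume (Metric.closedBall (0 : Vec dy) 1) with hV
  have hVtop : V ≠ ⊤ := measure_closedBall_lt_top.ne
  have hV0 : 0 < V.toReal := ENNReal.toReal_pos
    (Metric.measure_closedBall_pos volume _ one_pos).ne' hVtop
  refine ⟨V.toReal⁻¹ * (18 * Real.exp (9 * B)), by positivity,
    fun Sw Sy hSw hSy hlw hly K hK u mw m my ydag r hr => ?_⟩
  -- The positive prefactors are absorbed as additive constants of the exponents. They do not affect
  -- leading coefficients, so the estimate is uniform in `r`, the means and the determinants.
  set k₁ : ℝ := -Real.log (gaussConst Γ * r)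
  set k₂ : ℝ := -Real.log (gaussConst Sw * gaussConst Sy)
  set q₁ : Vec dy → ℝ := fun y => 1 / 2 * quad Γ⁻¹ (-m + ContinuousLinearMap.id ℝ _ y) + k₁ with hq₁
  set q₂ : Vec dy → ℝ := fun y => 1 / 2 * quad Sw⁻¹ ((u + K ydag - mw) + (-K) y) +
    1 / 2 * quad Sy⁻¹ (-my + ContinuousLinearMap.id ℝ _ y) + k₂ with hq₂
  have e₁ : ∀ y, gaussDensity Γ (y - m) * r = Real.exp (-q₁ y) := fun y => by
    rw [hq₁, ← mul_exp_eq_exp_neg (mul_pos (gaussConst_pos hΓ) hr), gaussDensity_eq,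
      show y - m = -m + ContinuousLinearMap.id ℝ _ y by simp [sub_eq_neg_add], neg_mul]
    ring_nf
  have e₂ : ∀ y, gaussDensity Sw (aff K ydag (joint u y) - mw) * gaussDensity Sy (y - my) =
      Real.exp (-q₂ y) := fun y => by
    rw [hq₂, ← mul_exp_eq_exp_neg (mul_pos (gaussConst_pos hSw) (gaussConst_pos hSy)),
      gaussDensity_eq, gaussDensity_eq, neg_add, Real.exp_add,
      show y - my = -my + ContinuousLinearMap.id ℝ _ y by simp [sub_eq_neg_add],
      show aff K ydag (joint u y) - mw = (u + K ydag - mw) + (-K) y by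
        simp [aff]; abel, neg_mul, neg_mul]
    ring
  have hid : ‖ContinuousLinearMap.id ℝ (Vec dy)‖ ≤ 1 := ContinuousLinearMap.norm_id_le
  have h₁ : QuadraticAt B q₁ ydag := by
    refine ((quadraticAt_quad (inv_nonneg.2 hc.le) (quad_inv_le hΓ hc hcΓ) hid
      (-m)).add_const k₁).mono ?_
    rw [hB]; simp only [le_add_iff_nonneg_right]; positivity
  have h₂ : QuadraticAt B q₂ ydag := by
    refine (((quadraticAt_quad (inv_nonneg.2 hlam.le) (quad_inv_le hSw hlam hlw)
      ((norm_neg K).trans_le hK) (u + K ydag - mw)).add (quadraticAt_quad (inv_nonneg.2 hlam.le)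
      (quad_inv_le hSy hlam hly) hid (-my))).add_const k₂).mono ?_
    rw [hB]; simp only [le_add_iff_nonneg_left]; positivity
  have key := h₁.ofReal_abs_exp_sub_exp_le hB0 h₂ (by fun_prop) (by fun_prop)
  simp only [e₁, e₂]
  rw [ENNReal.ofReal_mul (by positivity), ENNReal.ofReal_inv_of_pos hV0,
    ENNReal.ofReal_toReal hVtop, mul_assoc, ← ENNReal.div_eq_inv_mul]
  rw [ENNReal.le_div_iff_mul_le (Or.inl (Metric.measure_closedBall_pos volume _ one_pos).ne')
    (Or.inl hVtop), mul_comm]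
  exact key

end SliceEstimate

/-! ### Stability of normalization -/

section Normalization

variable {n : ℕ}

/-- Stability in the weighted total variation distance of the normalization of a density. -/
lemma dg_withDensity_div_le {a : Vec n → ℝ≥0∞} {s : Vec n → ℝ} (ha : Measurable a)
    (ha' : ∀ x, a x ≠ ⊤) (hs : Measurable s) (hs0 : ∀ x, 0 ≤ s x) {n₀ z₀ m : ℝ} (hz₀ : 0 < z₀)
    [hp : IsProbabilityMeasure (volume.withDensity fun x => ENNReal.ofReal (s x))]
    (hi : Integrable (fun x => 1 + ‖x‖ ^ 2) (volume.withDensity fun x => ENNReal.ofReal (s x)))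
    (hm : ∫ x, (1 + ‖x‖ ^ 2) ∂(volume.withDensity fun x => ENNReal.ofReal (s x)) ≤ m)
    (hZ : ENNReal.ofReal z₀ ≤ ∫⁻ x, a x) (hZ' : ∫⁻ x, a x ≠ ⊤) :
    dg (volume.withDensity fun x => ENNReal.ofReal (s x))
      (volume.withDensity fun x => a x / ∫⁻ x, a x) ≤
      ENNReal.ofReal (z₀⁻¹ * (m + 1)) *
        ∫⁻ x, ENNReal.ofReal ((1 + ‖x‖ ^ 2) * |(a x).toReal - s x * n₀|) := by
  set D := ∫⁻ x, ENNReal.ofReal ((1 + ‖x‖ ^ 2) * |(a x).toReal - s x * n₀|) with hD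
  set Z := ∫⁻ x, a x with hZdef
  have hm0 : 0 ≤ m := (integral_nonneg fun x => by positivity).trans hm
  have hc : 0 < z₀⁻¹ * (m + 1) := by positivity
  rcases eq_or_ne D ⊤ with hDtop | hDtop
  · rw [hDtop, ENNReal.mul_top (by simpa using hc)]; exact le_top
  have hZr : z₀ ≤ Z.toReal := by
    rwa [← ENNReal.ofReal_le_iff_le_toReal hZ']
  have hZ0 : 0 < Z.toReal := hz₀.trans_le hZr
  have iD : Integrable fun x => (1 + ‖x‖ ^ 2) * |(a x).toReal - s x * n₀| := by
    refine ⟨by fun_prop, ?_⟩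
    rw [hasFiniteIntegral_iff_ofReal (ae_of_all _ fun x => by positivity)]
    exact lt_top_iff_ne_top.2 hDtop
  have eD : ∫ x, (1 + ‖x‖ ^ 2) * |(a x).toReal - s x * n₀| = D.toReal :=
    integral_eq_lintegral_of_nonneg_ae (ae_of_all _ fun x => by positivity) (by fun_prop)
  have hsint : ∀ f : Vec n → ℝ, ∫ x, f x ∂(volume.withDensity fun x => ENNReal.ofReal (s x)) =
      ∫ x, s x * f x := fun f => by
    rw [integral_withDensity_eq_integral_toReal_smul (by fun_prop)
      (ae_of_all _ fun _ => ENNReal.ofReal_lt_top)]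
    simp [ENNReal.toReal_ofReal (hs0 _)]
  have hsi : ∀ f : Vec n → ℝ, Integrable f (volume.withDensity fun x => ENNReal.ofReal (s x)) →
      Integrable fun x => s x * f x := fun f hf => by
    have := (integrable_withDensity_iff_integrable_smul₀' (by fun_prop)
      (ae_of_all _ fun _ => ENNReal.ofReal_lt_top)).1 hf
    simpa [ENNReal.toReal_ofReal (hs0 _)] using this
  have main : ∀ f : Vec n → ℝ, Measurable f → (∀ x, |f x| ≤ 1 + ‖x‖ ^ 2) →
      Integrable (fun x => ((a x).toReal - s x * n₀) * f x) ∧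
      |∫ x, ((a x).toReal - s x * n₀) * f x| ≤ D.toReal := fun f hf hfg => by
    have hb : ∀ x, ‖((a x).toReal - s x * n₀) * f x‖ ≤
        (1 + ‖x‖ ^ 2) * |(a x).toReal - s x * n₀| := fun x => by
      rw [norm_mul, mul_comm]
      exact mul_le_mul_of_nonneg_right (hfg x) (abs_nonneg _)
    refine ⟨iD.mono' (by fun_prop) (ae_of_all _ hb), ?_⟩
    rw [← eD]
    exact norm_integral_le_of_norm_le iD (ae_of_all _ hb)
  have i1 : Integrable fun x => s x := by
    simpa using hsi (fun _ => 1) (integrable_const 1)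
  have e1 : ∫ x, s x = 1 := by
    simpa using (hsint fun _ => 1).symm
  have hone := main (fun _ => 1) measurable_const fun x => by simp
  have hZe : ∫ x, (a x).toReal = Z.toReal :=
    integral_toReal ha.aemeasurable (ae_of_all _ fun x => (ha' x).lt_top)
  have ia : Integrable fun x => (a x).toReal := integrable_toReal_of_lintegral_ne_top
    ha.aemeasurable hZ'
  -- The test function `1` compares the masses, since `s` integrates to one.
  have hdiff : |Z.toReal - n₀| ≤ D.toReal := by
    have := hone.2
    simp only [mul_one] at this
    rwa [integral_sub ia (i1.mul_const n₀), hZe, integral_mul_const, e1, one_mul] at this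
  refine dg_le fun f hf hfg => ?_
  obtain ⟨if1, hf1⟩ := main f hf hfg
  have isf := hsi f (integrable_of_weight hf hfg hi)
  have iaf : Integrable fun x => (a x).toReal * f x := by
    convert! if1.add (isf.const_mul n₀) using 1
    funext x
    simp only [Pi.add_apply]
    ring
  have hms : |∫ x, s x * f x| ≤ m := by
    rw [← hsint]
    exact (abs_integral_le_of_weight hfg hi).trans hm
  have eaf : ∫ x, f x ∂(volume.withDensity fun x => a x / Z) =
      Z.toReal⁻¹ * ∫ x, (a x).toReal * f x := by
    rw [integral_withDensity_eq_integral_toReal_smul (by fun_prop) (ae_of_all _ fun x =>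
      ENNReal.div_lt_top (ha' x) (ENNReal.toReal_pos_iff.1 hZ0).1.ne'), ← integral_const_mul]
    refine integral_congr_ae (ae_of_all _ fun x => ?_)
    simp only [ENNReal.toReal_div, smul_eq_mul]
    ring
  have esub : ∫ x, ((a x).toReal - s x * n₀) * f x =
      (∫ x, (a x).toReal * f x) - n₀ * ∫ x, s x * f x := by
    rw [← integral_const_mul, ← integral_sub iaf (isf.const_mul n₀)]
    refine integral_congr_ae (ae_of_all _ fun x => ?_)
    simp only
    ring
  rw [← ENNReal.ofReal_toReal hDtop, ← ENNReal.ofReal_mul hc.le, hsint, eaf]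
  refine ENNReal.ofReal_le_ofReal ?_
  -- The error splits into the error of the mass, weighted by an integral against `s`, and the
  -- unnormalized error; both are at most `D` up to the factors in the constant.
  have e : (∫ x, s x * f x) - Z.toReal⁻¹ * ∫ x, (a x).toReal * f x =
      Z.toReal⁻¹ * ((Z.toReal - n₀) * (∫ x, s x * f x) -
        ∫ x, ((a x).toReal - s x * n₀) * f x) := by
    rw [esub]; field_simp; ring
  rw [e, abs_mul, abs_of_pos (inv_pos.2 hZ0)]
  calc _ ≤ z₀⁻¹ * (D.toReal * m + D.toReal) := by
        refine mul_le_mul (by gcongr) ?_ (abs_nonneg _) (by positivity)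
        refine (abs_sub _ _).trans (add_le_add ?_ hf1)
        rw [abs_mul]
        exact mul_le_mul hdiff hms (abs_nonneg _) ENNReal.toReal_nonneg
    _ = _ := by ring

lemma fourthMomentLE_of_lintegral_le {ι : Type*} [Fintype ι] {μ : Measure (EuclideanSpace ℝ ι)}
    [IsProbabilityMeasure μ] {R : ℝ} (hR : 0 ≤ R)
    (h : ∫⁻ x, ENNReal.ofReal (‖x‖ ^ 4) ∂μ ≤ ENNReal.ofReal R) : FourthMomentLE R μ where
  prob := inferInstance
  integrable := by
    refine ⟨by fun_prop, ?_⟩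
    rw [hasFiniteIntegral_iff_ofReal (ae_of_all _ fun x => by positivity)]
    exact h.trans_lt ENNReal.ofReal_lt_top
  integral_le := by
    rw [integral_eq_lintegral_of_nonneg_ae (ae_of_all _ fun x => by positivity) (by fun_prop)]
    exact ENNReal.toReal_le_of_le_ofReal hR h

end Normalization

/-! ### Lower bound of the evidence and propagation of moments -/

section Conditioning

variable {du dy : ℕ} {κΨ κh ℓh : ℝ} {Ψ : Vec du → Vec du} {h : Vec du → Vec dy}
  {S : Matrix (Fin du) (Fin du) ℝ} {Γ : Matrix (Fin dy) (Fin dy) ℝ} {μ ν : Measure (Vec du)} {R : ℝ}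

@[fun_prop]
lemma measurable_jointDensity_slice [SFinite μ] (hΨ : Measurable Ψ) (hh : Measurable h)
    (y : Vec dy) : Measurable fun u => jointDensity Ψ h S Γ μ u y := by
  have := measurable_predDensity (S := S) (μ := μ) hΨ
  unfold jointDensity liftDensity
  fun_prop

/-- Integration against a slice of the joint density is integration of the likelihood. -/
lemma lintegral_mul_jointDensity [SFinite μ] (hΨ : Measurable Ψ) (hh : Measurable h)
    (hΓ : Γ.PosDef) (y : Vec dy) {F : Vec du → ℝ≥0∞} (hF : Measurable F) :
    ∫⁻ u, F u * jointDensity Ψ h S Γ μ u y =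
      ∫⁻ z, F z.u * ENNReal.ofReal (gaussDensity Γ (y - h z.u)) ∂(QP Ψ h S Γ μ) := by
  have hp := measurable_predDensity (S := S) (μ := μ) hΨ
  have hj := measurable_jointDensity (S := S) (Γ := Γ) (μ := μ) hΨ hh
  rw [QP, ofJointDensity, lintegral_withDensity_eq_lintegral_mul _ hj (by fun_prop),
    lintegral_joint (by fun_prop)]
  refine lintegral_congr fun u => ?_
  simp only [Pi.mul_apply, joint_u, joint_y, jointDensity, liftDensity, mul_assoc]
  rw [lintegral_mul_const _ (by fun_prop), lintegral_gaussDensity hΓ, one_mul]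
  ring

/-- The evidence is the mean likelihood `N(h(u), Γ)(y)`, at least a constant times `exp (-k (1 +
‖z‖²))`. As in Jensen's inequality, a bound on the second moment bounds such a mean from below. -/
lemma exists_le_lintegral_jointDensity (κΨ κh ℓh : ℝ) (hS : S.PosDef) (hΓ : Γ.PosDef) (R κy : ℝ) :
    ∃ z₀ : ℝ, 0 < z₀ ∧ ∀ (Ψ : Vec du → Vec du) (h : Vec du → Vec dy), VectorFields κΨ κh ℓh Ψ h →
      ∀ μ, FourthMomentLE R μ → ∀ y : Vec dy, ‖y‖ ≤ κy →
        ENNReal.ofReal z₀ ≤ ∫⁻ u, jointDensity Ψ h S Γ μ u y := by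
  obtain ⟨R', hR'⟩ := exists_fourthMomentLE_QP (du := du) (dy := dy) κΨ κh ℓh hS hΓ R
  obtain ⟨c, hc, hcΓ⟩ := exists_mul_norm_sq_le_quad hΓ
  set A : ℝ := κy + κh with hA
  set k : ℝ := 1 / 2 * (c⁻¹ * (A ^ 2 + κh ^ 2)) with hk
  have hk0 : 0 ≤ k := by positivity
  set m : ℝ := k * (2 * (1 + R')) with hm
  refine ⟨gaussConst Γ * Real.exp (-m), mul_pos (gaussConst_pos hΓ) (Real.exp_pos _),
    fun Ψ h H μ hμ y hy => ?_⟩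
  have := hμ.prob
  have hQ := hR' Ψ h H μ hμ
  have := hQ.prob
  have hh := H.measurable_h
  have e := lintegral_mul_jointDensity (S := S) (μ := μ) H.measurable_Ψ hh hΓ y
    (F := fun _ => 1) measurable_const
  simp only [one_mul] at e
  rw [e]
  -- The tangent line of the exponential at `-m`. As `m` dominates the mean of `k (1 + ‖z‖²)`, the
  -- last factor on the left has mean at least one.
  have hpt : ∀ z : Joint du dy, gaussConst Γ * (Real.exp (-m) * (1 + m - k * (1 + ‖z‖ ^ 2))) ≤
      gaussDensity Γ (y - h z.u) := fun z => by
    have h1 : ‖y - h z.u‖ ≤ A + κh * ‖z.u‖ := (norm_sub_le _ _).trans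
      ((add_le_add hy (H.growth_h _)).trans (by rw [hA]; linarith))
    have h2 : ‖y - h z.u‖ ^ 2 ≤ (A ^ 2 + κh ^ 2) * (1 + ‖z‖ ^ 2) := by
      calc ‖y - h z.u‖ ^ 2 ≤ (A + κh * ‖z.u‖) ^ 2 := by gcongr
        _ ≤ (A ^ 2 + κh ^ 2) * (1 + ‖z.u‖ ^ 2) := by nlinarith [sq_nonneg (A * ‖z.u‖ - κh)]
        _ ≤ _ := by gcongr; exact z.norm_u_le
    have h3 : 1 / 2 * quad Γ⁻¹ (y - h z.u) ≤ k * (1 + ‖z‖ ^ 2) := by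
      calc _ ≤ 1 / 2 * (c⁻¹ * ((A ^ 2 + κh ^ 2) * (1 + ‖z‖ ^ 2))) := by
            gcongr; exact (quad_inv_le hΓ hc hcΓ _).trans (by gcongr)
        _ = _ := by rw [hk]; ring
    rw [gaussDensity_eq]
    refine mul_le_mul_of_nonneg_left ?_ (gaussConst_pos hΓ).le
    calc _ ≤ Real.exp (-m) * Real.exp (m - k * (1 + ‖z‖ ^ 2)) := by
          gcongr
          linarith [Real.add_one_le_exp (m - k * (1 + ‖z‖ ^ 2))]
      _ ≤ _ := by rw [← Real.exp_add]; exact Real.exp_le_exp.2 (by linarith)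
  have hw := hQ.integrable_weight
  have hwle := hQ.integral_weight_le
  have ig : Integrable (fun z : Joint du dy => gaussDensity Γ (y - h z.u)) (QP Ψ h S Γ μ) :=
    (integrable_const (gaussConst Γ)).mono' (by fun_prop : Measurable fun z : Joint du dy =>
      gaussDensity Γ (y - h z.u)).aestronglyMeasurable (ae_of_all _ fun z => by
      rw [Real.norm_of_nonneg (gaussDensity_pos hΓ _).le]; exact gaussDensity_le hΓ _)
  rw [← ofReal_integral_eq_lintegral_ofReal ig (ae_of_all _ fun z => (gaussDensity_pos hΓ _).le)]
  refine ENNReal.ofReal_le_ofReal ?_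
  refine le_trans ?_ (integral_mono ((((integrable_const (1 + m)).sub
    (hw.const_mul k)).const_mul _).const_mul _) ig hpt)
  simp only [integral_const_mul, Pi.sub_apply]
  rw [integral_sub (integrable_const _) (hw.const_mul k), integral_const_mul]
  refine mul_le_mul_of_nonneg_left ?_ (gaussConst_pos hΓ).le
  refine le_mul_of_one_le_right (Real.exp_pos _).le ?_
  have : k * ∫ z, (1 + ‖z‖ ^ 2) ∂(QP Ψ h S Γ μ) ≤ m := by rw [hm]; gcongr
  simp only [integral_const, probReal_univ, smul_eq_mul, one_mul]
  linarith

lemma lintegral_jointDensity_ne_top [IsProbabilityMeasure μ] (hΨ : Measurable Ψ)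
    (hh : Measurable h) (hS : S.PosDef) (hΓ : Γ.PosDef) (y : Vec dy) :
    ∫⁻ u, jointDensity Ψ h S Γ μ u y ≠ ⊤ := by
  have := isProbabilityMeasure_QP (μ := μ) hΨ hh hS hΓ
  have e := lintegral_mul_jointDensity (S := S) (μ := μ) hΨ hh hΓ y
    (F := fun _ => 1) measurable_const
  simp only [one_mul] at e
  rw [e]
  refine ((lintegral_mono fun z => ENNReal.ofReal_le_ofReal (gaussDensity_le hΓ _)).trans_lt ?_).ne
  simp

/-- Conditioning reweights the predicted state by the likelihood, which is bounded, and divides by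
the evidence, which is bounded below. -/
lemma exists_fourthMomentLE_condition (κΨ κh ℓh : ℝ) (hS : S.PosDef) (hΓ : Γ.PosDef) (R κy : ℝ) :
    ∃ R' : ℝ, ∀ (Ψ : Vec du → Vec du) (h : Vec du → Vec dy), VectorFields κΨ κh ℓh Ψ h →
      ∀ μ, FourthMomentLE R μ → ∀ y : Vec dy, ‖y‖ ≤ κy →
        FourthMomentLE R' (condition y (jointDensity Ψ h S Γ μ)) := by
  obtain ⟨R', hR'⟩ := exists_fourthMomentLE_QP (du := du) (dy := dy) κΨ κh ℓh hS hΓ R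
  obtain ⟨z₀, hz₀, hZ⟩ := exists_le_lintegral_jointDensity (du := du) (dy := dy) κΨ κh ℓh hS hΓ R κy
  refine ⟨z₀⁻¹ * (gaussConst Γ * R'), fun Ψ h H μ hμ y hy => ?_⟩
  have := hμ.prob
  have hQ := hR' Ψ h H μ hμ
  have hΨ := H.measurable_Ψ
  have hh := H.measurable_h
  have hj := measurable_jointDensity_slice (S := S) (Γ := Γ) (μ := μ) hΨ hh y
  have hZtop := lintegral_jointDensity_ne_top (μ := μ) hΨ hh hS hΓ y
  have hZle := hZ Ψ h H μ hμ y hy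
  set Z := ∫⁻ u, jointDensity Ψ h S Γ μ u y with hZdef
  have hZ0 : Z ≠ 0 := fun h0 => by
    rw [h0, nonpos_iff_eq_zero, ENNReal.ofReal_eq_zero] at hZle; linarith
  have hint : ∀ F : Vec du → ℝ≥0∞, Measurable F →
      ∫⁻ u, F u ∂(condition y (jointDensity Ψ h S Γ μ)) =
        Z⁻¹ * ∫⁻ u, F u * jointDensity Ψ h S Γ μ u y := fun F hF => by
    rw [condition, lintegral_withDensity_eq_lintegral_mul _ (by fun_prop) hF,
      ← lintegral_const_mul _ (by fun_prop)]
    refine lintegral_congr fun u => ?_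
    rw [Pi.mul_apply, ENNReal.div_eq_inv_mul]
    ring
  have : IsProbabilityMeasure (condition y (jointDensity Ψ h S Γ μ)) := ⟨by
    rw [← lintegral_one, hint _ measurable_const]
    simp only [one_mul]
    exact ENNReal.inv_mul_cancel hZ0 hZtop⟩
  have hG := (gaussConst_pos hΓ).le
  have hR0 := hQ.nonneg
  refine fourthMomentLE_of_lintegral_le (by positivity) ?_
  rw [hint _ (by fun_prop), lintegral_mul_jointDensity hΨ hh hΓ y (by fun_prop),
    ENNReal.ofReal_mul (by positivity), ENNReal.ofReal_inv_of_pos hz₀]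
  refine mul_le_mul' (ENNReal.inv_le_inv.2 hZle) ?_
  calc _ ≤ ∫⁻ z, ENNReal.ofReal (gaussConst Γ * ‖z‖ ^ 4) ∂(QP Ψ h S Γ μ) := by
        refine lintegral_mono fun z => ?_
        rw [← ENNReal.ofReal_mul (by positivity), mul_comm]
        refine ENNReal.ofReal_le_ofReal ?_
        have := z.norm_u_le
        gcongr
        exact gaussDensity_le hΓ _
    _ = ENNReal.ofReal (∫ z, gaussConst Γ * ‖z‖ ^ 4 ∂(QP Ψ h S Γ μ)) :=
        (ofReal_integral_eq_lintegral_ofReal (hQ.integrable.const_mul _)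
          (ae_of_all _ fun z => by positivity)).symm
    _ ≤ _ := by
        refine ENNReal.ofReal_le_ofReal ?_
        rw [integral_const_mul]
        gcongr
        exact hQ.integral_le

lemma exists_fourthMomentLE_kalmanTransport (κΨ κh ℓh : ℝ) (hS : S.PosDef) (hΓ : Γ.PosDef)
    (R κy : ℝ) :
    ∃ R' : ℝ, ∀ (Ψ : Vec du → Vec du) (h : Vec du → Vec dy), VectorFields κΨ κh ℓh Ψ h →
      ∀ μ, FourthMomentLE R μ → ∀ y : Vec dy, ‖y‖ ≤ κy →
        FourthMomentLE R' (kalmanTransport y (QP Ψ h S Γ μ)) := by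
  obtain ⟨R', hR'⟩ := exists_fourthMomentLE_QP (du := du) (dy := dy) κΨ κh ℓh hS hΓ R
  obtain ⟨lam, a, hlam, ha, hcov⟩ := exists_covBounds_QP (du := du) (dy := dy) κΨ κh ℓh hS hΓ R
  set κ : ℝ := du * (dy * a) * lam⁻¹
  have hκ : 0 ≤ κ := by positivity
  set c : ℝ := 8 * ((1 + κ) ^ 4 + (κ * κy) ^ 4) with hc
  have hc0 : 0 ≤ c := by positivity
  refine ⟨c * (1 + R'), fun Ψ h H μ hμ y hy => ?_⟩
  have hQ := hR' Ψ h H μ hμ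
  have := hQ.prob
  have hg := (hcov Ψ h H μ hμ).norm_gain_le hlam ha.le
  have hm := measurable_aff (gain (cov (QP Ψ h S Γ μ))) y
  rw [kalmanTransport_eq]
  set A := gain (cov (QP Ψ h S Γ μ))
  have hle : ∀ z, ‖aff A y z‖ ^ 4 ≤ c * (1 + ‖z‖ ^ 4) := fun z => by
    calc ‖aff A y z‖ ^ 4 ≤ ((1 + κ) * ‖z‖ + κ * κy) ^ 4 := by
          gcongr; exact norm_aff_le hg hy z
      _ ≤ 8 * (((1 + κ) * ‖z‖) ^ 4 + (κ * κy) ^ 4) := add_pow_four_le _ _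
      _ ≤ _ := by
          rw [hc, mul_pow]
          have h1 : 0 ≤ (1 + κ) ^ 4 := by positivity
          have h2 : 0 ≤ (κ * κy) ^ 4 * ‖z‖ ^ 4 := by positivity
          linarith
  have habs : ∀ z, |‖aff A y z‖ ^ 4| ≤ c * (1 + ‖z‖ ^ 4) := fun z => by
    rw [abs_of_nonneg (by positivity)]; exact hle z
  refine ⟨Measure.isProbabilityMeasure_map hm.aemeasurable, ?_, ?_⟩
  · rw [integrable_map_measure (by fun_prop) hm.aemeasurable]
    exact hQ.integrable_of_le (by fun_prop) habs
  · rw [integral_map hm.aemeasurable (by fun_prop)]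
    exact (le_abs_self _).trans (hQ.integral_le_of_le (by fun_prop) hc0 habs)

end Conditioning

/-! ### Kalman transport of a Gaussian against conditioning -/

section GaussianApproximation

variable {du dy : ℕ} {κΨ κh ℓh : ℝ} {Ψ : Vec du → Vec du} {h : Vec du → Vec dy}
  {S : Matrix (Fin du) (Fin du) ℝ} {Γ : Matrix (Fin dy) (Fin dy) ℝ} {μ ν : Measure (Vec du)} {R : ℝ}

/-- The innovation vanishes on the slice. There the factored Gaussian density is the analysis
density at `u` times a constant, which is why Kalman transport conditions a Gaussian exactly. -/
lemma aff_joint_self (K : Vec dy →L[ℝ] Vec du) (ydag : Vec dy) (u : Vec du) :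
    aff K ydag (joint u ydag) = u := by
  simp [aff]

/-- The fibre estimate has a constant independent of `u`, so it can be integrated over `u` against
the weight; the resulting weighted `L¹` norm on the joint space is at most `dg`. -/
lemma exists_lintegral_slice_sub_le (hS : S.PosDef) (hΓ : Γ.PosDef) {lam : ℝ} (κ : ℝ)
    (hlam : 0 < lam) :
    ∃ C : ℝ, 0 < C ∧ ∀ (Ψ : Vec du → Vec du) (h : Vec du → Vec dy), Measurable Ψ → Measurable h →
      ∀ (μ : Measure (Vec du)) [IsProbabilityMeasure μ],
      Integrable (fun z => 1 + ‖z‖ ^ 2) (QP Ψ h S Γ μ) →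
      ∀ (Sw : Matrix (Fin du) (Fin du) ℝ) (Sy : Matrix (Fin dy) (Fin dy) ℝ),
      Sw.PosDef → Sy.PosDef → (∀ x, lam * ‖x‖ ^ 2 ≤ quad Sw x) →
      (∀ x, lam * ‖x‖ ^ 2 ≤ quad Sy x) → ∀ K : Vec dy →L[ℝ] Vec du, ‖K‖ ≤ κ →
      ∀ (mw : Vec du) (my ydag : Vec dy) (p : Measure (Joint du dy)),
      Integrable (fun z => 1 + ‖z‖ ^ 2) p →
      (p = volume.withDensity fun z => ENNReal.ofReal
        (gaussDensity Sw (aff K ydag z - mw) * gaussDensity Sy (z.y - my))) →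
      ∫⁻ u, ENNReal.ofReal ((1 + ‖u‖ ^ 2) * |(jointDensity Ψ h S Γ μ u ydag).toReal -
        gaussDensity Sw (u - mw) * gaussDensity Sy (ydag - my)|) ≤
        ENNReal.ofReal C * dg (QP Ψ h S Γ μ) p := by
  obtain ⟨C, hC, hslice⟩ := exists_ofReal_abs_slice_sub_le (du := du) (κ := κ) hΓ hlam
  refine ⟨C, hC, fun Ψ h hΨ hh μ _ hi Sw Sy hSw hSy hlw hly K hK mw my ydag p hip hp => ?_⟩
  set b : Joint du dy → ℝ := fun z =>
    gaussDensity Sw (aff K ydag z - mw) * gaussDensity Sy (z.y - my) with hb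
  have hbm : Measurable b := by fun_prop
  have hb0 : ∀ z, 0 ≤ b z := fun z => (mul_pos (gaussDensity_pos hSw _) (gaussDensity_pos hSy _)).le
  have hj := measurable_jointDensity (S := S) (Γ := Γ) (μ := μ) hΨ hh
  have hjr : ∀ u y, (jointDensity Ψ h S Γ μ u y).toReal =
      gaussDensity Γ (y - h u) * (predDensity Ψ S μ u).toReal := fun u y => by
    rw [jointDensity, liftDensity, ENNReal.toReal_mul,
      ENNReal.toReal_ofReal (gaussDensity_pos hΓ _).le]
  have hpm := measurable_predDensity (S := S) (μ := μ) hΨ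
  have hp' : p = volume.withDensity fun z => ENNReal.ofReal (b z) := hp
  subst hp'
  refine le_trans ?_ (mul_le_mul_right (lintegral_weight_mul_abs_sub_le_dg hj (by fun_prop)
    (fun z => jointDensity_ne_top hS _ _) (fun z => ENNReal.ofReal_ne_top) hi hip) _)
  simp only [ENNReal.toReal_ofReal (hb0 _)]
  rw [lintegral_joint (by fun_prop), ← lintegral_const_mul' _ _ ENNReal.ofReal_ne_top]
  refine lintegral_mono fun u => ?_
  simp only [joint_u, joint_y]
  have hr : 0 < (predDensity Ψ S μ u).toReal := ENNReal.toReal_pos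
    (predDensity_pos hΨ hS u).ne' (predDensity_ne_top hS u)
  have h1 := hslice Sw Sy hSw hSy hlw hly K hK u mw (h u) my ydag _ hr
  rw [aff_joint_self] at h1
  have hu0 : (0 : ℝ) ≤ 1 + ‖u‖ ^ 2 := by positivity
  simp only [hjr]
  rw [ENNReal.ofReal_mul hu0]
  calc _ ≤ ENNReal.ofReal (1 + ‖u‖ ^ 2) * (ENNReal.ofReal C * _) := by gcongr
    _ = ENNReal.ofReal C * ∫⁻ y, ENNReal.ofReal ((1 + ‖u‖ ^ 2) *
        |gaussDensity Γ (y - h u) * (predDensity Ψ S μ u).toReal - b (joint u y)|) := by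
        rw [mul_left_comm, ← lintegral_const_mul' _ _ ENNReal.ofReal_ne_top]
        simp only [ENNReal.ofReal_mul hu0]
        rfl
    -- The weight of the state component is at most that of the joint point.
    _ ≤ _ := by
        gcongr with y
        exact norm_le_norm_joint u y

/-- On a Gaussian measure the Kalman transport is conditioning, and conditioning is Lipschitz at
the joint laws of state and datum. -/
lemma exists_dg_kalmanTransport_gaussProj_le (κΨ κh ℓh : ℝ) (hS : S.PosDef) (hΓ : Γ.PosDef)
    (R κy : ℝ) :
    ∃ C : ℝ, 0 < C ∧ ∀ (Ψ : Vec du → Vec du) (h : Vec du → Vec dy), VectorFields κΨ κh ℓh Ψ h →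
      ∀ μ, FourthMomentLE R μ → ∀ y : Vec dy, ‖y‖ ≤ κy →
        dg (kalmanTransport y (gaussProj (QP Ψ h S Γ μ))) (condition y (jointDensity Ψ h S Γ μ)) ≤
          ENNReal.ofReal C * dg (QP Ψ h S Γ μ) (gaussProj (QP Ψ h S Γ μ)) := by
  obtain ⟨R', hR'⟩ := exists_fourthMomentLE_QP (du := du) (dy := dy) κΨ κh ℓh hS hΓ R
  obtain ⟨lam, a, hlam, ha, hcov⟩ := exists_covBounds_QP (du := du) (dy := dy) κΨ κh ℓh hS hΓ R
  obtain ⟨z₀, hz₀, hZ⟩ := exists_le_lintegral_jointDensity (du := du) (dy := dy) κΨ κh ℓh hS hΓ R κy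
  set κ : ℝ := du * (dy * a) * lam⁻¹
  have hκ : 0 ≤ κ := by positivity
  obtain ⟨c, hc, haff⟩ := exists_weight_aff_le (du := du) (dy := dy) κ κy hκ
  obtain ⟨C, hC, hslice⟩ := exists_lintegral_slice_sub_le (du := du) (dy := dy) hS hΓ κ hlam
  by_cases hR0 : 0 ≤ R'
  swap
  · exact ⟨1, one_pos, fun Ψ h H μ hμ => absurd (hR' Ψ h H μ hμ).nonneg hR0⟩
  set m : ℝ := c * (2 * (1 + R')) with hm
  have hm0 : 0 ≤ m := by positivity
  refine ⟨z₀⁻¹ * (m + 1) * C, by positivity, fun Ψ h H μ hμ y hy => ?_⟩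
  have := hμ.prob
  have hΨ := H.measurable_Ψ
  have hh := H.measurable_h
  have hQ := hR' Ψ h H μ hμ
  have := hQ.prob
  have hcQ := hcov Ψ h H μ hμ
  have hg := hcQ.norm_gain_le hlam ha.le
  set p := gaussProj (QP Ψ h S Γ μ) with hp
  have hcp : cov p = cov (QP Ψ h S Γ μ) := cov_gaussProj hQ.memLp_two
  have hcb : CovBounds lam a (cov p) := hcp ▸ hcQ
  rw [← hcp] at hg
  have hip : Integrable (fun z => 1 + ‖z‖ ^ 2) p :=
    integrable_weight_of_memLp (memLp_two_gaussProj _)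
  obtain ⟨mw, my, Sw, Sy, hSw, hSy, hlw, hly, hpa, hpd⟩ := exists_gaussian_density hlam hcb y
  have hm' := measurable_aff (gain (cov p)) y
  have hmap : IsProbabilityMeasure (p.map (aff (gain (cov p)) y)) :=
    Measure.isProbabilityMeasure_map hm'.aemeasurable
  have hle : ∀ z, 1 + ‖aff (gain (cov p)) y z‖ ^ 2 ≤ c * (1 + ‖z‖ ^ 2) := haff _ y hg hy
  have hia : Integrable (fun z => 1 + ‖aff (gain (cov p)) y z‖ ^ 2) p :=
    (hip.const_mul c).mono' (by fun_prop) (ae_of_all _ fun z => by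
      rw [Real.norm_of_nonneg (by positivity)]; exact hle z)
  have him : Integrable (fun x => 1 + ‖x‖ ^ 2) (p.map (aff (gain (cov p)) y)) := by
    rw [integrable_map_measure (by fun_prop) hm'.aemeasurable]
    exact hia
  have hmm : ∫ x, (1 + ‖x‖ ^ 2) ∂(p.map (aff (gain (cov p)) y)) ≤ m := by
    rw [integral_map hm'.aemeasurable (by fun_prop)]
    calc _ ≤ ∫ z, c * (1 + ‖z‖ ^ 2) ∂p := integral_mono hia (hip.const_mul c) hle
      _ = c * ∫ z, (1 + ‖z‖ ^ 2) ∂(QP Ψ h S Γ μ) := by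
          rw [integral_const_mul, hp, integral_weight_gaussProj hQ.memLp_two]
      _ ≤ m := by rw [hm]; gcongr; exact hQ.integral_weight_le
  rw [kalmanTransport_eq]
  rw [hpa] at hmap him hmm ⊢
  -- The comparison mass `n₀` is the evidence of the Gaussian projection, the constant factor of its
  -- slice.
  have key := dg_withDensity_div_le (n₀ := gaussDensity Sy (y - my))
    (measurable_jointDensity_slice hΨ hh y) (fun u => jointDensity_ne_top hS u y)
    (by fun_prop) (fun u => (gaussDensity_pos hSw _).le) hz₀ him hmm (hZ Ψ h H μ hμ y hy)
    (lintegral_jointDensity_ne_top hΨ hh hS hΓ y)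
  refine key.trans ?_
  rw [ENNReal.ofReal_mul (q := C) (by positivity), mul_assoc]
  gcongr
  exact hslice Ψ h hΨ hh μ hQ.integrable_weight Sw Sy hSw hSy hlw hly _ hg mw my y p hip hpd

end GaussianApproximation

/-! ### One filter step and induction over time -/

section Filters

variable {du dy : ℕ} {κΨ κh ℓh : ℝ} {Ψ : Vec du → Vec du} {h : Vec du → Vec dy}
  {S : Matrix (Fin du) (Fin du) ℝ} {Γ : Matrix (Fin dy) (Fin dy) ℝ} {μ ν : Measure (Vec du)} {R : ℝ}

/-- One step of the mean field ensemble Kalman filter against one step of the true filter. -/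
lemma exists_dg_kalmanTransport_condition_le (κΨ κh : ℝ) (hℓ : 0 ≤ ℓh) (hS : S.PosDef)
    (hΓ : Γ.PosDef) (R : ℝ) {κy : ℝ} (hκy : 0 ≤ κy) :
    ∃ C : ℝ≥0, ∀ (Ψ : Vec du → Vec du) (h : Vec du → Vec dy), VectorFields κΨ κh ℓh Ψ h →
      ∀ μ ν, FourthMomentLE R μ → FourthMomentLE R ν → ∀ y : Vec dy, ‖y‖ ≤ κy →
        dg (kalmanTransport y (QP Ψ h S Γ ν)) (condition y (jointDensity Ψ h S Γ μ)) ≤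
          C * (dg ν μ + dg (QP Ψ h S Γ μ) (gaussProj (QP Ψ h S Γ μ))) := by
  obtain ⟨R', hR'⟩ := exists_fourthMomentLE_QP (du := du) (dy := dy) κΨ κh ℓh hS hΓ R
  obtain ⟨lam, a, hlam, ha, hcov⟩ := exists_covBounds_QP (du := du) (dy := dy) κΨ κh ℓh hS hΓ R
  set κ : ℝ := du * (dy * a) * lam⁻¹
  have hκ : 0 ≤ κ := by positivity
  obtain ⟨c, hc, haff⟩ := exists_weight_aff_le (du := du) (dy := dy) κ κy hκ
  obtain ⟨C₁, -, h₁⟩ := exists_dg_kalmanTransport_QP_le (du := du) (dy := dy) κΨ κh hℓ hS hΓ R hκy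
  obtain ⟨C₂, -, h₂⟩ := exists_dg_QP_le (du := du) (dy := dy) κΨ κh ℓh hS hΓ R
  obtain ⟨C₃, -, h₃⟩ := exists_dg_kalmanTransport_gaussProj_le (du := du) (dy := dy) κΨ κh ℓh
    hS hΓ R κy
  refine ⟨C₁.toNNReal * C₂.toNNReal + c.toNNReal + C₃.toNNReal, fun Ψ h H μ ν hμ hν y hy => ?_⟩
  have hQ := hR' Ψ h H μ hμ
  have := hQ.prob
  set Q := QP Ψ h S Γ μ
  -- Equal covariances mean equal gains, so a single map transports both measures.
  have h4 : dg (kalmanTransport y Q) (kalmanTransport y (gaussProj Q)) ≤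
      ENNReal.ofReal c * dg Q (gaussProj Q) := by
    rw [kalmanTransport_eq, kalmanTransport_eq, cov_gaussProj hQ.memLp_two]
    exact dg_map_le (by fun_prop) hc
      (haff _ y ((hcov Ψ h H μ hμ).norm_gain_le hlam ha.le) hy)
  set G := dg Q (gaussProj Q)
  calc _ ≤ dg (kalmanTransport y (QP Ψ h S Γ ν)) (kalmanTransport y Q) +
        (dg (kalmanTransport y Q) (kalmanTransport y (gaussProj Q)) +
        dg (kalmanTransport y (gaussProj Q)) (condition y (jointDensity Ψ h S Γ μ))) :=
        dg_triangle.trans (add_le_add_right dg_triangle _)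
    _ ≤ ENNReal.ofReal C₁ * (ENNReal.ofReal C₂ * dg ν μ) +
        (ENNReal.ofReal c * G + ENNReal.ofReal C₃ * G) := by
        refine add_le_add ((h₁ Ψ h H μ ν hμ hν y hy).trans ?_)
          (add_le_add h4 (h₃ Ψ h H μ hμ y hy))
        gcongr
        exact h₂ Ψ h H ν μ hν hμ
    _ ≤ (ENNReal.ofReal C₁ * ENNReal.ofReal C₂ + ENNReal.ofReal c + ENNReal.ofReal C₃) *
        (dg ν μ + G) := by
        rw [mul_add, add_mul, add_mul, ← mul_assoc, ← add_mul]
        refine add_le_add ?_ ?_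
        · rw [add_assoc]; exact le_self_add
        · gcongr
          exact le_add_self
    _ = _ := by simp only [ENNReal.ofReal]; push_cast; rfl

lemma FourthMomentLE.mono {ι : Type*} [Fintype ι] {R R' : ℝ} {μ : Measure (EuclideanSpace ℝ ι)}
    (hμ : FourthMomentLE R μ) (hR : R ≤ R') : FourthMomentLE R' μ :=
  ⟨hμ.prob, hμ.integrable, hμ.integral_le.trans hR⟩

/-- For `q ≥ 4` one has `‖x‖⁴ ≤ 1 + ‖x‖^q`, on either side of the unit sphere. -/
lemma fourthMomentLE_of_isGaussian {n q : ℕ} (hq : 4 ≤ q) {M : ℝ} {μ : Measure (Vec n)}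
    [IsGaussian μ] (hM : moment q μ ≤ M) : FourthMomentLE (1 + M) μ where
  prob := inferInstance
  integrable := integrable_norm_pow_gaussian 4
  integral_le := by
    have hi := integrable_norm_pow_gaussian (ν := μ) q
    refine (integral_mono (integrable_norm_pow_gaussian 4) ((integrable_const 1).add hi)
      fun x => ?_).trans ?_
    · rcases le_total ‖x‖ 1 with hx | hx
      · exact (pow_le_one₀ (norm_nonneg x) hx).trans (le_add_of_nonneg_right (by positivity))
      · exact (pow_le_pow_right₀ hx hq).trans (le_add_of_nonneg_left zero_le_one)
    · rw [integral_add' (integrable_const 1) hi]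
      simpa [moment] using hM

/-- `μ` and `ν` are runs of length `J` of the true filter and of the mean field ensemble Kalman
filter, from the same initial law. -/
structure FilterPair (J : ℕ) (Ψ : Vec du → Vec du) (h : Vec du → Vec dy)
    (S : Matrix (Fin du) (Fin du) ℝ) (Γ : Matrix (Fin dy) (Fin dy) ℝ) (y : ℕ → Vec dy)
    (μ ν : ℕ → Measure (Vec du)) : Prop where
  init : ν 0 = μ 0
  true_step : IsTrueFilter J Ψ h S Γ y μ
  enkf_step : IsMeanFieldEnKF J Ψ h S Γ y ν

lemma exists_fourthMomentLE_filters (κΨ κh ℓh : ℝ) (hS : S.PosDef) (hΓ : Γ.PosDef)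
    (R₀ κy : ℝ) (J j : ℕ) (hj : j ≤ J) :
    ∃ R : ℝ, ∀ (Ψ : Vec du → Vec du) (h : Vec du → Vec dy), VectorFields κΨ κh ℓh Ψ h →
      ∀ y : ℕ → Vec dy, (∀ i, 1 ≤ i → i ≤ J → ‖y i‖ ≤ κy) →
      ∀ μ ν, FilterPair J Ψ h S Γ y μ ν → FourthMomentLE R₀ (μ 0) →
        FourthMomentLE R (μ j) ∧ FourthMomentLE R (ν j) := by
  induction j with
  | zero => exact ⟨R₀, fun Ψ h H y hy μ ν F h0 => ⟨h0, F.init ▸ h0⟩⟩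
  | succ j ih =>
    obtain ⟨R, hR⟩ := ih (by omega)
    obtain ⟨R₁, h₁⟩ := exists_fourthMomentLE_condition (du := du) (dy := dy) κΨ κh ℓh hS hΓ R κy
    obtain ⟨R₂, h₂⟩ := exists_fourthMomentLE_kalmanTransport (du := du) (dy := dy) κΨ κh ℓh
      hS hΓ R κy
    refine ⟨max R₁ R₂, fun Ψ h H y hy μ ν F h0 => ?_⟩
    obtain ⟨hμ, hν⟩ := hR Ψ h H y hy μ ν F h0
    have hyj := hy (j + 1) (by omega) hj
    rw [F.true_step j (by omega), F.enkf_step j (by omega)]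
    exact ⟨(h₁ Ψ h H _ hμ _ hyj).mono (le_max_left _ _),
      (h₂ Ψ h H _ hν _ hyj).mono (le_max_right _ _)⟩

/-- The one step bound is iterated from distance zero. Its constant at time `j` depends on a common
fourth moment bound of both filters at that time, which itself depends only on the initial bound and
the parameters. -/
lemma exists_dg_filters_le (κΨ κh : ℝ) (hℓ : 0 ≤ ℓh) (hS : S.PosDef) (hΓ : Γ.PosDef)
    (R₀ : ℝ) {κy : ℝ} (hκy : 0 ≤ κy) (J j : ℕ) (hj : j ≤ J) :
    ∃ C : ℝ≥0, ∀ (Ψ : Vec du → Vec du) (h : Vec du → Vec dy), VectorFields κΨ κh ℓh Ψ h →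
      ∀ y : ℕ → Vec dy, (∀ i, 1 ≤ i → i ≤ J → ‖y i‖ ≤ κy) →
      ∀ μ ν, FilterPair J Ψ h S Γ y μ ν → FourthMomentLE R₀ (μ 0) →
        dg (ν j) (μ j) ≤ C * maxGap J Ψ h S Γ μ := by
  induction j with
  | zero => exact ⟨0, fun Ψ h H y hy μ ν F h0 => by rw [F.init, dg_self]; exact zero_le⟩
  | succ j ih =>
    obtain ⟨C, hC⟩ := ih (by omega)
    obtain ⟨R, hR⟩ := exists_fourthMomentLE_filters (du := du) (dy := dy) κΨ κh ℓh hS hΓ R₀ κy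
      J j (by omega)
    obtain ⟨C', hC'⟩ := exists_dg_kalmanTransport_condition_le (du := du) (dy := dy) κΨ κh hℓ
      hS hΓ R hκy
    refine ⟨C' * (C + 1), fun Ψ h H y hy μ ν F h0 => ?_⟩
    obtain ⟨hμ, hν⟩ := hR Ψ h H y hy μ ν F h0
    rw [F.true_step j (by omega), F.enkf_step j (by omega)]
    refine (hC' Ψ h H _ _ hμ hν _ (hy (j + 1) (by omega) hj)).trans ?_
    push_cast
    rw [mul_assoc, add_mul, one_mul]
    gcongr
    · exact hC Ψ h H y hy μ ν F h0
    · exact Finset.le_sup (f := fun j => dg (QP Ψ h S Γ (μ j)) (gaussProj (QP Ψ h S Γ (μ j))))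
        (Finset.mem_range.2 (by omega))

lemma maxGap_lt_top {J : ℕ} (hS : S.PosDef) (hΓ : Γ.PosDef) {R₀ κy : ℝ}
    (H : VectorFields κΨ κh ℓh Ψ h) {y : ℕ → Vec dy} (hy : ∀ i, 1 ≤ i → i ≤ J → ‖y i‖ ≤ κy)
    {μ ν : ℕ → Measure (Vec du)} (F : FilterPair J Ψ h S Γ y μ ν) (h0 : FourthMomentLE R₀ (μ 0)) :
    maxGap J Ψ h S Γ μ < ⊤ := by
  refine (Finset.sup_lt_iff ENNReal.zero_lt_top).2 fun j hj => ?_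
  obtain ⟨R, hR⟩ := exists_fourthMomentLE_filters (du := du) (dy := dy) κΨ κh ℓh hS hΓ R₀ κy
    J j (Finset.mem_range.1 hj).le
  obtain ⟨R', hR'⟩ := exists_fourthMomentLE_QP (du := du) (dy := dy) κΨ κh ℓh hS hΓ R
  have hQ := hR' Ψ h H _ (hR Ψ h H y hy μ ν F h0).1
  exact dg_lt_top hQ.integrable_weight (integrable_weight_of_memLp (memLp_two_gaussProj _))

end Filters

end EnKF

end

/-! ### The main theorem -/

theorem mainTheorem1 (du dy J : ℕ) (hJ : 1 ≤ J) (M κy κΨ κh ℓh : ℝ)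
    (hκy : 0 < κy) (hκΨ : 0 < κΨ) (hκh : 0 < κh) (hℓh : 0 < ℓh)
    (S : Matrix (Fin du) (Fin du) ℝ) (Γ : Matrix (Fin dy) (Fin dy) ℝ) :
    ∃ C : ℝ≥0, ∀ (Ψ : EnKF.Vec du → EnKF.Vec du) (h : EnKF.Vec du → EnKF.Vec dy)
      (y : ℕ → EnKF.Vec dy) (μ μEK : ℕ → Measure (EnKF.Vec du)),
      Measurable Ψ →
      EnKF.AssumptionH J κy κΨ κh ℓh Ψ h S Γ y →
      IsGaussian (μ 0) →
      μEK 0 = μ 0 →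
      EnKF.moment (max (3 + du) (4 + dy)) (μ 0) ≤ M →
      EnKF.IsTrueFilter J Ψ h S Γ y μ →
      EnKF.IsMeanFieldEnKF J Ψ h S Γ y μEK →
      EnKF.maxGap J Ψ h S Γ μ < ⊤ ∧
        EnKF.dg (μEK J) (μ J) ≤ C * EnKF.maxGap J Ψ h S Γ μ := by
  -- The constant is chosen before the standing assumption is available; if a noise covariance is
  -- not positive definite, that assumption fails and any constant works.
  by_cases hpos : S.PosDef ∧ Γ.PosDef
  swap
  · exact ⟨0, fun Ψ h y μ μEK _ H => absurd ⟨H.posDef_S, H.posDef_Γ⟩ hpos⟩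
  obtain ⟨hS, hΓ⟩ := hpos
  obtain ⟨C, hC⟩ := EnKF.exists_dg_filters_le (du := du) (dy := dy) κΨ κh hℓh.le hS hΓ (1 + M)
    hκy.le J J le_rfl
  refine ⟨C, fun Ψ h y μ μEK hΨ H hG h0 hM hμ hν => ?_⟩
  have V : EnKF.VectorFields κΨ κh ℓh Ψ h := ⟨hΨ, H.growth_Ψ, H.growth_h, H.lipschitz_h⟩
  have F : EnKF.FilterPair J Ψ h S Γ y μ μEK := ⟨h0, hμ, hν⟩
  have hm : EnKF.FourthMomentLE (1 + M) (μ 0) := EnKF.fourthMomentLE_of_isGaussian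
    (le_max_of_le_right (Nat.le_add_right 4 dy)) hM
  exact ⟨EnKF.maxGap_lt_top hS hΓ V H.data_bound F hm, hC Ψ h V y H.data_bound μ μEK F hm⟩
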